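/- **Setting.** Let $k_{rw},k_{rn}\in C^2([0,1])$ be strictly convex with $k_{rw}(0)=0$, $k_{rw}'>0$ on $(0,1]$, $k_{rn}(1)=0$, $k_{rn}'<0$ on $[0,1)$. Let $p_c^{(i)},p_c^{(d)}\in C^1((0,1])$ vanish at $1$, with ${p_c^{(i)}}',{p_c^{(d)}}'<0$ and $p_c^{(i)}<p_c^{(d)}$ on $(0,1)$. For $M>0$ and $N_g\in\mathbb R$ put $$f=\frac{k_{rw}}{k_{rw}+Mk_{rn}},\qquad h=k_{rn}f,\qquad F=f+N_gh,$$ and assume (Scenario A) that $F'>0$ on $(0,1)$ and that there is $S_o\in(0,1)$ with $F''(S_o)=0$, $F''>0$ on $(0,S_o)$, $F''<0$ on $(S_o,1)$. Fix $0<S_B<S_o$. For $\alpha>S_B$ let $c(\alpha)=\frac{F(\alpha)-F(S_B)}{\alpha-S_B}$ and $$\mathcal G(S;S_B,\alpha)=\frac{F(S)-F(S_B)-c(\alpha)(S-S_B)}{h(S)} .$$ Let $\bar S\in(S_B,1)$ be the point with $F'(\bar S)=c(\bar S)$. For $\alpha\in(S_B,\bar S)$ let $\beta(\alpha)\in[\bar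 S,1]$ denote (if it exists) the third intersection of the graph of $F$ with the line through $(S_B,F(S_B))$ and $(\alpha,F(\alpha))$, and $\gamma(\alpha)$ (if it exists) the smallest $\gamma\in(S_B,1)$ with $\int_{S_B}^{\gamma}\mathcal G(S;S_B,\alpha)\,dS=0$. Let $S_*\in(S_B,\bar S)$ be the point with $\gamma(S_*)=\beta(S_*)$. (It exists, for instance, if $\mathcal G(\cdot;S_B,\alpha)$ is non-integrable near $S=1$ for each $S_B\le\alpha\le\bar S$.) Let $S_T\in(S_B,S_*]$, $c=c(S_T)$, $\mathcal G(S)=\mathcal G(S;S_B,S_T)$, $E^j=(S_T,p_c^{(j)}(S_T))$ and $$\tau_j=\frac{\big({p_c^{(j)}}'(S_T)\big)^2}{4c\,\mathcal G'(S_T)}\quad (j\in\{i,d\}),\qquad \text{and assume } \tau_i<\tau_d .$$ For $\tau>0$ consider, in the strip $0<S<1$, $$\mathrm{(TW)}\qquad S'=\frac1{c\tau}\mathcal F(S,p),\qquad p'=\mathcal G(S),\qquad \mathcal F(S,p)=\begin{cases}p_c^{(d)}(S)-p& p>p_c^{(d)}(S),\\ 0& p_c^{(i)}(S)\le p\le p_c^{(d)}(S),\\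 p_c^{(i)}(S)-p& p<p_c^{(i)}(S).\end{cases}$$ Let $S_m(\tau,S_T)$ be the supremum of those $b\in(S_B,1)$ for which there is $w$, continuous on $[S_B,b)$, with $w(S_B)=p_c^{(i)}(S_B)$ and, on $(S_B,b)$, $w<p_c^{(i)}$ and $w'=\frac{c\tau\mathcal G}{p_c^{(i)}-w}$. Let $\tau_m=\sup\{\tau>0:\ S_m(\tau,S_T)=S_T\}$. A *turn* around the segment $\overline{E^iE^d}$ is a passage of the curve $(S,p)$ from the part $p<p_c^{(i)}(S_T)$ of the line $S=S_T$ through $S>S_T$ to the part $p>p_c^{(d)}(S_T)$ of this line, and then through $S<S_T$ back to the part $p<p_c^{(i)}(S_T)$. The curve *turns finitely often* if it makes finitely many turns and does not meet the line $S=S_T$ for large $\xi$; it *turns infinitely often* if from some $\xi$ on it is an infinite succession of consecutive turns. **Theorem.** $0<\tau_m\le\tau_i$. For every $\tau>0$ there is a non-constant solution $(S,p):\mathbb R\to(0,1)\times\mathbb R$ of (TW) with $(S,p)(\xi)\to(S_B,p_c^{(i)}(S_B))$ as $\xi\to-\infty$, and every such solution satisfies $$S(-\infty)=S_B,\qquad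 S(+\infty)=S_T,\qquad p'(-\infty)=p'(+\infty)=0 ,$$ and has the following behaviour as $\xi\to\infty$. - If $\tau\le\tau_m$, then $p<p_c^{(i)}(S)$ for all $\xi$, $S$ is strictly increasing, $p$ is strictly decreasing, and $(S,p)\to E^i$. - If $\tau_m<\tau\le\tau_i$, then the orbit passes the line $S=S_T$ below $E^i$, turns finitely often around $\overline{E^iE^d}$, and $(S,p)\to E^i$ or $(S,p)\to E^d$. - If $\tau_i<\tau\le\tau_d$, where in the borderline case $\tau=\tau_d$ it is assumed in addition that ${p_c^{(d)}}'$ is Hölder continuous at $S_T$ (that is, $|{p_c^{(d)}}'(S)-{p_c^{(d)}}'(S_T)|\le C|S-S_T|^{a}$ near $S_T$ for some $C$ and some $a>0$), then the orbit passes the line $S=S_T$ below $E^i$, turns finitely often around $\overline{E^iE^d}$, and $(S,p)\to E^d$. - If $\tau>\tau_d$, then the orbit turns infinitely often around $\overline{E^iE^d}$ and its distance to $\overline{E^iE^d}$ tends to $0$. -/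

import Mathlib

open Set Filter Topology

namespace TwoPhase

/-- Constitutive data of the two-phase model without hysteresis in the relative permeabilities:
wetting / non-wetting relative permeabilities `krw`, `krn`, infiltration / drainage capillary
pressures `pci`, `pcd`, viscosity ratio `M` and gravity number `Ng`. -/
structure Medium where
  krw : ℝ → ℝ
  krn : ℝ → ℝ
  pci : ℝ → ℝ
  pcd : ℝ → ℝ
  M : ℝ
  Ng : ℝ
  M_pos : 0 < M
  pci_contDiffOn : ContDiffOn ℝ 1 pci (Ioc 0 1)
  pcd_contDiffOn : ContDiffOn ℝ 1 pcd (Ioc 0 1)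
  pci_one : pci 1 = 0
  pcd_one : pcd 1 = 0
  pci_deriv_neg : ∀ S ∈ Ioo (0 : ℝ) 1, deriv pci S < 0
  pcd_deriv_neg : ∀ S ∈ Ioo (0 : ℝ) 1, deriv pcd S < 0
  pci_lt_pcd : ∀ S ∈ Ioo (0 : ℝ) 1, pci S < pcd S
  krw_contDiffOn : ContDiffOn ℝ 2 krw (Icc 0 1)
  krw_deriv_pos : ∀ S ∈ Ioc (0 : ℝ) 1, 0 < derivWithin krw (Icc 0 1) S
  krw_zero : krw 0 = 0
  krw_strictConvexOn : StrictConvexOn ℝ (Icc 0 1) krw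
  krn_contDiffOn : ContDiffOn ℝ 2 krn (Icc 0 1)
  krn_deriv_neg : ∀ S ∈ Ico (0 : ℝ) 1, derivWithin krn (Icc 0 1) S < 0
  krn_one : krn 1 = 0
  krn_strictConvexOn : StrictConvexOn ℝ (Icc 0 1) krn

namespace Medium

noncomputable section

/-- Fractional flow function. -/
def f (m : Medium) (S : ℝ) : ℝ := m.krw S / (m.krw S + m.M * m.krn S)

def h (m : Medium) (S : ℝ) : ℝ := m.krn S * m.f S

/-- Flux function including gravity. -/
def F (m : Medium) (S : ℝ) : ℝ := m.f S + m.Ng * m.h S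

/-- Scenario A: `F` is strictly increasing and convex-concave with inflection point `So`.
(Twice continuous differentiability, `F 0 = 0` and `F 1 = 1` hold by construction.) -/
structure ScenarioA (m : Medium) (So : ℝ) : Prop where
  F_deriv_pos : ∀ S ∈ Ioo (0 : ℝ) 1, 0 < deriv m.F S
  So_mem : So ∈ Ioo (0 : ℝ) 1
  inflection : deriv (deriv m.F) So = 0
  convex_part : ∀ S ∈ Ioo 0 So, 0 < deriv (deriv m.F) S
  concave_part : ∀ S ∈ Ioo So 1, deriv (deriv m.F) S < 0

/-- Slope of the chord of `F` from `SB` to `a`; for `a = ST` this is the wave speed. -/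
def speed (m : Medium) (SB a : ℝ) : ℝ := (m.F a - m.F SB) / (a - SB)

/-- The line through `(SB, F SB)` and `(a, F a)`. -/
def chord (m : Medium) (SB a S : ℝ) : ℝ := m.F SB + m.speed SB a * (S - SB)

/-- `G S = (F S - chord S) / h S`. -/
def G (m : Medium) (SB a S : ℝ) : ℝ := (m.F S - m.chord SB a S) / m.h S

/-- `b` is the point `S̄` where the chord from `SB` is tangent to the graph of `F`. -/
def IsSBar (m : Medium) (SB b : ℝ) : Prop :=
  b ∈ Ioo SB 1 ∧ deriv m.F b = (m.F b - m.F SB) / (b - SB)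

/-- `b = β(a)`: the third intersection point, in `[S̄, 1]`, of the graph of `F` with the line
through `(SB, F SB)` and `(a, F a)`. -/
def IsBeta (m : Medium) (SB SBar a b : ℝ) : Prop :=
  b ∈ Icc SBar 1 ∧ m.F b = m.chord SB a b

/-- `g = γ(a)`: the first nontrivial zero of `S ↦ ∫_{SB}^S G(·; SB, a)`. -/
def IsGamma (m : Medium) (SB a g : ℝ) : Prop :=
  IsLeast {S : ℝ | S ∈ Ioo SB 1 ∧ ∫ x in SB..S, m.G SB a x = 0} g

/-- `s = S_*`: the point of `(SB, S̄)` where `β` and `γ` take a common value. -/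
def IsSStar (m : Medium) (SB s : ℝ) : Prop :=
  ∃ SBar, m.IsSBar SB SBar ∧ s ∈ Ioo SB SBar ∧
    ∃ t, m.IsBeta SB SBar s t ∧ m.IsGamma SB s t

/-- The right-hand side of `∂S/∂t = (1/τ) 𝓕(S, p)` for play-type hysteresis. -/
def calF (m : Medium) (S p : ℝ) : ℝ :=
  if m.pcd S < p then m.pcd S - p
  else if p < m.pci S then m.pci S - p
  else 0

/-- `(S, p)` is a solution, defined for all `ξ`, of the travelling wave system which leaves the
equilibrium point `(SB, pci SB)`: it tends to it as `ξ → -∞` and is not constant. -/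
structure IsOrbit (m : Medium) (SB ST τ : ℝ) (S p : ℝ → ℝ) : Prop where
  mem_strip : ∀ ξ, S ξ ∈ Ioo (0 : ℝ) 1
  eq_S : ∀ ξ, HasDerivAt S (1 / (m.speed SB ST * τ) * m.calF (S ξ) (p ξ)) ξ
  eq_p : ∀ ξ, HasDerivAt p (m.G SB ST (S ξ)) ξ
  tendsto_S : Tendsto S atBot (𝓝 SB)
  tendsto_p : Tendsto p atBot (𝓝 (m.pci SB))
  leaves : ∃ ξ, (S ξ, p ξ) ≠ (SB, m.pci SB)

/-- The function `w` describes, on `[SB, b)`, the orbit leaving `(SB, pci SB)` in the region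
`p < pci S` as a graph over the saturation. -/
def IsGraphOrbit (m : Medium) (SB ST τ b : ℝ) (w : ℝ → ℝ) : Prop :=
  w SB = m.pci SB ∧ ContinuousOn w (Ico SB b) ∧
    ∀ S ∈ Ioo SB b, w S < m.pci S ∧
      HasDerivAt w (m.speed SB ST * τ * m.G SB ST S / (m.pci S - w S)) S

/-- `S_m(τ, ST)`: the upper limit of the saturations up to which the orbit stays in the region
`p < pci S`. -/
def Sm (m : Medium) (SB ST τ : ℝ) : ℝ :=
  sSup {b : ℝ | b ∈ Ioo SB 1 ∧ ∃ w : ℝ → ℝ, m.IsGraphOrbit SB ST τ b w}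

/-- `τ_m(ST) = sup {τ : S_m(τ, ST) = ST}`. -/
def tauM (m : Medium) (SB ST : ℝ) : ℝ := sSup {τ : ℝ | 0 < τ ∧ m.Sm SB ST τ = ST}

def tauI (m : Medium) (SB ST : ℝ) : ℝ :=
  (deriv m.pci ST) ^ 2 / (4 * m.speed SB ST * deriv (m.G SB ST) ST)

def tauD (m : Medium) (SB ST : ℝ) : ℝ :=
  (deriv m.pcd ST) ^ 2 / (4 * m.speed SB ST * deriv (m.G SB ST) ST)

/-- Boundary conditions of a travelling wave connecting `SB` to `ST`. -/
def SatisfiesBC (SB ST : ℝ) (S p : ℝ → ℝ) : Prop :=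
  Tendsto S atBot (𝓝 SB) ∧ Tendsto S atTop (𝓝 ST) ∧
    Tendsto (deriv p) atBot (𝓝 0) ∧ Tendsto (deriv p) atTop (𝓝 0)

/-- The segment joining the equilibrium points `(ST, pci ST)` and `(ST, pcd ST)`. -/
def eqSegment (m : Medium) (ST : ℝ) : Set (ℝ × ℝ) :=
  segment ℝ (ST, m.pci ST) (ST, m.pcd ST)

/-- Between `a` and `b` the curve `(S, p)` makes one full turn around the segment over `ST`:
starting on the vertical line `S = ST` below the segment it passes through `S > ST` to this line
above the segment (at `t`), and then through `S < ST` back to the line below the segment. -/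
structure IsTurn (m : Medium) (ST : ℝ) (S p : ℝ → ℝ) (a t b : ℝ) : Prop where
  lt_left : a < t
  lt_right : t < b
  start_below : S a = ST ∧ p a < m.pci ST
  right_side : ∀ ξ ∈ Ioo a t, ST < S ξ
  mid_above : S t = ST ∧ m.pcd ST < p t
  left_side : ∀ ξ ∈ Ioo t b, S ξ < ST
  end_below : S b = ST ∧ p b < m.pci ST

/-- Finitely many turns around the segment; after some `ξ` the curve does not even meet the line
`S = ST` any more, so that no part of a further turn takes place. -/
def TurnsFinitelyOften (m : Medium) (ST : ℝ) (S p : ℝ → ℝ) : Prop :=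
  {a : ℝ | ∃ t b, m.IsTurn ST S p a t b}.Finite ∧ ∀ᶠ ξ in atTop, S ξ ≠ ST

/-- From some `ξ` on the curve is made up of infinitely many consecutive turns. -/
def TurnsInfinitelyOften (m : Medium) (ST : ℝ) (S p : ℝ → ℝ) : Prop :=
  ∃ a : ℕ → ℝ, StrictMono a ∧ Tendsto a atTop atTop ∧
    ∀ n, ∃ t, m.IsTurn ST S p (a n) t (a (n + 1))

end

end Medium

/-- The derivative of `g` is Hölder continuous at `s` (some exponent, some constant). -/
def HolderDerivAt (g : ℝ → ℝ) (s : ℝ) : Prop :=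
  ∃ C α : ℝ, 0 < α ∧ ∀ᶠ x in 𝓝 s, |deriv g x - deriv g s| ≤ C * |x - s| ^ α

end TwoPhase

/-!
With `A = max (lo S - p) 0`, `B = max (p - hi S) 0` and `κ = c τ`, the travelling wave system
reads `κ S' = A - B`, `p' = g S`, where `lo` and `hi` are strictly decreasing and `g` vanishes at
`a = S_B` and `b = S_T`, is negative between them and positive from `b` up to the common value
`t` of `β` and `γ` belonging to `S_*`. Only these properties and `∫_a^t g ≥ 0` matter; they are
collected in `TwoPhase.PlaySystem`. That a medium in Scenario A gives such a system
(`TwoPhase.Medium.exists_playSystem`) follows from the monotonicity of the chord slope on either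
side of the tangency point `S̄`, and from the fact that lowering the chord raises `G`.

**Confinement and convergence.** The energy `(A² + B²) / (2 κ) + ∫_a^S g` has derivative
`(lo' A² + hi' B²) / κ² ≤ 0` and starts from zero. Hence it is negative along an orbit, which
keeps `S` in `(a, t)`, since `∫_a^S g` is zero at `a` and nonnegative at `t`
(`PlaySystem.trapped`). The dissipation is integrable and its derivative is bounded below, so
`A, B → 0`. Then `S` varies arbitrarily slowly while `p` stays bounded, which forces `g S` to
vanish in the limit, so that `S → b` (`PlaySystem.IsPath.tendsto_b`).

**Turns.** By uniqueness no orbit meets an equilibrium `(b, p)`, `lo b ≤ p ≤ hi b`. So every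
passage of the line `S = b` is transversal, rightwards below `lo b` and leftwards above `hi b`;
the passages are locally finite and alternate. Either there are infinitely many, which are
consecutive turns, or `S - b` finally keeps one sign, and then `p → lo b` if it is negative and
`p → hi b` if it is positive. With `x = S - b`, the rate `r = -x' / x` solves a Riccati equation
`r' = r² - P r + Q` with convergent coefficients. It has no global solution if `P∞² < 4 Q∞`, so
that the approach from the left is impossible for `τ > τ_i` and the approach from the right for
`τ > τ_d`. If `P∞² > 4 Q∞`, a constant is a supersolution, and `r` stays bounded on the arc that
starts from the branch `p = hi S`; then `x` cannot vanish in finite time, and the orbit does not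
return to the line. In the degenerate case the Hölder condition makes `r₀ + (r₀ / 4) / log x` a
supersolution (`PlaySystem.IsPath.not_frequently`).

**The first branch.** The function `V = (lo - w)² / 2` of the saturation, where `w` is the orbit
as a graph, solves `V' = lo' √(2 V) - κ g`, `V a = 0`. The right-hand side is nonincreasing in
`V`, so that there is exactly one solution, monotone and Lipschitz in `κ`. The orbit meets the
line `S = b` exactly if `V b > 0` (`PlaySystem.IsPath.crosses_iff`), which is also the negation
of `S_m = S_T` (`Medium.Governs.Sm_eq_iff`). Since `V b` vanishes for small `κ`, this makes `τ_m`
positive and `τ ≤ τ_m` equivalent to `V b = 0`. Following the graph of `V` backwards from a point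
with `a < S < b` also constructs an orbit (`PlaySystem.exists_path`).
-/

/-! ### Real functions: signs, zeros, dissipation and Riccati equations -/

namespace TwoPhase

/-- A function that can cross zero only upwards stays positive. -/
theorem pos_of_deriv_pos_of_zero {f : ℝ → ℝ} {x₀ x₁ : ℝ} (h01 : x₀ ≤ x₁)
    (hc : ContinuousOn f (Icc x₀ x₁)) (h0 : 0 < f x₀)
    (hz : ∀ x ∈ Ioc x₀ x₁, f x = 0 → ∃ d, 0 < d ∧ HasDerivAt f d x) : 0 < f x₁ := by
  by_contra! h1
  have hcl : IsClosed (Icc x₀ x₁ ∩ f ⁻¹' Iic 0) :=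
    hc.preimage_isClosed_of_isClosed isClosed_Icc isClosed_Iic
  have hne : (Icc x₀ x₁ ∩ f ⁻¹' Iic 0).Nonempty := ⟨x₁, ⟨h01, le_rfl⟩, h1⟩
  have hbd : BddBelow (Icc x₀ x₁ ∩ f ⁻¹' Iic 0) := ⟨x₀, fun x hx => hx.1.1⟩
  obtain ⟨hzI, hz0⟩ := hcl.csInf_mem hne hbd
  set z := sInf (Icc x₀ x₁ ∩ f ⁻¹' Iic 0) with hzdef
  have hlt : x₀ < z := lt_of_le_of_ne hzI.1 (fun h => by
    rw [← h] at hz0; exact absurd hz0 (not_le.2 h0))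
  have hpos : ∀ x ∈ Ico x₀ z, 0 < f x := by
    intro x hx
    by_contra! hx0
    exact absurd (csInf_le hbd ⟨⟨hx.1, hx.2.le.trans hzI.2⟩, hx0⟩) (not_le.2 hx.2)
  have hfz : f z = 0 := by
    refine le_antisymm hz0 ?_
    have : Tendsto f (𝓝[Ico x₀ z] z) (𝓝 (f z)) :=
      (hc z hzI).mono (fun x hx => ⟨hx.1, hx.2.le.trans hzI.2⟩)
    have hnb : (𝓝[Ico x₀ z] z).NeBot := by
      rw [← mem_closure_iff_nhdsWithin_neBot, closure_Ico hlt.ne]; exact ⟨hlt.le, le_rfl⟩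
    exact ge_of_tendsto this (eventually_nhdsWithin_of_forall fun x hx => (hpos x hx).le)
  obtain ⟨d, hd, hder⟩ := hz z ⟨hlt, hzI.2⟩ hfz
  have h2 := (hasDerivAt_iff_tendsto_slope_left_right.1 hder).1
  have h3 : ∀ᶠ x in 𝓝[<] z, 0 < slope f z x := h2.eventually (lt_mem_nhds hd)
  have h4 : ∀ᶠ x in 𝓝[<] z, x ∈ Ico x₀ z :=
    mem_of_superset (Ioo_mem_nhdsLT hlt) Ioo_subset_Ico_self
  obtain ⟨x, hx, hxI⟩ := (h3.and h4).exists
  rw [slope_def_field, hfz, sub_zero] at hx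
  exact absurd hx (not_lt.2 (div_nonpos_of_nonneg_of_nonpos (hpos x hxI).le (by linarith [hxI.2])))

/-- A function that does not increase while it is positive cannot become positive. This comparison
principle needs no Lipschitz condition, so it also covers equations with square roots. -/
theorem nonpos_of_deriv_nonpos_of_pos {f f' : ℝ → ℝ} {x₀ x₁ : ℝ} (h01 : x₀ ≤ x₁)
    (hc : ContinuousOn f (Icc x₀ x₁)) (h0 : f x₀ ≤ 0)
    (hd : ∀ x ∈ Ioo x₀ x₁, 0 < f x → HasDerivAt f (f' x) x ∧ f' x ≤ 0) : f x₁ ≤ 0 := by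
  by_contra! h1
  have hcl : IsClosed (Icc x₀ x₁ ∩ f ⁻¹' Iic 0) :=
    hc.preimage_isClosed_of_isClosed isClosed_Icc isClosed_Iic
  have hne : (Icc x₀ x₁ ∩ f ⁻¹' Iic 0).Nonempty := ⟨x₀, ⟨le_rfl, h01⟩, h0⟩
  have hbd : BddAbove (Icc x₀ x₁ ∩ f ⁻¹' Iic 0) := ⟨x₁, fun x hx => hx.1.2⟩
  obtain ⟨hzI, hz0⟩ := hcl.csSup_mem hne hbd
  set z := sSup (Icc x₀ x₁ ∩ f ⁻¹' Iic 0) with hzdef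
  have hpos : ∀ x ∈ Ioo z x₁, 0 < f x := by
    intro x hx
    by_contra! hx0
    exact absurd (le_csSup hbd ⟨⟨hzI.1.trans hx.1.le, hx.2.le⟩, hx0⟩) (not_le.2 hx.1)
  have hanti : AntitoneOn f (Icc z x₁) := by
    refine antitoneOn_of_hasDerivWithinAt_nonpos (f' := f') (convex_Icc _ _)
      (hc.mono (Icc_subset_Icc_left hzI.1)) ?_ ?_
    · intro x hx
      rw [interior_Icc] at hx ⊢
      exact (hd x ⟨hzI.1.trans_lt hx.1, hx.2⟩ (hpos x hx)).1.hasDerivWithinAt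
    · intro x hx
      rw [interior_Icc] at hx
      exact (hd x ⟨hzI.1.trans_lt hx.1, hx.2⟩ (hpos x hx)).2
  have := hanti ⟨le_rfl, hzI.2⟩ ⟨hzI.2, le_rfl⟩ hzI.2
  exact absurd (this.trans hz0) (not_le.2 h1)

/-- If `E` is bounded below and decreases at least at the rate `m D`, where `D ≥ 0` cannot drop
faster than at the rate `C`, then `D` tends to zero. -/
theorem tendsto_zero_of_deriv_le_neg {E E' D D' : ℝ → ℝ} {ξ₀ m C L : ℝ} (hm : 0 < m)
    (hE : ∀ ξ ≥ ξ₀, HasDerivAt E (E' ξ) ξ) (hE' : ∀ ξ ≥ ξ₀, E' ξ ≤ -m * D ξ)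
    (hL : ∀ ξ ≥ ξ₀, L ≤ E ξ) (hD0 : ∀ ξ ≥ ξ₀, 0 ≤ D ξ)
    (hD : ∀ ξ ≥ ξ₀, HasDerivAt D (D' ξ) ξ) (hD' : ∀ ξ ≥ ξ₀, -C ≤ D' ξ) :
    Tendsto D atTop (𝓝 0) := by
  wlog hC : 0 < C generalizing C
  · exact this (C := max C 1) (fun ξ h => le_trans (neg_le_neg (le_max_left _ _)) (hD' ξ h))
      (lt_max_of_lt_right one_pos)
  have hanti : AntitoneOn E (Ici ξ₀) := by
    refine antitoneOn_of_hasDerivWithinAt_nonpos (f' := E') (convex_Ici _)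
      (fun x hx => (hE x hx).continuousAt.continuousWithinAt) ?_ ?_
    · intro x hx
      rw [interior_Ici] at hx ⊢
      exact (hE x hx.le).hasDerivWithinAt
    · intro x hx
      rw [interior_Ici] at hx
      have := hE' x hx.le
      have := mul_nonneg hm.le (hD0 x hx.le)
      linarith
  obtain ⟨l, hl⟩ : ∃ l, Tendsto E atTop (𝓝 l) := by
    have h1 : Antitone fun ξ => E (max ξ ξ₀) := fun x y h =>
      hanti (mem_Ici.2 (le_max_right _ _)) (mem_Ici.2 (le_max_right _ _)) (max_le_max_right _ h)
    have h2 : BddBelow (range fun ξ => E (max ξ ξ₀)) := by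
      refine ⟨L, ?_⟩
      rintro _ ⟨ξ, rfl⟩
      exact hL _ (le_max_right _ _)
    refine ⟨_, (tendsto_atTop_ciInf h1 h2).congr' ?_⟩
    filter_upwards [eventually_ge_atTop ξ₀] with ξ hξ
    rw [max_eq_left hξ]
  rw [Metric.tendsto_atTop]
  intro ε hε
  set θ := ε / (2 * C) with hθ
  have hθ0 : 0 < θ := by positivity
  have h1 : Tendsto (fun ξ => E ξ - E (ξ + θ)) atTop (𝓝 (l - l)) :=
    hl.sub (hl.comp (tendsto_atTop_add_const_right _ _ tendsto_id))
  rw [sub_self] at h1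
  have h2 := h1.eventually (gt_mem_nhds (show 0 < m * (ε / 2) * θ by positivity))
  obtain ⟨N, hN⟩ := eventually_atTop.1 (h2.and (eventually_ge_atTop ξ₀))
  refine ⟨N, fun ξ hξ => ?_⟩
  obtain ⟨h3, h4⟩ := hN ξ hξ
  rw [Real.dist_eq, sub_zero, abs_of_nonneg (hD0 ξ h4)]
  by_contra! hbig
  -- `D` stays above `ε / 2` on a time interval of the fixed length `θ`
  have h5 : ∀ x ∈ Icc ξ (ξ + θ), ε / 2 ≤ D x := by
    intro x hx
    have hmono : MonotoneOn (fun x => D x + C * x) (Ici ξ₀) := by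
      refine monotoneOn_of_hasDerivWithinAt_nonneg (f' := fun x => D' x + C * 1) (convex_Ici _)
        (fun x hx =>
          ((hD x hx).add ((hasDerivAt_id x).const_mul C)).continuousAt.continuousWithinAt)
        ?_ ?_
      · intro x hx
        rw [interior_Ici] at hx ⊢
        exact ((hD x hx.le).add ((hasDerivAt_id x).const_mul C)).hasDerivWithinAt
      · intro x hx
        rw [interior_Ici] at hx
        have := hD' x hx.le
        linarith
    have h6 := hmono (show ξ ∈ Ici ξ₀ from h4) (show x ∈ Ici ξ₀ from h4.trans hx.1) hx.1
    have h7 : C * (x - ξ) ≤ C * θ := mul_le_mul_of_nonneg_left (by linarith [hx.2]) hC.le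
    have h8 : C * θ = ε / 2 := by rw [hθ]; field_simp
    simp only at h6
    linarith
  have h6 : AntitoneOn (fun x => E x + m * (ε / 2) * x) (Icc ξ (ξ + θ)) := by
    refine antitoneOn_of_hasDerivWithinAt_nonpos (f' := fun x => E' x + m * (ε / 2) * 1)
      (convex_Icc _ _) (fun x hx => ((hE x (h4.trans hx.1)).add
        ((hasDerivAt_id x).const_mul _)).continuousAt.continuousWithinAt) ?_ ?_
    · intro x hx
      rw [interior_Icc] at hx ⊢
      exact ((hE x (h4.trans hx.1.le)).add ((hasDerivAt_id x).const_mul _)).hasDerivWithinAt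
    · intro x hx
      rw [interior_Icc] at hx
      have h7 := hE' x (h4.trans hx.1.le)
      have h8 := mul_le_mul_of_nonneg_left (h5 x ⟨hx.1.le, hx.2.le⟩) hm.le
      linarith
  have h7 := h6 ⟨le_rfl, by linarith⟩ ⟨by linarith, le_rfl⟩ (show ξ ≤ ξ + θ by linarith)
  simp only at h7
  linarith

/-- If the limiting Riccati equation has no real rest point, no solution exists for all times. -/
theorem riccati_no_global_solution {r P Q : ℝ → ℝ} {ξ₀ P₀ Q₀ : ℝ}
    (hr : ∀ ξ ≥ ξ₀, HasDerivAt r (r ξ ^ 2 - P ξ * r ξ + Q ξ) ξ)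
    (hP : Tendsto P atTop (𝓝 P₀)) (hQ : Tendsto Q atTop (𝓝 Q₀)) (hdisc : P₀ ^ 2 < 4 * Q₀) :
    False := by
  -- a uniform lower bound `ε * (1 + r ^ 2)` for the right-hand side makes `arctan r` unbounded
  have hQ0 : 0 < Q₀ := by nlinarith [sq_nonneg P₀]
  obtain ⟨ε, hε0, hε1, hε⟩ : ∃ ε, 0 < ε ∧ ε < 1 ∧ P₀ ^ 2 < 4 * (1 - ε) * (Q₀ - ε) := by
    have h1 : Tendsto (fun ε : ℝ => 4 * (1 - ε) * (Q₀ - ε)) (𝓝[>] 0) (𝓝 (4 * (1 - 0) * (Q₀ - 0))) :=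
      (Continuous.tendsto (by fun_prop) 0).mono_left nhdsWithin_le_nhds
    have h2 := h1.eventually (lt_mem_nhds (show P₀ ^ 2 < 4 * (1 - 0) * (Q₀ - 0) by linarith))
    obtain ⟨ε, h3, h4⟩ := (h2.and (Ioo_mem_nhdsGT (show (0:ℝ) < 1 by norm_num))).exists
    exact ⟨ε, h4.1, h4.2, h3⟩
  have hev : ∀ᶠ ξ in atTop, P ξ ^ 2 < 4 * (1 - ε) * (Q ξ - ε) := by
    have h1 : Tendsto (fun ξ => 4 * (1 - ε) * (Q ξ - ε) - P ξ ^ 2) atTop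
        (𝓝 (4 * (1 - ε) * (Q₀ - ε) - P₀ ^ 2)) :=
      ((hQ.sub_const ε).const_mul _).sub (hP.pow 2)
    filter_upwards [h1.eventually (lt_mem_nhds (sub_pos.2 hε))] with ξ hξ
    linarith
  obtain ⟨N, hN⟩ := eventually_atTop.1 (hev.and (eventually_ge_atTop ξ₀))
  have hmono : MonotoneOn (fun ξ => Real.arctan (r ξ) - ε * ξ) (Ici N) := by
    have hd : ∀ x ∈ Ici N, HasDerivAt (fun ξ => Real.arctan (r ξ) - ε * ξ)
        (1 / (1 + r x ^ 2) * (r x ^ 2 - P x * r x + Q x) - ε * 1) x := fun x hx =>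
      (hr x (hN x hx).2).arctan.sub ((hasDerivAt_id x).const_mul ε)
    refine monotoneOn_of_hasDerivWithinAt_nonneg (convex_Ici _)
      (fun x hx => (hd x hx).continuousAt.continuousWithinAt)
      (fun x hx => (hd x (interior_subset hx)).hasDerivWithinAt) ?_
    intro x hx
    have h1 := (hN x (interior_subset hx)).1
    have h2 : 0 < 1 + r x ^ 2 := by positivity
    have h3 : ε * (1 + r x ^ 2) ≤ r x ^ 2 - P x * r x + Q x := by
      nlinarith [sq_nonneg (2 * (1 - ε) * r x - P x)]
    have h4 : ε ≤ 1 / (1 + r x ^ 2) * (r x ^ 2 - P x * r x + Q x) := by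
      rw [one_div, inv_mul_eq_div, le_div_iff₀ h2]; exact h3
    linarith
  have hπ := Real.pi_pos
  have h1 := hmono self_mem_Ici (show N + Real.pi / ε ∈ Ici N by
    simp only [mem_Ici, le_add_iff_nonneg_right]; positivity)
    (show N ≤ N + Real.pi / ε by simp only [le_add_iff_nonneg_right]; positivity)
  simp only at h1
  have h2 := Real.neg_pi_div_two_lt_arctan (r N)
  have h3 := Real.arctan_lt_pi_div_two (r (N + Real.pi / ε))
  have h4 : ε * (N + Real.pi / ε) = ε * N + Real.pi := by field_simp
  linarith

/-- After a zero with positive slope, the next zero has slope at most zero. -/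
theorem exists_next_zero {f f' : ℝ → ℝ} (hf : ∀ x, HasDerivAt f (f' x) x) {u z : ℝ}
    (hu : f u = 0) (hu' : 0 < f' u) (huz : u < z) (hz : f z = 0) :
    ∃ d, u < d ∧ f d = 0 ∧ (∀ x ∈ Ioo u d, 0 < f x) ∧ f' d ≤ 0 := by
  have hc : Continuous f := continuous_iff_continuousAt.2 fun x => (hf x).continuousAt
  have h2 := (hasDerivAt_iff_tendsto_slope_left_right.1 (hf u)).2
  have h3 : ∀ᶠ x in 𝓝[>] u, 0 < slope f u x := h2.eventually (lt_mem_nhds hu')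
  obtain ⟨v, hv, hvpos⟩ := (mem_nhdsGT_iff_exists_Ioo_subset' huz).1 h3
  have hpos1 : ∀ x ∈ Ioo u v, 0 < f x := by
    intro x hx
    have := hvpos hx
    simp only [mem_ofPred_eq, slope_def_field, hu, sub_zero] at this
    exact (div_pos_iff_of_pos_right (by linarith [hx.1])).1 this
  have hcl : IsClosed (Icc v (max v z) ∩ f ⁻¹' {0}) :=
    isClosed_Icc.inter (isClosed_singleton.preimage hc)
  have hvz : v ≤ z := by
    by_contra! h
    exact (hpos1 z ⟨huz, h⟩).ne' hz
  have hne : (Icc v (max v z) ∩ f ⁻¹' {0}).Nonempty := ⟨z, ⟨hvz, le_max_right _ _⟩, hz⟩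
  have hbd : BddBelow (Icc v (max v z) ∩ f ⁻¹' {0}) := ⟨v, fun x hx => hx.1.1⟩
  obtain ⟨hdI, hd0⟩ := hcl.csInf_mem hne hbd
  set d := sInf (Icc v (max v z) ∩ f ⁻¹' {0}) with hd
  have huv : u < v := hv
  have hpos : ∀ x ∈ Ioo u d, 0 < f x := by
    intro x hx
    by_contra! hx0
    obtain ⟨y, hy, hy'⟩ : ∃ y ∈ Ioo u v, y ≤ x := by
      refine ⟨min x ((u + v) / 2),
        ⟨lt_min hx.1 (by linarith), (min_le_right _ _).trans_lt (by linarith)⟩,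
        min_le_left _ _⟩
    have hy0 := hpos1 y hy
    obtain ⟨w, hw, hw0⟩ := intermediate_value_Icc' hy' hc.continuousOn ⟨hx0, hy0.le⟩
    have hwv : v ≤ w := by
      by_contra! h
      exact (hpos1 w ⟨hy.1.trans_le hw.1, h⟩).ne' hw0
    have := csInf_le hbd ⟨⟨hwv, (hw.2.trans hx.2.le).trans hdI.2⟩, hw0⟩
    exact absurd (this.trans hw.2) (not_le.2 hx.2)
  have hud : u < d := huv.trans_le hdI.1
  refine ⟨d, hud, hd0, hpos, ?_⟩
  have h4 := (hasDerivAt_iff_tendsto_slope_left_right.1 (hf d)).1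
  refine le_of_tendsto h4 ?_
  filter_upwards [Ioo_mem_nhdsLT hud] with x hx
  have hd0' : f d = 0 := hd0
  rw [slope_def_field, hd0', sub_zero]
  exact div_nonpos_of_nonneg_of_nonpos (hpos x hx).le (by linarith [hx.2])

/-- Simple zeros do not accumulate. -/
theorem finite_zeros_Icc {f f' : ℝ → ℝ} (hf : ∀ x, HasDerivAt f (f' x) x)
    (hf' : ∀ x, f x = 0 → f' x ≠ 0) (u v : ℝ) : {x ∈ Icc u v | f x = 0}.Finite := by
  have hc : Continuous f := continuous_iff_continuousAt.2 fun x => (hf x).continuousAt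
  by_contra hinf
  obtain ⟨x, hx, hacc⟩ := Set.Infinite.exists_accPt_of_subset_isCompact hinf isCompact_Icc
    (sep_subset _ _)
  have hfreq := accPt_iff_frequently_nhdsNE.1 hacc
  have hx0 : f x = 0 := by
    have h1 : ∃ᶠ y in 𝓝 x, f y = 0 :=
      (hfreq.mono fun y hy => hy.2).filter_mono nhdsWithin_le_nhds
    have h2 : IsClosed {y | f y = 0} := isClosed_eq hc continuous_const
    exact h2.mem_of_frequently_of_tendsto h1 tendsto_id
  have h1 := (hf x).eventually_ne (c := 0) (hf' x hx0)
  exact hfreq (h1.mono fun y hy h => hy h.2)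

/-- Backward form of `eq_zero_of_abs_deriv_le_mul_abs_self_of_eq_zero_right`. -/
theorem eq_zero_of_abs_deriv_le_mul_abs_of_eq_zero_left {f f' : ℝ → ℝ} {K x₀ x₁ : ℝ}
    (hf : ContinuousOn f (Icc x₀ x₁)) (hf' : ∀ x ∈ Ioc x₀ x₁, HasDerivAt f (f' x) x)
    (h1 : f x₁ = 0) (bound : ∀ x ∈ Ioc x₀ x₁, |f' x| ≤ K * |f x|) : ∀ x ∈ Icc x₀ x₁, f x = 0 := by
  have h := eq_zero_of_abs_deriv_le_mul_abs_self_of_eq_zero_right (f := fun x => f (-x))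
    (f' := fun x => -f' (-x)) (K := K) (a := -x₁) (b := -x₀) ?_ ?_ ?_ ?_
  · intro x hx
    have := h (-x) ⟨by linarith [hx.2], by linarith [hx.1]⟩
    simpa using this
  · refine hf.comp continuous_neg.continuousOn fun x hx => ⟨by linarith [hx.2], by linarith [hx.1]⟩
  · intro x hx
    have h2 := (hf' (-x) ⟨by linarith [hx.2], by linarith [hx.1]⟩).comp x (hasDerivAt_neg x)
    have h3 : f' (-x) * -1 = -f' (-x) := by ring
    rw [h3] at h2
    exact h2.hasDerivWithinAt
  · simpa using h1
  · intro x hx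
    simpa using bound (-x) ⟨by linarith [hx.2], by linarith [hx.1]⟩

end TwoPhase

/-! ### Ordinary differential equations with bounded Lipschitz right-hand sides -/

namespace TwoPhase

open scoped NNReal in
theorem exists_solution_Icc_of_bounded {E : Type*} [NormedAddCommGroup E] [NormedSpace ℝ E]
    [CompleteSpace E] {f : ℝ → E → E} {K L : ℝ≥0} {t₁ t₂ : ℝ} (t₀ : Icc t₁ t₂)
    (hlip : ∀ t ∈ Icc t₁ t₂, LipschitzWith K (f t))
    (hcont : ∀ x, ContinuousOn (f · x) (Icc t₁ t₂))
    (hbd : ∀ t ∈ Icc t₁ t₂, ∀ x, ‖f t x‖ ≤ L) (x₀ : E) :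
    ∃ α : ℝ → E, α t₀ = x₀ ∧ ∀ t ∈ Icc t₁ t₂, HasDerivWithinAt α (f t (α t)) (Icc t₁ t₂) t := by
  have h : IsPicardLindelof f t₀ x₀ (L * Real.toNNReal (max (t₂ - t₀) (t₀ - t₁))) 0 L K :=
    { lipschitzOnWith := fun t ht => (hlip t ht).lipschitzOnWith
      continuousOn := fun x _ => hcont x
      norm_le := fun t ht x _ => hbd t ht x
      mul_max_le := by
        have : 0 ≤ max (t₂ - (t₀ : ℝ)) (t₀ - t₁) := le_max_of_le_left (by linarith [t₀.2.2])
        push_cast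
        rw [Real.coe_toNNReal _ this, sub_zero] }
  exact h.exists_eq_forall_mem_Icc_hasDerivWithinAt₀

open scoped NNReal in
/-- Solutions on the intervals `[-n, n]` agree where both are defined, so they fit together. -/
theorem exists_global_solution_of_bounded {E : Type*} [NormedAddCommGroup E] [NormedSpace ℝ E]
    [CompleteSpace E] {X : E → E} {K L : ℝ≥0} (hlip : LipschitzWith K X) (hbd : ∀ x, ‖X x‖ ≤ L)
    (x₀ : E) : ∃ α : ℝ → E, α 0 = x₀ ∧ ∀ t, HasDerivAt α (X (α t)) t := by
  have hn : ∀ n : ℕ, ∃ α : ℝ → E, α 0 = x₀ ∧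
      ∀ t ∈ Ioo (-((n : ℝ) + 1)) (n + 1), HasDerivAt α (X (α t)) t := by
    intro n
    obtain ⟨α, h0, hα⟩ := exists_solution_Icc_of_bounded (f := fun _ => X) (K := K) (L := L)
      (t₁ := -((n : ℝ) + 1)) (t₂ := n + 1) ⟨0, by constructor <;> linarith [n.cast_nonneg (α := ℝ)]⟩
      (fun _ _ => hlip) (fun _ => continuousOn_const) (fun _ _ => hbd) x₀
    exact ⟨α, h0, fun t ht => (hα t (Ioo_subset_Icc_self ht)).hasDerivAt (Icc_mem_nhds ht.1 ht.2)⟩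
  choose α h0 hα using hn
  have hag : ∀ (n k : ℕ), n ≤ k → EqOn (α n) (α k) (Ioo (-((n : ℝ) + 1)) (n + 1)) := by
    intro n k hnk
    have hnk' : (n : ℝ) ≤ k := by exact_mod_cast hnk
    refine ODE_solution_unique_of_mem_Ioo (v := fun _ => X) (s := fun _ => univ) (K := K) (t₀ := 0)
      (fun _ _ => hlip.lipschitzOnWith)
      (by constructor <;> linarith [n.cast_nonneg (α := ℝ)]) (fun t ht => ⟨hα n t ht, trivial⟩)
      (fun t ht => ⟨hα k t ⟨by linarith [ht.1], by linarith [ht.2]⟩, trivial⟩) ?_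
    rw [h0, h0]
  refine ⟨fun t => α ⌈|t|⌉₊ t, by simp [h0], fun t => ?_⟩
  have hmem : ∀ s : ℝ, s ∈ Ioo (-((⌈|s|⌉₊ : ℝ) + 1)) (⌈|s|⌉₊ + 1) := by
    intro s
    have h1 := Nat.le_ceil |s|
    have h2 := abs_le.1 h1
    exact ⟨by linarith [h2.1], by linarith [h2.2]⟩
  have heq : (fun s => α ⌈|s|⌉₊ s) =ᶠ[𝓝 t] α (⌈|t|⌉₊ + 1) := by
    have hev : ∀ᶠ s in 𝓝 t, |s| < |t| + 1 := continuous_abs.continuousAt.eventually_lt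
      continuousAt_const (by linarith)
    filter_upwards [hev] with s hs
    refine hag _ _ ?_ (hmem s)
    rw [Nat.ceil_le]
    push_cast
    linarith [Nat.le_ceil |t|]
  refine HasDerivAt.congr_of_eventuallyEq ?_ heq
  have h1 := hα (⌈|t|⌉₊ + 1) t (by
    have := hmem t
    push_cast
    exact ⟨by linarith [this.1], by linarith [this.2]⟩)
  rwa [← hag ⌈|t|⌉₊ (⌈|t|⌉₊ + 1) (Nat.le_succ _) (hmem t)] at h1

end TwoPhase

/-! ### Play systems -/

namespace TwoPhase

/-- The data of a planar system `κ S' = max (lo S - p) 0 - max (p - hi S) 0`, `p' = g S`. The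
orbit in question leaves `(a, lo a)` and should approach the segment of equilibria over `b`; the
point `t` bounds the saturations that it can reach, because of `area_nonneg`. -/
structure PlaySystem where
  lo : ℝ → ℝ
  hi : ℝ → ℝ
  g : ℝ → ℝ
  a : ℝ
  b : ℝ
  t : ℝ
  a_pos : 0 < a
  a_lt_b : a < b
  b_lt_t : b < t
  t_lt_one : t < 1
  lo_contDiffOn : ContDiffOn ℝ 1 lo (Ioo 0 1)
  hi_contDiffOn : ContDiffOn ℝ 1 hi (Ioo 0 1)
  lo_deriv_neg : ∀ x ∈ Ioo (0 : ℝ) 1, deriv lo x < 0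
  hi_deriv_neg : ∀ x ∈ Ioo (0 : ℝ) 1, deriv hi x < 0
  lo_lt_hi : ∀ x ∈ Ioo (0 : ℝ) 1, lo x < hi x
  g_contDiffOn : ContDiffOn ℝ 2 g (Ioo 0 1)
  g_a : g a = 0
  g_b : g b = 0
  g_neg : ∀ x ∈ Ioo a b, g x < 0
  g_pos : ∀ x ∈ Ioo b t, 0 < g x
  g_deriv_pos : 0 < deriv g b
  area_nonneg : 0 ≤ ∫ x in a..t, g x

namespace PlaySystem

noncomputable section

variable (P : PlaySystem)

theorem Icc_subset : Icc P.a P.t ⊆ Ioo 0 1 := fun _ hx =>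
  ⟨P.a_pos.trans_le hx.1, hx.2.trans_lt P.t_lt_one⟩

theorem Ioo_subset : Ioo P.a P.t ⊆ Ioo 0 1 := Ioo_subset_Icc_self.trans P.Icc_subset

theorem a_lt_t : P.a < P.t := P.a_lt_b.trans P.b_lt_t

theorem a_mem : P.a ∈ Ioo (0 : ℝ) 1 := P.Icc_subset ⟨le_rfl, P.a_lt_t.le⟩

theorem b_mem : P.b ∈ Ioo (0 : ℝ) 1 := P.Icc_subset ⟨P.a_lt_b.le, P.b_lt_t.le⟩

theorem t_mem : P.t ∈ Ioo (0 : ℝ) 1 := P.Icc_subset ⟨P.a_lt_t.le, le_rfl⟩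

variable {P} {x : ℝ}

theorem hasDerivAt_lo (hx : x ∈ Ioo (0 : ℝ) 1) : HasDerivAt P.lo (deriv P.lo x) x :=
  ((P.lo_contDiffOn.differentiableOn (by norm_num)).differentiableAt
    (isOpen_Ioo.mem_nhds hx)).hasDerivAt

theorem hasDerivAt_hi (hx : x ∈ Ioo (0 : ℝ) 1) : HasDerivAt P.hi (deriv P.hi x) x :=
  ((P.hi_contDiffOn.differentiableOn (by norm_num)).differentiableAt
    (isOpen_Ioo.mem_nhds hx)).hasDerivAt

theorem hasDerivAt_g (hx : x ∈ Ioo (0 : ℝ) 1) : HasDerivAt P.g (deriv P.g x) x :=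
  ((P.g_contDiffOn.differentiableOn (by norm_num)).differentiableAt
    (isOpen_Ioo.mem_nhds hx)).hasDerivAt

variable (P)

theorem continuousOn_lo : ContinuousOn P.lo (Ioo 0 1) := P.lo_contDiffOn.continuousOn
theorem continuousOn_hi : ContinuousOn P.hi (Ioo 0 1) := P.hi_contDiffOn.continuousOn
theorem continuousOn_g : ContinuousOn P.g (Ioo 0 1) := P.g_contDiffOn.continuousOn

theorem continuousOn_deriv_lo : ContinuousOn (deriv P.lo) (Ioo 0 1) :=
  P.lo_contDiffOn.continuousOn_deriv_of_isOpen isOpen_Ioo le_rfl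

theorem continuousOn_deriv_hi : ContinuousOn (deriv P.hi) (Ioo 0 1) :=
  P.hi_contDiffOn.continuousOn_deriv_of_isOpen isOpen_Ioo le_rfl

theorem strictAntiOn_lo : StrictAntiOn P.lo (Ioo 0 1) :=
  strictAntiOn_of_deriv_neg (convex_Ioo _ _) P.continuousOn_lo
    (by rw [interior_Ioo]; exact P.lo_deriv_neg)

theorem strictAntiOn_hi : StrictAntiOn P.hi (Ioo 0 1) :=
  strictAntiOn_of_deriv_neg (convex_Ioo _ _) P.continuousOn_hi
    (by rw [interior_Ioo]; exact P.hi_deriv_neg)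

/-- The potential `∫_a^s g`, with minimum on `[a, t]` at `b`. -/
def pot (s : ℝ) : ℝ := ∫ x in P.a..s, P.g x

theorem pot_a : P.pot P.a = 0 := intervalIntegral.integral_same

theorem hasDerivAt_pot {s : ℝ} (hs : s ∈ Ioo (0 : ℝ) 1) : HasDerivAt P.pot (P.g s) s := by
  have hsub : uIcc P.a s ⊆ Ioo 0 1 := ordConnected_Ioo.uIcc_subset P.a_mem hs
  refine intervalIntegral.integral_hasDerivAt_right
    (P.continuousOn_g.mono hsub).intervalIntegrable ?_
    (P.continuousOn_g.continuousAt (isOpen_Ioo.mem_nhds hs))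
  exact P.continuousOn_g.stronglyMeasurableAtFilter isOpen_Ioo s hs

theorem pot_b_le {s : ℝ} (hs : s ∈ Icc P.a P.t) : P.pot P.b ≤ P.pot s := by
  have hc : ContinuousOn P.pot (Ioo 0 1) := fun x hx =>
    (P.hasDerivAt_pot hx).continuousAt.continuousWithinAt
  have hbt : Icc P.b P.t ⊆ Ioo 0 1 := (Icc_subset_Icc_left P.a_lt_b.le).trans P.Icc_subset
  have hab : Icc P.a P.b ⊆ Ioo 0 1 := (Icc_subset_Icc_right P.b_lt_t.le).trans P.Icc_subset
  rcases le_total s P.b with h | h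
  · have : AntitoneOn P.pot (Icc P.a P.b) := by
      refine antitoneOn_of_hasDerivWithinAt_nonpos (f' := P.g) (convex_Icc _ _) (hc.mono hab) ?_ ?_
      · exact fun x hx => (P.hasDerivAt_pot (hab (interior_subset hx))).hasDerivWithinAt
      · exact fun x hx => (P.g_neg x (by rwa [interior_Icc] at hx)).le
    exact this ⟨hs.1, h⟩ ⟨P.a_lt_b.le, le_rfl⟩ h
  · have : MonotoneOn P.pot (Icc P.b P.t) := by
      refine monotoneOn_of_hasDerivWithinAt_nonneg (f' := P.g) (convex_Icc _ _) (hc.mono hbt) ?_ ?_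
      · exact fun x hx => (P.hasDerivAt_pot (hbt (interior_subset hx))).hasDerivWithinAt
      · exact fun x hx => (P.g_pos x (by rwa [interior_Icc] at hx)).le
    exact this ⟨le_rfl, P.b_lt_t.le⟩ ⟨h, hs.2⟩ h

/-- The amount by which `p` lies below the curve `lo`, zero above this curve. -/
def deficit (S p : ℝ) : ℝ := max (P.lo S - p) 0

/-- The amount by which `p` lies above the curve `hi`, zero below this curve. -/
def excess (S p : ℝ) : ℝ := max (p - P.hi S) 0

variable {P}

theorem deficit_nonneg {S p : ℝ} : 0 ≤ P.deficit S p := le_max_right _ _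
theorem excess_nonneg {S p : ℝ} : 0 ≤ P.excess S p := le_max_right _ _

theorem deficit_eq {S p : ℝ} (h : p ≤ P.lo S) : P.deficit S p = P.lo S - p :=
  max_eq_left (sub_nonneg.2 h)

theorem deficit_eq_zero {S p : ℝ} (h : P.lo S ≤ p) : P.deficit S p = 0 :=
  max_eq_right (sub_nonpos.2 h)

theorem excess_eq {S p : ℝ} (h : P.hi S ≤ p) : P.excess S p = p - P.hi S :=
  max_eq_left (sub_nonneg.2 h)

theorem excess_eq_zero {S p : ℝ} (h : p ≤ P.hi S) : P.excess S p = 0 :=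
  max_eq_right (sub_nonpos.2 h)

theorem deficit_mul_excess {S p : ℝ} (hS : S ∈ Ioo (0 : ℝ) 1) :
    P.deficit S p * P.excess S p = 0 := by
  rcases le_total (P.lo S) p with h | h
  · rw [deficit_eq_zero h, zero_mul]
  · rw [excess_eq_zero (h.trans (P.lo_lt_hi S hS).le), mul_zero]

theorem le_of_deficit_eq_zero {S p : ℝ} (h : P.deficit S p = 0) : P.lo S ≤ p := by
  have := le_max_left (P.lo S - p) 0
  unfold deficit at h; linarith

variable (P)

/-- `(S, p)` satisfies the differential equations at `ξ`, with time constant `κ`. -/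
structure SolvesAt (κ : ℝ) (S p : ℝ → ℝ) (ξ : ℝ) : Prop where
  eq_S : HasDerivAt S ((P.deficit (S ξ) (p ξ) - P.excess (S ξ) (p ξ)) / κ) ξ
  eq_p : HasDerivAt p (P.g (S ξ)) ξ

/-- The Lyapunov function of the system, nonincreasing along solutions. -/
def energy (κ S p : ℝ) : ℝ := (P.deficit S p ^ 2 + P.excess S p ^ 2) / (2 * κ) + P.pot S

end

end PlaySystem

/-! ### The energy and the confinement of orbits -/

theorem hasDerivAt_max_zero_sq (x : ℝ) :
    HasDerivAt (fun x : ℝ => max x 0 ^ 2) (2 * max x 0) x := by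
  rcases lt_trichotomy x 0 with h | rfl | h
  · rw [max_eq_right h.le, mul_zero]
    refine (hasDerivAt_const x (0 : ℝ)).congr_of_eventuallyEq ?_
    filter_upwards [Iio_mem_nhds h] with y hy
    rw [max_eq_right (le_of_lt hy)]; norm_num
  · rw [hasDerivAt_iff_isLittleO_nhds_zero]
    simp only [zero_add, max_self, mul_zero, smul_zero, sub_zero, ne_eq, OfNat.ofNat_ne_zero,
      not_false_eq_true, zero_pow]
    have h1 : (fun h : ℝ => max h 0 ^ 2) =O[𝓝 0] fun h : ℝ => h ^ 2 := by
      refine Asymptotics.IsBigO.of_bound 1 (Eventually.of_forall fun h => ?_)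
      rw [one_mul, norm_pow, norm_pow]
      gcongr
      rw [Real.norm_eq_abs, Real.norm_eq_abs, abs_of_nonneg (le_max_right _ _)]
      exact max_le (le_abs_self h) (abs_nonneg h)
    exact h1.trans_isLittleO (Asymptotics.isLittleO_pow_id (by norm_num))
  · rw [max_eq_left h.le]
    have h1 := hasDerivAt_pow 2 x
    norm_num at h1
    refine h1.congr_of_eventuallyEq ?_
    filter_upwards [Ioi_mem_nhds h] with y hy
    rw [max_eq_left (le_of_lt hy)]

namespace PlaySystem

variable {P : PlaySystem} {κ : ℝ} {S p : ℝ → ℝ} {ξ : ℝ}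

theorem SolvesAt.deficit_sq (h : P.SolvesAt κ S p ξ) (hS : S ξ ∈ Ioo (0 : ℝ) 1) :
    HasDerivAt (fun ξ => P.deficit (S ξ) (p ξ) ^ 2) (2 * P.deficit (S ξ) (p ξ) *
      (deriv P.lo (S ξ) * ((P.deficit (S ξ) (p ξ) - P.excess (S ξ) (p ξ)) / κ) - P.g (S ξ))) ξ :=
  (hasDerivAt_max_zero_sq _).comp ξ (((hasDerivAt_lo hS).comp ξ h.eq_S).sub h.eq_p)

theorem SolvesAt.excess_sq (h : P.SolvesAt κ S p ξ) (hS : S ξ ∈ Ioo (0 : ℝ) 1) :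
    HasDerivAt (fun ξ => P.excess (S ξ) (p ξ) ^ 2) (2 * P.excess (S ξ) (p ξ) *
      (P.g (S ξ) - deriv P.hi (S ξ) * ((P.deficit (S ξ) (p ξ) - P.excess (S ξ) (p ξ)) / κ))) ξ :=
  (hasDerivAt_max_zero_sq _).comp ξ (h.eq_p.sub ((hasDerivAt_hi hS).comp ξ h.eq_S))

theorem SolvesAt.energy (h : P.SolvesAt κ S p ξ) (hS : S ξ ∈ Ioo (0 : ℝ) 1) (hκ : 0 < κ) :
    HasDerivAt (fun ξ => P.energy κ (S ξ) (p ξ)) ((deriv P.lo (S ξ) * P.deficit (S ξ) (p ξ) ^ 2 +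
      deriv P.hi (S ξ) * P.excess (S ξ) (p ξ) ^ 2) / κ ^ 2) ξ := by
  have h1 := (((h.deficit_sq hS).add (h.excess_sq hS)).div_const (2 * κ)).add
    ((P.hasDerivAt_pot hS).comp ξ h.eq_S)
  refine h1.congr_deriv ?_
  have h2 := deficit_mul_excess (P := P) (p := p ξ) hS
  field_simp
  linear_combination -(deriv P.lo (S ξ) + deriv P.hi (S ξ)) * h2

theorem energy_deriv_nonpos {x y : ℝ} (hx : x ∈ Ioo (0 : ℝ) 1) :
    (deriv P.lo x * P.deficit x y ^ 2 + deriv P.hi x * P.excess x y ^ 2) / κ ^ 2 ≤ 0 := by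
  refine div_nonpos_of_nonpos_of_nonneg ?_ (sq_nonneg _)
  have h1 := mul_nonneg (neg_nonneg.2 (P.lo_deriv_neg x hx).le) (sq_nonneg (P.deficit x y))
  have h2 := mul_nonneg (neg_nonneg.2 (P.hi_deriv_neg x hx).le) (sq_nonneg (P.excess x y))
  linarith

theorem continuousAt_deficit {z : ℝ × ℝ} (hz : z.1 ∈ Ioo (0 : ℝ) 1) :
    ContinuousAt (fun z : ℝ × ℝ => P.deficit z.1 z.2) z := by
  have h1 : ContinuousAt (fun z : ℝ × ℝ => P.lo z.1) z :=
    (hasDerivAt_lo hz).continuousAt.comp' continuousAt_fst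
  exact (h1.sub continuousAt_snd).max continuousAt_const

theorem continuousAt_excess {z : ℝ × ℝ} (hz : z.1 ∈ Ioo (0 : ℝ) 1) :
    ContinuousAt (fun z : ℝ × ℝ => P.excess z.1 z.2) z := by
  have h1 : ContinuousAt (fun z : ℝ × ℝ => P.hi z.1) z :=
    (hasDerivAt_hi hz).continuousAt.comp' continuousAt_fst
  exact (continuousAt_snd.sub h1).max continuousAt_const

theorem continuousAt_energy {z : ℝ × ℝ} (hz : z.1 ∈ Ioo (0 : ℝ) 1) :
    ContinuousAt (fun z : ℝ × ℝ => P.energy κ z.1 z.2) z := by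
  have h1 : ContinuousAt (fun z : ℝ × ℝ => P.pot z.1) z :=
    (P.hasDerivAt_pot hz).continuousAt.comp' continuousAt_fst
  exact ((((continuousAt_deficit hz).pow 2).add
    ((continuousAt_excess hz).pow 2)).div_const _).add h1

theorem deficit_lo_self {x : ℝ} : P.deficit x (P.lo x) = 0 := deficit_eq_zero le_rfl

theorem excess_lo_self {x : ℝ} (hx : x ∈ Ioo (0 : ℝ) 1) : P.excess x (P.lo x) = 0 :=
  excess_eq_zero (P.lo_lt_hi x hx).le

theorem energy_start : P.energy κ P.a (P.lo P.a) = 0 := by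
  rw [energy, deficit_lo_self, excess_lo_self P.a_mem, pot_a]; simp

/-- As long as the saturation stays in `(a, t)`, an orbit leaving `(a, lo a)` below the curve
`lo` has negative energy. -/
theorem energy_neg (hκ : 0 < κ) {ξ₁ : ℝ} (hSc : Continuous S) (hpc : Continuous p)
    (hmem : ∀ ξ < ξ₁, S ξ ∈ Ioo P.a P.t) (hode : ∀ ξ < ξ₁, P.SolvesAt κ S p ξ)
    (hstart : ∀ᶠ ξ in atBot, p ξ < P.lo (S ξ)) (hS : Tendsto S atBot (𝓝 P.a))
    (hp : Tendsto p atBot (𝓝 (P.lo P.a))) :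
    S ξ₁ ∈ Icc P.a P.t ∧ P.energy κ (S ξ₁) (p ξ₁) < 0 := by
  have hmem1 : S ξ₁ ∈ Icc P.a P.t :=
    isClosed_Icc.mem_of_tendsto (hSc.continuousAt.continuousWithinAt (s := Iio ξ₁)).tendsto
      (eventually_nhdsWithin_of_forall fun ξ hξ => Ioo_subset_Icc_self (hmem ξ hξ))
  refine ⟨hmem1, ?_⟩
  have hmem' : ∀ ξ ≤ ξ₁, S ξ ∈ Ioo (0 : ℝ) 1 := fun ξ hξ => by
    rcases hξ.lt_or_eq with h | rfl
    · exact P.Ioo_subset (hmem ξ h)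
    · exact P.Icc_subset hmem1
  have hEc : ContinuousOn (fun ξ => P.energy κ (S ξ) (p ξ)) (Iic ξ₁) := fun ξ hξ =>
    (ContinuousAt.comp (f := fun ξ => (S ξ, p ξ)) (continuousAt_energy (hmem' ξ hξ))
      (hSc.prodMk hpc).continuousAt).continuousWithinAt
  have hE : AntitoneOn (fun ξ => P.energy κ (S ξ) (p ξ)) (Iic ξ₁) := by
    refine antitoneOn_of_hasDerivWithinAt_nonpos (convex_Iic _) hEc (f' := fun ξ =>
      (deriv P.lo (S ξ) * P.deficit (S ξ) (p ξ) ^ 2 + deriv P.hi (S ξ) * P.excess (S ξ) (p ξ) ^ 2)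
        / κ ^ 2) ?_ ?_
    · intro x hx
      rw [interior_Iic] at hx ⊢
      exact ((hode x hx).energy (hmem' x hx.le) hκ).hasDerivWithinAt
    · intro x hx
      exact energy_deriv_nonpos (hmem' x (mem_Iic.1 (interior_subset hx)))
  have hlim : Tendsto (fun ξ => P.energy κ (S ξ) (p ξ)) atBot (𝓝 0) := by
    have := (continuousAt_energy (P := P) (κ := κ) (z := (P.a, P.lo P.a)) P.a_mem).tendsto.comp
      (hS.prodMk_nhds hp)
    rwa [energy_start] at this
  have hle : ∀ ξ ≤ ξ₁, P.energy κ (S ξ) (p ξ) ≤ 0 := fun ξ hξ =>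
    ge_of_tendsto hlim ((eventually_le_atBot ξ).mono fun η hη => hE (hη.trans hξ) hξ hη)
  obtain ⟨N, hN⟩ := eventually_atBot.1 (hstart.and (eventually_lt_atBot ξ₁))
  have hstrict : StrictAntiOn (fun ξ => P.energy κ (S ξ) (p ξ)) (Iic N) := by
    have hd : ∀ ξ ≤ N, _ := fun ξ hξ => (hode ξ (hN ξ hξ).2).energy (hmem' ξ (hN ξ hξ).2.le) hκ
    refine strictAntiOn_of_hasDerivWithinAt_neg (convex_Iic _)
      (hEc.mono (Iic_subset_Iic.2 (hN N le_rfl).2.le))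
      (fun x hx => (hd x (mem_Iic.1 (interior_subset hx))).hasDerivWithinAt) ?_
    intro x hx
    have hx' : x ≤ N := mem_Iic.1 (interior_subset hx)
    have hm := hmem' x (hN x hx').2.le
    refine div_neg_of_neg_of_pos ?_ (by positivity)
    have hlt := (hN x hx').1
    have h1 : 0 < P.deficit (S x) (p x) := by rw [deficit_eq hlt.le]; linarith
    rw [excess_eq_zero (hlt.le.trans (P.lo_lt_hi _ hm).le)]
    have := mul_neg_of_neg_of_pos (P.lo_deriv_neg _ hm) (pow_pos h1 2)
    linarith
  have h1 := hstrict (show N - 1 ∈ Iic N by simp) self_mem_Iic (by linarith)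
  have h2 := hle (N - 1) (by linarith [(hN N le_rfl).2])
  have h3 := hE (show N ∈ Iic ξ₁ from (hN N le_rfl).2.le) self_mem_Iic
    (hN N le_rfl).2.le
  simp only at h1 h3
  linarith

/-- Negative energy keeps the saturation off the end points `a` and `t`, where `pot ≥ 0`, and bounds
`deficit` and `excess`, since `pot` is minimal at `b`. -/
theorem bounds_of_energy_neg (hκ : 0 < κ) {x y R : ℝ} (hx : x ∈ Icc P.a P.t)
    (hE : P.energy κ x y < 0) (hR : 0 < R) (hR2 : -(2 * κ * P.pot P.b) ≤ R ^ 2) :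
    x ∈ Ioo P.a P.t ∧ P.deficit x y < R ∧ P.excess x y < R := by
  have h1 : P.pot P.b ≤ P.pot x := P.pot_b_le hx
  have h2 : 0 ≤ (P.deficit x y ^ 2 + P.excess x y ^ 2) / (2 * κ) := by positivity
  have hpot : P.pot x < 0 := by unfold energy at hE; linarith
  have h3 : P.deficit x y ^ 2 + P.excess x y ^ 2 < R ^ 2 := by
    have h4 : (P.deficit x y ^ 2 + P.excess x y ^ 2) / (2 * κ) < -P.pot P.b := by
      unfold energy at hE; linarith
    rw [div_lt_iff₀ (by positivity)] at h4
    linarith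
  refine ⟨⟨lt_of_le_of_ne hx.1 ?_, lt_of_le_of_ne hx.2 ?_⟩, ?_, ?_⟩
  · rintro rfl; rw [pot_a] at hpot; exact lt_irrefl _ hpot
  · rintro rfl; exact absurd P.area_nonneg (not_le.2 hpot)
  · exact lt_of_pow_lt_pow_left₀ 2 hR.le (by nlinarith [sq_nonneg (P.excess x y)])
  · exact lt_of_pow_lt_pow_left₀ 2 hR.le (by nlinarith [sq_nonneg (P.deficit x y)])

/-- An orbit leaving `(a, lo a)` below the curve `lo` never leaves `a < S < t`. The equations are
only needed where `deficit` and `excess` are less than `R`, so that they may be cut off beyond. -/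
theorem trapped (hκ : 0 < κ) {R : ℝ} (hR : 0 < R) (hR2 : -(2 * κ * P.pot P.b) ≤ R ^ 2)
    (hSc : Continuous S) (hpc : Continuous p)
    (hode : ∀ ξ, S ξ ∈ Ioo P.a P.t → P.deficit (S ξ) (p ξ) < R → P.excess (S ξ) (p ξ) < R →
      P.SolvesAt κ S p ξ)
    (hmem : ∀ᶠ ξ in atBot, S ξ ∈ Ioo P.a P.t)
    (hstart : ∀ᶠ ξ in atBot, p ξ < P.lo (S ξ)) (hS : Tendsto S atBot (𝓝 P.a))
    (hp : Tendsto p atBot (𝓝 (P.lo P.a))) (ξ : ℝ) :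
    S ξ ∈ Ioo P.a P.t ∧ P.deficit (S ξ) (p ξ) < R ∧ P.excess (S ξ) (p ξ) < R := by
  set good : Set ℝ := {ξ | S ξ ∈ Ioo P.a P.t ∧ P.deficit (S ξ) (p ξ) < R ∧ P.excess (S ξ) (p ξ) < R}
    with hgood
  have hopen : IsOpen good := by
    rw [isOpen_iff_mem_nhds]
    intro η hη
    have hz : (S η, p η).1 ∈ Ioo (0 : ℝ) 1 := P.Ioo_subset hη.1
    have hc : ContinuousAt (fun ξ => (S ξ, p ξ)) η := (hSc.prodMk hpc).continuousAt
    have h1 := ContinuousAt.comp (f := fun ξ => (S ξ, p ξ)) (continuousAt_deficit (P := P) hz) hc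
    have h2 := ContinuousAt.comp (f := fun ξ => (S ξ, p ξ)) (continuousAt_excess (P := P) hz) hc
    filter_upwards [hSc.continuousAt.eventually (isOpen_Ioo.mem_nhds hη.1),
      h1.eventually (gt_mem_nhds hη.2.1), h2.eventually (gt_mem_nhds hη.2.2)] with x h3 h4 h5
    exact ⟨h3, h4, h5⟩
  have hev : ∀ᶠ ξ in atBot, ξ ∈ good := by
    have h1 := (continuousAt_deficit (P := P) (z := (P.a, P.lo P.a)) P.a_mem).tendsto.comp
      (hS.prodMk_nhds hp)
    have h2 := (continuousAt_excess (P := P) (z := (P.a, P.lo P.a)) P.a_mem).tendsto.comp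
      (hS.prodMk_nhds hp)
    simp only [deficit_lo_self] at h1
    simp only [excess_lo_self P.a_mem] at h2
    filter_upwards [hmem, h1.eventually (gt_mem_nhds hR), h2.eventually (gt_mem_nhds hR)]
      with x h3 h4 h5
    exact ⟨h3, h4, h5⟩
  change ξ ∈ good
  by_contra hbad
  obtain ⟨N, hN⟩ := eventually_atBot.1 hev
  have hbd : BddBelow goodᶜ := ⟨N, fun η hη => by
    by_contra! h
    exact hη (hN η h.le)⟩
  have hmemc := hopen.isClosed_compl.csInf_mem ⟨ξ, hbad⟩ hbd
  set ξ₁ := sInf goodᶜ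
  have hlt : ∀ η < ξ₁, η ∈ good := fun η hη => by
    by_contra h
    exact absurd (csInf_le hbd h) (not_le.2 hη)
  obtain ⟨h1, h2⟩ := energy_neg hκ hSc hpc (fun η hη => (hlt η hη).1)
    (fun η hη => hode η (hlt η hη).1 (hlt η hη).2.1 (hlt η hη).2.2) hstart hS hp
  exact hmemc (bounds_of_energy_neg hκ h1 h2 hR hR2)

variable (P) in
/-- An orbit, defined for all `ξ`, which leaves `(a, lo a)` below the curve `lo` and has its
saturation in `(a, t)`. -/
structure IsPath (κ : ℝ) (S p : ℝ → ℝ) : Prop where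
  κ_pos : 0 < κ
  mem : ∀ ξ, S ξ ∈ Ioo P.a P.t
  solves : ∀ ξ, P.SolvesAt κ S p ξ
  start : ∀ᶠ ξ in atBot, p ξ < P.lo (S ξ)
  tendsto_S : Tendsto S atBot (𝓝 P.a)
  tendsto_p : Tendsto p atBot (𝓝 (P.lo P.a))

namespace IsPath

variable (h : P.IsPath κ S p)
include h

theorem continuous_S : Continuous S :=
  continuous_iff_continuousAt.2 fun ξ => (h.solves ξ).eq_S.continuousAt

theorem continuous_p : Continuous p :=
  continuous_iff_continuousAt.2 fun ξ => (h.solves ξ).eq_p.continuousAt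

theorem mem01 (ξ : ℝ) : S ξ ∈ Ioo (0 : ℝ) 1 := P.Ioo_subset (h.mem ξ)

theorem energy_lt_zero (ξ : ℝ) : P.energy κ (S ξ) (p ξ) < 0 :=
  (energy_neg h.κ_pos h.continuous_S h.continuous_p (fun ξ _ => h.mem ξ) (fun ξ _ => h.solves ξ)
    h.start h.tendsto_S h.tendsto_p).2

end IsPath

end PlaySystem

end TwoPhase

/-! ### Convergence to the segment of equilibria -/

namespace TwoPhase
namespace PlaySystem

variable {P : PlaySystem} {κ : ℝ} {S p : ℝ → ℝ} {ξ : ℝ}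

variable (P) in
theorem exists_deriv_le_neg :
    ∃ m, 0 < m ∧ ∀ x ∈ Icc P.a P.t, deriv P.lo x ≤ -m ∧ deriv P.hi x ≤ -m := by
  obtain ⟨m₁, h1, h1'⟩ := isCompact_Icc.exists_forall_le' (f := fun x => -deriv P.lo x) (a := 0)
    (P.continuousOn_deriv_lo.mono P.Icc_subset).neg
    (fun x hx => neg_pos.2 (P.lo_deriv_neg x (P.Icc_subset hx)))
  obtain ⟨m₂, h2, h2'⟩ := isCompact_Icc.exists_forall_le' (f := fun x => -deriv P.hi x) (a := 0)
    (P.continuousOn_deriv_hi.mono P.Icc_subset).neg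
    (fun x hx => neg_pos.2 (P.hi_deriv_neg x (P.Icc_subset hx)))
  refine ⟨min m₁ m₂, lt_min h1 h2, fun x hx => ⟨?_, ?_⟩⟩
  · linarith [h1' x hx, min_le_left m₁ m₂]
  · linarith [h2' x hx, min_le_right m₁ m₂]

variable (P) in
theorem exists_abs_le : ∃ C, 0 < C ∧ ∀ x ∈ Icc P.a P.t,
    |deriv P.lo x| ≤ C ∧ |deriv P.hi x| ≤ C ∧ |P.g x| ≤ C := by
  obtain ⟨c₁, h1⟩ := isCompact_Icc.exists_bound_of_continuousOn
    (P.continuousOn_deriv_lo.mono P.Icc_subset)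
  obtain ⟨c₂, h2⟩ := isCompact_Icc.exists_bound_of_continuousOn
    (P.continuousOn_deriv_hi.mono P.Icc_subset)
  obtain ⟨c₃, h3⟩ := isCompact_Icc.exists_bound_of_continuousOn (P.continuousOn_g.mono P.Icc_subset)
  refine ⟨max 1 (max c₁ (max c₂ c₃)), by positivity, fun x hx => ⟨?_, ?_, ?_⟩⟩
  · exact (h1 x hx).trans (by simp)
  · exact (h2 x hx).trans (by simp)
  · exact (h3 x hx).trans (by simp)

variable (P κ) in
theorem exists_energy_radius : ∃ R, 0 < R ∧ -(2 * κ * P.pot P.b) ≤ R ^ 2 :=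
  ⟨|2 * κ * P.pot P.b| + 1, by positivity, by
    nlinarith [neg_le_abs (2 * κ * P.pot P.b), abs_nonneg (2 * κ * P.pot P.b)]⟩

namespace IsPath

variable (h : P.IsPath κ S p)
include h

theorem exists_bound : ∃ R, 0 < R ∧
    ∀ ξ, P.deficit (S ξ) (p ξ) < R ∧ P.excess (S ξ) (p ξ) < R := by
  obtain ⟨R, hR, hR2⟩ := exists_energy_radius P κ
  exact ⟨R, hR, fun ξ => (bounds_of_energy_neg h.κ_pos (Ioo_subset_Icc_self (h.mem ξ))
    (h.energy_lt_zero ξ) hR hR2).2⟩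

theorem energy_antitone : Antitone fun ξ => P.energy κ (S ξ) (p ξ) :=
  antitone_of_hasDerivAt_nonpos (fun ξ => (h.solves ξ).energy (h.mem01 ξ) h.κ_pos)
    (fun ξ => energy_deriv_nonpos (h.mem01 ξ))

/-- The energy is dissipated at a rate proportional to `deficit ^ 2 + excess ^ 2`. -/
theorem tendsto_sq_add_sq :
    Tendsto (fun ξ => P.deficit (S ξ) (p ξ) ^ 2 + P.excess (S ξ) (p ξ) ^ 2) atTop (𝓝 0) := by
  obtain ⟨m, hm, hm'⟩ := P.exists_deriv_le_neg
  obtain ⟨C, hC, hC'⟩ := P.exists_abs_le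
  obtain ⟨R, hR, hR'⟩ := h.exists_bound
  have hκ := h.κ_pos
  refine tendsto_zero_of_deriv_le_neg (ξ₀ := 0) (m := m / κ ^ 2) (L := P.pot P.b)
    (C := 4 * R ^ 2 * C / κ + 4 * R * C)
    (by positivity) (fun ξ _ => (h.solves ξ).energy (h.mem01 ξ) h.κ_pos) ?_ ?_
    (fun ξ _ => by positivity)
    (fun ξ _ => ((h.solves ξ).deficit_sq (h.mem01 ξ)).add ((h.solves ξ).excess_sq (h.mem01 ξ))) ?_
  · intro ξ _
    have hI := Ioo_subset_Icc_self (h.mem ξ)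
    rw [← neg_div, div_mul_eq_mul_div]
    gcongr
    have h1 := mul_le_mul_of_nonneg_right (hm' _ hI).1 (sq_nonneg (P.deficit (S ξ) (p ξ)))
    have h2 := mul_le_mul_of_nonneg_right (hm' _ hI).2 (sq_nonneg (P.excess (S ξ) (p ξ)))
    linarith
  · intro ξ _
    have h1 := P.pot_b_le (Ioo_subset_Icc_self (h.mem ξ))
    have h2 : 0 ≤ (P.deficit (S ξ) (p ξ) ^ 2 + P.excess (S ξ) (p ξ) ^ 2) / (2 * κ) := by positivity
    unfold energy
    linarith
  · intro ξ _
    have hI := Ioo_subset_Icc_self (h.mem ξ)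
    obtain ⟨c1, c2, c3⟩ := hC' _ hI
    obtain ⟨r1, r2⟩ := hR' ξ
    have h0 := deficit_mul_excess (P := P) (p := p ξ) (h.mem01 ξ)
    have a0 : 0 ≤ P.deficit (S ξ) (p ξ) := deficit_nonneg
    have b0 : 0 ≤ P.excess (S ξ) (p ξ) := excess_nonneg
    set A := P.deficit (S ξ) (p ξ)
    set B := P.excess (S ξ) (p ξ)
    have e1 : 2 * A * (deriv P.lo (S ξ) * ((A - B) / κ) - P.g (S ξ)) +
        2 * B * (P.g (S ξ) - deriv P.hi (S ξ) * ((A - B) / κ)) =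
        (2 * A ^ 2 * deriv P.lo (S ξ) + 2 * B ^ 2 * deriv P.hi (S ξ)) / κ
          + 2 * (B - A) * P.g (S ξ) := by
      field_simp
      linear_combination -(deriv P.lo (S ξ) + deriv P.hi (S ξ)) * h0
    rw [e1]
    have hA2 : A ^ 2 ≤ R ^ 2 := by gcongr
    have hB2 : B ^ 2 ≤ R ^ 2 := by gcongr
    have e2 : -(4 * R ^ 2 * C / κ) ≤
        (2 * A ^ 2 * deriv P.lo (S ξ) + 2 * B ^ 2 * deriv P.hi (S ξ)) / κ := by
      rw [← neg_div]
      gcongr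
      have k1 : A ^ 2 * (-deriv P.lo (S ξ)) ≤ R ^ 2 * C :=
        mul_le_mul hA2 ((neg_le_abs _).trans c1)
          (neg_nonneg.2 (P.lo_deriv_neg _ (h.mem01 ξ)).le) (by positivity)
      have k2 : B ^ 2 * (-deriv P.hi (S ξ)) ≤ R ^ 2 * C :=
        mul_le_mul hB2 ((neg_le_abs _).trans c2)
          (neg_nonneg.2 (P.hi_deriv_neg _ (h.mem01 ξ)).le) (by positivity)
      linarith
    have e3 : -(4 * R * C) ≤ 2 * (B - A) * P.g (S ξ) := by
      have k1 : |2 * (B - A) * P.g (S ξ)| ≤ 4 * R * C := by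
        rw [abs_mul]
        refine mul_le_mul ?_ c3 (abs_nonneg _) (by positivity)
        rw [abs_le]
        constructor <;> linarith
      exact (abs_le.1 k1).1
    linarith

theorem tendsto_deficit : Tendsto (fun ξ => P.deficit (S ξ) (p ξ)) atTop (𝓝 0) := by
  have h1 : Tendsto (fun ξ => P.deficit (S ξ) (p ξ) ^ 2) atTop (𝓝 0) :=
    squeeze_zero (fun _ => sq_nonneg _) (fun ξ => le_add_of_nonneg_right (sq_nonneg _))
      h.tendsto_sq_add_sq
  simpa [Real.sqrt_sq, deficit_nonneg] using h1.sqrt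

theorem tendsto_excess : Tendsto (fun ξ => P.excess (S ξ) (p ξ)) atTop (𝓝 0) := by
  have h1 : Tendsto (fun ξ => P.excess (S ξ) (p ξ) ^ 2) atTop (𝓝 0) :=
    squeeze_zero (fun _ => sq_nonneg _) (fun ξ => le_add_of_nonneg_left (sq_nonneg _))
      h.tendsto_sq_add_sq
  simpa [Real.sqrt_sq, excess_nonneg] using h1.sqrt

theorem exists_p_bound : ∃ W, 0 < W ∧ ∀ ξ η, |p ξ - p η| ≤ W := by
  obtain ⟨R, hR, hR'⟩ := h.exists_bound
  have hl : ∀ ξ, P.lo P.t - R ≤ p ξ := fun ξ => by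
    have h1 : P.lo (S ξ) - p ξ ≤ P.deficit (S ξ) (p ξ) := le_max_left _ _
    have h2 := P.strictAntiOn_lo.antitoneOn (h.mem01 ξ) P.t_mem (h.mem ξ).2.le
    linarith [(hR' ξ).1]
  have hu : ∀ ξ, p ξ ≤ P.hi P.a + R := fun ξ => by
    have h1 : p ξ - P.hi (S ξ) ≤ P.excess (S ξ) (p ξ) := le_max_left _ _
    have h2 := P.strictAntiOn_hi.antitoneOn P.a_mem (h.mem01 ξ) (h.mem ξ).1.le
    linarith [(hR' ξ).2]
  refine ⟨|P.hi P.a + R - (P.lo P.t - R)| + 1, by positivity, fun ξ η => ?_⟩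
  have := le_abs_self (P.hi P.a + R - (P.lo P.t - R))
  rw [abs_le]
  constructor <;> linarith [hl ξ, hl η, hu ξ, hu η]

/-- The saturation varies arbitrarily slowly. If it did not converge to `b`, then `p' = g S` would
be bounded away from zero over arbitrarily long periods, although `p` is bounded. -/
theorem tendsto_b : Tendsto S atTop (𝓝 P.b) := by
  by_contra hcon
  rw [Metric.tendsto_atTop] at hcon
  push Not at hcon
  obtain ⟨δ, hδ, hfar⟩ := hcon
  obtain ⟨W, hW, hW'⟩ := h.exists_p_bound
  have hκ := h.κ_pos
  set e := P.energy κ (S 0) (p 0) with he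
  have he0 : e < 0 := h.energy_lt_zero 0
  have hpotc : ContinuousOn P.pot (Icc P.a P.t) := fun x hx =>
    (P.hasDerivAt_pot (P.Icc_subset hx)).continuousAt.continuousWithinAt
  have hK : IsCompact (Icc P.a P.t ∩ (P.pot ⁻¹' Iic e ∩ {x | δ / 2 ≤ |x - P.b|})) := by
    have h1 : IsClosed (Icc P.a P.t ∩ P.pot ⁻¹' Iic e) :=
      hpotc.preimage_isClosed_of_isClosed isClosed_Icc isClosed_Iic
    have h2 : IsClosed {x : ℝ | δ / 2 ≤ |x - P.b|} := isClosed_le continuous_const (by fun_prop)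
    rw [← inter_assoc]
    exact isCompact_Icc.of_isClosed_subset (h1.inter h2) (fun x hx => hx.1.1)
  -- the energy excludes the end points `a` and `t` from the compact set
  obtain ⟨η, hη, hη'⟩ := hK.exists_forall_le' (f := fun x => |P.g x|) (a := 0)
    ((P.continuousOn_g.mono (inter_subset_left.trans P.Icc_subset)).abs) (by
      rintro x ⟨hx, hxe, hxb⟩
      have hxe' : P.pot x < 0 := lt_of_le_of_lt hxe he0
      have hxa : x ≠ P.a := by rintro rfl; rw [P.pot_a] at hxe'; exact lt_irrefl _ hxe'
      have hxt : x ≠ P.t := by rintro rfl; exact absurd P.area_nonneg (not_le.2 hxe')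
      refine abs_pos.2 ?_
      rcases lt_trichotomy x P.b with hlt | rfl | hgt
      · exact (P.g_neg x ⟨lt_of_le_of_ne hx.1 hxa.symm, hlt⟩).ne
      · have hxb' : δ / 2 ≤ |P.b - P.b| := hxb
        rw [sub_self, abs_zero] at hxb'
        linarith
      · exact (P.g_pos x ⟨hgt, lt_of_le_of_ne hx.2 hxt⟩).ne')
  set T := W / η + 1 with hT
  have hT0 : 0 < T := by positivity
  have hS' : Tendsto (fun ξ => (P.deficit (S ξ) (p ξ) - P.excess (S ξ) (p ξ)) / κ) atTop (𝓝 0) := by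
    simpa using (h.tendsto_deficit.sub h.tendsto_excess).div_const κ
  obtain ⟨N, hN⟩ := eventually_atTop.1 (hS'.eventually
    (Metric.ball_mem_nhds 0 (show 0 < δ / (2 * T) by positivity)))
  obtain ⟨ξ, hξN, hξ⟩ := hfar (max N 0)
  have hξN' : N ≤ ξ := (le_max_left _ _).trans hξN
  have hξ0 : 0 ≤ ξ := (le_max_right _ _).trans hξN
  have hmemK : ∀ x ∈ Icc ξ (ξ + T), η ≤ |P.g (S x)| := by
    intro x hx
    refine hη' (S x) ⟨Ioo_subset_Icc_self (h.mem x), ?_, ?_⟩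
    · have h1 := h.energy_antitone (hξ0.trans hx.1)
      have h2 : 0 ≤ (P.deficit (S x) (p x) ^ 2 + P.excess (S x) (p x) ^ 2) / (2 * κ) := by
        positivity
      have h3 : P.energy κ (S x) (p x) ≤ e := h1
      simp only [mem_preimage, mem_Iic]
      unfold energy at h3
      linarith
    · have h1 := (convex_Icc ξ (ξ + T)).norm_image_sub_le_of_norm_hasDerivWithin_le
        (f := S) (C := δ / (2 * T)) (fun y _ => (h.solves y).eq_S.hasDerivWithinAt) (fun y hy => by
          have := hN y (hξN'.trans hy.1)
          rw [dist_zero_right] at this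
          exact this.le) ⟨le_rfl, by linarith⟩ hx
      have h2 : δ / (2 * T) * ‖x - ξ‖ ≤ δ / 2 := by
        rw [Real.norm_eq_abs, abs_of_nonneg (by linarith [hx.1])]
        calc δ / (2 * T) * (x - ξ) ≤ δ / (2 * T) * T := by
              gcongr; linarith [hx.2]
          _ = δ / 2 := by field_simp
      rw [Real.dist_eq] at hξ
      rw [Real.norm_eq_abs] at h1
      have h3 := abs_sub_le (S ξ) (S x) P.b
      rw [abs_sub_comm (S ξ) (S x)] at h3
      change δ / 2 ≤ |S x - P.b|
      linarith
  obtain ⟨x, hx, hx'⟩ := exists_hasDerivAt_eq_slope p (fun ξ => P.g (S ξ))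
    (show ξ < ξ + T by linarith) h.continuous_p.continuousOn (fun y _ => (h.solves y).eq_p)
  have h1 := hmemK x (Ioo_subset_Icc_self hx)
  rw [hx', add_sub_cancel_left, abs_div, abs_of_pos hT0, le_div_iff₀ hT0] at h1
  have h2 := hW' (ξ + T) ξ
  have h3 : η * T = W + η := by rw [hT]; field_simp
  linarith

theorem tendsto_infDist_segment : Tendsto (fun ξ => Metric.infDist (S ξ, p ξ)
    (segment ℝ (P.b, P.lo P.b) (P.b, P.hi P.b))) atTop (𝓝 0) := by
  have hlo : Tendsto (fun ξ => P.lo (S ξ)) atTop (𝓝 (P.lo P.b)) :=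
    (hasDerivAt_lo P.b_mem).continuousAt.tendsto.comp h.tendsto_b
  have hhi : Tendsto (fun ξ => P.hi (S ξ)) atTop (𝓝 (P.hi P.b)) :=
    (hasDerivAt_hi P.b_mem).continuousAt.tendsto.comp h.tendsto_b
  have hlim : Tendsto (fun ξ => |S ξ - P.b| + (P.deficit (S ξ) (p ξ) + |P.lo (S ξ) - P.lo P.b| +
      (P.excess (S ξ) (p ξ) + |P.hi (S ξ) - P.hi P.b|))) atTop (𝓝 0) := by
    have h1 := (h.tendsto_b.sub_const P.b).abs
    have h2 := (hlo.sub_const (P.lo P.b)).abs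
    have h3 := (hhi.sub_const (P.hi P.b)).abs
    simpa using h1.add ((h.tendsto_deficit.add h2).add (h.tendsto_excess.add h3))
  refine squeeze_zero (fun _ => Metric.infDist_nonneg) (fun ξ => ?_) hlim
  have hlh := (P.lo_lt_hi _ P.b_mem).le
  -- compare with the point of the segment over `b` obtained by clamping `p`
  have hq : (P.b, max (P.lo P.b) (min (P.hi P.b) (p ξ))) ∈
      segment ℝ (P.b, P.lo P.b) (P.b, P.hi P.b) := by
    rw [← Prod.image_mk_segment_right, segment_eq_Icc hlh]
    exact ⟨_, ⟨le_max_left _ _, max_le hlh (min_le_left _ _)⟩, rfl⟩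
  refine (Metric.infDist_le_dist_of_mem hq).trans ?_
  have h1 : P.lo (S ξ) - p ξ ≤ P.deficit (S ξ) (p ξ) := le_max_left _ _
  have h2 : p ξ - P.hi (S ξ) ≤ P.excess (S ξ) (p ξ) := le_max_left _ _
  have h3 : 0 ≤ P.deficit (S ξ) (p ξ) := deficit_nonneg
  have h4 : 0 ≤ P.excess (S ξ) (p ξ) := excess_nonneg
  have h5 := neg_abs_le (P.lo (S ξ) - P.lo P.b)
  have h6 := le_abs_self (P.hi (S ξ) - P.hi P.b)
  have h7 := abs_nonneg (P.lo (S ξ) - P.lo P.b)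
  have h8 := abs_nonneg (P.hi (S ξ) - P.hi P.b)
  have h9 := abs_nonneg (S ξ - P.b)
  rw [Prod.dist_eq, Real.dist_eq, Real.dist_eq]
  simp only
  refine max_le (by linarith) ?_
  rcases le_total (p ξ) (P.lo P.b) with hc | hc
  · rw [min_eq_right (hc.trans hlh), max_eq_left hc, abs_of_nonpos (by linarith)]
    linarith
  · rcases le_total (p ξ) (P.hi P.b) with hd | hd
    · rw [min_eq_right hd, max_eq_right hc, sub_self, abs_zero]
      linarith
    · rw [min_eq_left hd, max_eq_right hlh, abs_of_nonneg (by linarith)]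
      linarith

end IsPath

end PlaySystem

end TwoPhase

/-! ### Uniqueness at equilibria and passages of the line `S = b` -/

namespace TwoPhase
namespace PlaySystem

variable {P : PlaySystem} {κ : ℝ} {S p : ℝ → ℝ} {ξ : ℝ}

theorem exists_lipschitz_of_contDiffOn {f : ℝ → ℝ} (hf : ContDiffOn ℝ 1 f (Ioo 0 1)) {l u : ℝ}
    (hl : 0 < l) (hu : u < 1) : ∃ K, 0 ≤ K ∧ ∀ x ∈ Icc l u, ∀ y ∈ Icc l u,
      |f x - f y| ≤ K * |x - y| := by
  have hsub : Icc l u ⊆ Ioo 0 1 := fun x hx => ⟨hl.trans_le hx.1, hx.2.trans_lt hu⟩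
  obtain ⟨K, hK⟩ := isCompact_Icc.exists_bound_of_continuousOn
    ((hf.continuousOn_deriv_of_isOpen isOpen_Ioo le_rfl).mono hsub)
  refine ⟨max K 0, le_max_right _ _, fun x hx y hy => ?_⟩
  refine (convex_Icc l u).norm_image_sub_le_of_norm_hasDerivWithin_le (f := f) (f' := deriv f)
    (fun z hz => ?_) (fun z hz => (hK z hz).trans (le_max_left _ _)) hy hx
  exact (((hf.differentiableOn (by norm_num)).differentiableAt
    (isOpen_Ioo.mem_nhds (hsub hz))).hasDerivAt).hasDerivWithinAt

variable (P) in
theorem exists_lipschitz {l u : ℝ} (hl : 0 < l) (hu : u < 1) : ∃ K, 0 ≤ K ∧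
    ∀ z ∈ Icc l u ×ˢ (univ : Set ℝ), ∀ z' ∈ Icc l u ×ˢ (univ : Set ℝ),
      |P.deficit z.1 z.2 - P.deficit z'.1 z'.2| ≤ K * dist z z' ∧
      |P.excess z.1 z.2 - P.excess z'.1 z'.2| ≤ K * dist z z' ∧
      |P.g z.1 - P.g z'.1| ≤ K * dist z z' := by
  obtain ⟨K₁, h1, h1'⟩ := exists_lipschitz_of_contDiffOn P.lo_contDiffOn hl hu
  obtain ⟨K₂, h2, h2'⟩ := exists_lipschitz_of_contDiffOn P.hi_contDiffOn hl hu
  obtain ⟨K₃, h3, h3'⟩ := exists_lipschitz_of_contDiffOn (P.g_contDiffOn.of_le (by norm_num)) hl hu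
  refine ⟨K₁ + K₂ + K₃ + 1, by positivity, ?_⟩
  rintro ⟨x, y⟩ ⟨hx, -⟩ ⟨x', y'⟩ ⟨hx', -⟩
  have hdx : |x - x'| ≤ dist (x, y) (x', y') := le_max_left _ _
  have hdy : |y - y'| ≤ dist (x, y) (x', y') := le_max_right _ _
  have hd : 0 ≤ dist (x, y) (x', y') := dist_nonneg
  set d := dist (x, y) (x', y')
  have g1 : K₁ * |x - x'| ≤ K₁ * d := by gcongr
  have g2 : K₂ * |x - x'| ≤ K₂ * d := by gcongr
  have g3 : K₃ * |x - x'| ≤ K₃ * d := by gcongr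
  have k1 := h1' x hx x' hx'
  have k2 := h2' x hx x' hx'
  have k3 := h3' x hx x' hx'
  have p1 := mul_nonneg h1 hd
  have p2 := mul_nonneg h2 hd
  have p3 := mul_nonneg h3 hd
  refine ⟨?_, ?_, ?_⟩
  · refine (abs_max_sub_max_le_abs _ _ _).trans ?_
    simp only
    have e : P.lo x - y - (P.lo x' - y') = (P.lo x - P.lo x') - (y - y') := by ring
    rw [e]
    refine (abs_sub _ _).trans ?_
    linarith
  · refine (abs_max_sub_max_le_abs _ _ _).trans ?_
    simp only
    have e : y - P.hi x - (y' - P.hi x') = (y - y') - (P.hi x - P.hi x') := by ring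
    rw [e]
    refine (abs_sub _ _).trans ?_
    linarith
  · simp only
    linarith

/-- An equilibrium is not reached in finite time. -/
theorem eq_equilibrium (hκ : 0 < κ) {s₀ p₀ ξ₀ : ℝ} (hs₀ : s₀ ∈ Ioo (0 : ℝ) 1) (hg : P.g s₀ = 0)
    (hlo : P.lo s₀ ≤ p₀) (hhi : p₀ ≤ P.hi s₀) (hmem : ∀ ξ, S ξ ∈ Ioo (0 : ℝ) 1)
    (hsol : ∀ ξ, P.SolvesAt κ S p ξ) (hS : S ξ₀ = s₀) (hp : p ξ₀ = p₀) (ξ : ℝ) :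
    S ξ = s₀ ∧ p ξ = p₀ := by
  have hSc : Continuous S := continuous_iff_continuousAt.2 fun ξ => (hsol ξ).eq_S.continuousAt
  have hpc : Continuous p := continuous_iff_continuousAt.2 fun ξ => (hsol ξ).eq_p.continuousAt
  set u := min ξ ξ₀ - 1
  set v := max ξ ξ₀ + 1
  have huv : u ≤ v := by
    have h1 := min_le_left ξ ξ₀
    have h2 := le_max_left ξ ξ₀
    simp only [u, v]; linarith
  obtain ⟨x, -, hx⟩ := isCompact_Icc.exists_isMinOn (nonempty_Icc.2 huv) hSc.continuousOn
  obtain ⟨y, -, hy⟩ := isCompact_Icc.exists_isMaxOn (nonempty_Icc.2 huv) hSc.continuousOn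
  obtain ⟨K, hK0, hK⟩ := P.exists_lipschitz (l := min (S x) s₀) (u := max (S y) s₀)
    (lt_min (hmem x).1 hs₀.1) (max_lt (hmem y).2 hs₀.2)
  have hξ₀ : ξ₀ ∈ Ioo u v := by
    have h1 := min_le_right ξ ξ₀
    have h2 := le_max_right ξ ξ₀
    constructor <;> simp only [u, v] <;> linarith
  have hξ : ξ ∈ Ioo u v := by
    have h1 := min_le_left ξ ξ₀
    have h2 := le_max_left ξ ξ₀
    constructor <;> simp only [u, v] <;> linarith
  have key := ODE_solution_unique_of_mem_Icc (E := ℝ × ℝ) (a := u) (b := v) (t₀ := ξ₀)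
    (K := Real.toNNReal (K * (2 / κ) + K))
    (v := fun _ z => ((P.deficit z.1 z.2 - P.excess z.1 z.2) / κ, P.g z.1))
    (s := fun _ => Icc (min (S x) s₀) (max (S y) s₀) ×ˢ univ)
    (f := fun ξ => (S ξ, p ξ)) (g := fun _ => (s₀, p₀)) ?_ hξ₀
    (hSc.prodMk hpc).continuousOn (fun ξ _ => (hsol ξ).eq_S.prodMk (hsol ξ).eq_p)
    (fun ξ hξ => ⟨⟨(min_le_left _ _).trans (hx (Ioo_subset_Icc_self hξ)),
      (hy (Ioo_subset_Icc_self hξ)).trans (le_max_left _ _)⟩, trivial⟩) continuousOn_const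
    (fun ξ _ => by
      rw [hg, deficit_eq_zero hlo, excess_eq_zero hhi, sub_zero, zero_div]
      exact hasDerivAt_const _ _) (fun _ _ => ⟨⟨min_le_right _ _, le_max_right _ _⟩, trivial⟩)
    (by simp only [hS, hp])
  · have := key (Ioo_subset_Icc_self hξ)
    exact Prod.mk.inj this
  · intro _ _
    refine LipschitzOnWith.of_dist_le_mul fun z hz z' hz' => ?_
    obtain ⟨k1, k2, k3⟩ := hK z hz z' hz'
    rw [Real.coe_toNNReal _ (by positivity)]
    have hd : 0 ≤ dist z z' := dist_nonneg
    rw [Prod.dist_eq, Real.dist_eq, Real.dist_eq]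
    simp only
    refine max_le ?_ ?_
    · rw [← sub_div, abs_div, abs_of_pos hκ, div_le_iff₀ hκ]
      have e : P.deficit z.1 z.2 - P.excess z.1 z.2 - (P.deficit z'.1 z'.2 - P.excess z'.1 z'.2) =
        (P.deficit z.1 z.2 - P.deficit z'.1 z'.2) - (P.excess z.1 z.2 - P.excess z'.1 z'.2) := by
        ring
      rw [e]
      refine (abs_sub _ _).trans ?_
      have e2 : (K * (2 / κ) + K) * dist z z' * κ = 2 * (K * dist z z') + K * dist z z' * κ := by
        field_simp
      rw [e2]
      have : 0 ≤ K * dist z z' * κ := by positivity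
      linarith
    · have : 0 ≤ K * (2 / κ) * dist z z' := by positivity
      linarith

namespace IsPath

variable (h : P.IsPath κ S p)
include h

theorem hasDerivAt_S (ξ : ℝ) :
    HasDerivAt S ((P.deficit (S ξ) (p ξ) - P.excess (S ξ) (p ξ)) / κ) ξ := (h.solves ξ).eq_S

/-- The line `S = b` is never met on the segment of equilibria. -/
theorem lt_lo_or_hi_lt (hξ : S ξ = P.b) : p ξ < P.lo P.b ∨ P.hi P.b < p ξ := by
  by_contra! hcon
  have heq := eq_equilibrium h.κ_pos P.b_mem P.g_b hcon.1 hcon.2 h.mem01 h.solves hξ rfl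
  have h1 : Tendsto S atBot (𝓝 P.b) :=
    tendsto_const_nhds.congr fun η => (heq η).1.symm
  exact P.a_lt_b.ne (tendsto_nhds_unique h.tendsto_S h1)

theorem deriv_pos_of_lt_lo (hlt : p ξ < P.lo (S ξ)) :
    0 < (P.deficit (S ξ) (p ξ) - P.excess (S ξ) (p ξ)) / κ := by
  rw [deficit_eq hlt.le, excess_eq_zero (hlt.le.trans (P.lo_lt_hi _ (h.mem01 ξ)).le)]
  exact div_pos (by linarith) h.κ_pos

theorem deriv_neg_of_hi_lt (hlt : P.hi (S ξ) < p ξ) :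
    (P.deficit (S ξ) (p ξ) - P.excess (S ξ) (p ξ)) / κ < 0 := by
  rw [excess_eq hlt.le, deficit_eq_zero ((P.lo_lt_hi _ (h.mem01 ξ)).le.trans hlt.le)]
  exact div_neg_of_neg_of_pos (by linarith) h.κ_pos

theorem finite_crossings (u v : ℝ) : {ξ ∈ Icc u v | S ξ = P.b}.Finite := by
  have := finite_zeros_Icc (f := fun ξ => S ξ - P.b) (fun x => (h.hasDerivAt_S x).sub_const _)
    (fun x hx => ?_) u v
  · simpa only [sub_eq_zero] using this
  · have hx' : S x = P.b := sub_eq_zero.1 hx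
    rcases h.lt_lo_or_hi_lt hx' with h1 | h1
    · exact (h.deriv_pos_of_lt_lo (by rwa [hx'])).ne'
    · exact (h.deriv_neg_of_hi_lt (by rwa [hx'])).ne

theorem exists_next_down {u z : ℝ} (hu : S u = P.b) (hu' : p u < P.lo P.b) (huz : u < z)
    (hz : S z = P.b) : ∃ d, u < d ∧ S d = P.b ∧ P.hi P.b < p d ∧ ∀ x ∈ Ioo u d, P.b < S x := by
  obtain ⟨d, h1, h2, h3, h4⟩ := exists_next_zero (f := fun ξ => S ξ - P.b)
    (fun x => (h.hasDerivAt_S x).sub_const _) (sub_eq_zero.2 hu)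
    (h.deriv_pos_of_lt_lo (by rwa [hu])) huz (sub_eq_zero.2 hz)
  have h2' : S d = P.b := sub_eq_zero.1 h2
  refine ⟨d, h1, h2', ?_, fun x hx => sub_pos.1 (h3 x hx)⟩
  refine (h.lt_lo_or_hi_lt h2').resolve_left fun h5 => ?_
  exact absurd h4 (not_le.2 (h.deriv_pos_of_lt_lo (by rwa [h2'])))

theorem exists_next_up {u z : ℝ} (hu : S u = P.b) (hu' : P.hi P.b < p u) (huz : u < z)
    (hz : S z = P.b) : ∃ d, u < d ∧ S d = P.b ∧ p d < P.lo P.b ∧ ∀ x ∈ Ioo u d, S x < P.b := by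
  obtain ⟨d, h1, h2, h3, h4⟩ := exists_next_zero (f := fun ξ => P.b - S ξ)
    (fun x => (h.hasDerivAt_S x).const_sub _) (sub_eq_zero.2 hu.symm)
    (neg_pos.2 (h.deriv_neg_of_hi_lt (by rwa [hu]))) huz (sub_eq_zero.2 hz.symm)
  have h2' : S d = P.b := (sub_eq_zero.1 h2).symm
  refine ⟨d, h1, h2', ?_, fun x hx => sub_pos.1 (h3 x hx)⟩
  refine (h.lt_lo_or_hi_lt h2').resolve_right fun h5 => ?_
  exact absurd h4 (not_le.2 (neg_pos.2 (h.deriv_neg_of_hi_lt (by rwa [h2']))))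

theorem hasDerivAt_lo_sub (ξ : ℝ) : HasDerivAt (fun ξ => P.lo (S ξ) - p ξ)
    (deriv P.lo (S ξ) * ((P.deficit (S ξ) (p ξ) - P.excess (S ξ) (p ξ)) / κ) - P.g (S ξ)) ξ :=
  ((hasDerivAt_lo (h.mem01 ξ)).comp ξ (h.hasDerivAt_S ξ)).sub (h.solves ξ).eq_p

theorem hasDerivAt_sub_hi (ξ : ℝ) : HasDerivAt (fun ξ => p ξ - P.hi (S ξ))
    (P.g (S ξ) - deriv P.hi (S ξ) * ((P.deficit (S ξ) (p ξ) - P.excess (S ξ) (p ξ)) / κ)) ξ :=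
  (h.solves ξ).eq_p.sub ((hasDerivAt_hi (h.mem01 ξ)).comp ξ (h.hasDerivAt_S ξ))

/-- On `lo S = p`, for `S < b`, the difference `lo S - p` has derivative `-g S > 0`. -/
theorem lt_lo_of_le {ξ₀ ξ₁ : ℝ} (h01 : ξ₀ ≤ ξ₁) (h0 : p ξ₀ < P.lo (S ξ₀))
    (hlt : ∀ ξ ∈ Ioc ξ₀ ξ₁, S ξ < P.b) : p ξ₁ < P.lo (S ξ₁) := by
  refine sub_pos.1 (pos_of_deriv_pos_of_zero (f := fun ξ => P.lo (S ξ) - p ξ) h01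
    (fun x _ => (h.hasDerivAt_lo_sub x).continuousAt.continuousWithinAt) (sub_pos.2 h0) ?_)
  intro x hx hx0
  refine ⟨_, ?_, h.hasDerivAt_lo_sub x⟩
  have hx0' : p x = P.lo (S x) := (sub_eq_zero.1 hx0).symm
  rw [hx0', deficit_lo_self, excess_lo_self (h.mem01 x)]
  have := P.g_neg (S x) ⟨(h.mem x).1, hlt x hx⟩
  simpa using this

/-- The first passage of the line `S = b` is from left to right. -/
theorem exists_first_crossing (hex : ∃ ξ, S ξ = P.b) :
    ∃ ξ, S ξ = P.b ∧ p ξ < P.lo P.b ∧ ∀ η ≤ ξ, S η ≤ P.b ∧ p η < P.lo (S η) := by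
  obtain ⟨N, hN⟩ := eventually_atBot.1
    ((h.tendsto_S.eventually (gt_mem_nhds P.a_lt_b)).and h.start)
  have hbd : BddBelow {ξ | S ξ = P.b} := ⟨N, fun ξ hξ => by
    by_contra! hlt
    exact (hN ξ hlt.le).1.ne hξ⟩
  have hz := (isClosed_eq h.continuous_S continuous_const).csInf_mem hex hbd
  set z := sInf {ξ | S ξ = P.b}
  have hz' : S z = P.b := hz
  have hlt : ∀ η < z, S η < P.b := fun η hη => by
    by_contra! hcon
    obtain ⟨x, hx, hx'⟩ := intermediate_value_Icc (min_le_right N η) h.continuous_S.continuousOn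
      ⟨(hN _ (min_le_left N η)).1.le, hcon⟩
    exact absurd ((csInf_le hbd hx').trans hx.2) (not_le.2 hη)
  have hp : ∀ η < z, p η < P.lo (S η) := fun η hη =>
    h.lt_lo_of_le (min_le_right N η) (hN _ (min_le_left N η)).2 fun x hx => hlt x (hx.2.trans_lt hη)
  have hpz : p z < P.lo P.b := by
    refine (h.lt_lo_or_hi_lt hz').resolve_right (not_lt.2 ?_)
    have h1 : Tendsto (fun ξ => P.lo (S ξ) - p ξ) (𝓝[<] z) (𝓝 (P.lo (S z) - p z)) :=
      (h.hasDerivAt_lo_sub z).continuousAt.continuousWithinAt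
    have h2 := ge_of_tendsto h1
      (eventually_nhdsWithin_of_forall fun η hη => (sub_pos.2 (hp η hη)).le)
    rw [hz'] at h2
    linarith [P.lo_lt_hi _ P.b_mem]
  refine ⟨z, hz', hpz, fun η hη => ?_⟩
  rcases hη.lt_or_eq with h1 | rfl
  · exact ⟨(hlt η h1).le, hp η h1⟩
  · exact ⟨hz'.le, by rwa [hz']⟩

/-- If the line `S = b` is met at arbitrarily late times, the passages alternate in direction,
and two successive ones form a turn. -/
theorem exists_turns (hfreq : ∃ᶠ ξ in atTop, S ξ = P.b) :
    ∃ s : ℕ → ℝ, StrictMono s ∧ Tendsto s atTop atTop ∧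
      ∀ n, (S (s n) = P.b ∧ p (s n) < P.lo P.b) ∧ ∃ d, s n < d ∧ d < s (n + 1) ∧
        (∀ ξ ∈ Ioo (s n) d, P.b < S ξ) ∧ (S d = P.b ∧ P.hi P.b < p d) ∧
        ∀ ξ ∈ Ioo d (s (n + 1)), S ξ < P.b := by
  have hlate : ∀ x, ∃ z, x < z ∧ S z = P.b := fun x => by
    obtain ⟨z, hz, hz'⟩ := (hfreq.and_eventually (eventually_gt_atTop x)).exists
    exact ⟨z, hz', hz⟩
  obtain ⟨u₀, hu₀, hu₀', -⟩ := h.exists_first_crossing hfreq.exists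
  have hstep : ∀ u : {u // S u = P.b ∧ p u < P.lo P.b}, ∃ v : {u // S u = P.b ∧ p u < P.lo P.b},
      ∃ d, u.1 < d ∧ d < v.1 ∧ (∀ ξ ∈ Ioo u.1 d, P.b < S ξ) ∧ (S d = P.b ∧ P.hi P.b < p d) ∧
        ∀ ξ ∈ Ioo d v.1, S ξ < P.b := by
    rintro ⟨u, hu, hu'⟩
    obtain ⟨z, hz, hz'⟩ := hlate u
    obtain ⟨d, h1, h2, h3, h4⟩ := h.exists_next_down hu hu' hz hz'
    obtain ⟨y, hy, hy'⟩ := hlate d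
    obtain ⟨v, h5, h6, h7, h8⟩ := h.exists_next_up h2 h3 hy hy'
    exact ⟨⟨v, h6, h7⟩, d, h1, h5, h4, ⟨h2, h3⟩, h8⟩
  choose nxt hnxt using hstep
  set s : ℕ → {u // S u = P.b ∧ p u < P.lo P.b} := fun n => nxt^[n] ⟨u₀, hu₀, hu₀'⟩ with hs
  have hsucc : ∀ n, s (n + 1) = nxt (s n) := fun n => Function.iterate_succ_apply' _ _ _
  have hmono : StrictMono fun n => (s n).1 := strictMono_nat_of_lt_succ fun n => by
    obtain ⟨d, h1, h2, -⟩ := hnxt (s n)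
    rw [hsucc]
    exact h1.trans h2
  refine ⟨fun n => (s n).1, hmono, ?_, fun n => ⟨(s n).2, ?_⟩⟩
  · refine tendsto_atTop_atTop_of_monotone hmono.monotone fun M => ?_
    by_contra! hcon
    refine (Set.infinite_range_of_injective hmono.injective).mono ?_ (h.finite_crossings (s 0).1 M)
    rintro _ ⟨n, rfl⟩
    exact ⟨⟨hmono.monotone (Nat.zero_le n), (hcon n).le⟩, (s n).2.1⟩
  · simp only [hsucc]
    exact hnxt (s n)

theorem finite_all_crossings (hev : ∀ᶠ ξ in atTop, S ξ ≠ P.b) : {ξ | S ξ = P.b}.Finite := by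
  obtain ⟨M, hM⟩ := eventually_atTop.1 hev
  obtain ⟨N, hN⟩ := eventually_atBot.1 (h.tendsto_S.eventually (gt_mem_nhds P.a_lt_b))
  refine (h.finite_crossings N M).subset fun ξ hξ => ⟨⟨?_, ?_⟩, hξ⟩
  · by_contra! hlt
    exact (hN ξ hlt.le).ne hξ
  · by_contra! hlt
    exact hM ξ hlt.le hξ

theorem eventually_lt_or_gt (hev : ∀ᶠ ξ in atTop, S ξ ≠ P.b) :
    (∀ᶠ ξ in atTop, S ξ < P.b) ∨ ∀ᶠ ξ in atTop, P.b < S ξ := by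
  obtain ⟨M, hM⟩ := eventually_atTop.1 hev
  rcases lt_or_gt_of_ne (hM M le_rfl) with hlt | hgt
  · refine Or.inl (eventually_atTop.2 ⟨M, fun ξ hξ => ?_⟩)
    by_contra! hcon
    obtain ⟨η, hη, hη'⟩ := intermediate_value_Icc hξ h.continuous_S.continuousOn ⟨hlt.le, hcon⟩
    exact hM η hη.1 hη'
  · refine Or.inr (eventually_atTop.2 ⟨M, fun ξ hξ => ?_⟩)
    by_contra! hcon
    obtain ⟨η, hη, hη'⟩ := intermediate_value_Icc' hξ h.continuous_S.continuousOn ⟨hcon, hgt.le⟩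
    exact hM η hη.1 hη'

theorem hi_lt_of_le {ξ₀ ξ₁ : ℝ} (h01 : ξ₀ ≤ ξ₁) (h0 : P.hi (S ξ₀) < p ξ₀)
    (hlt : ∀ ξ ∈ Ioc ξ₀ ξ₁, P.b < S ξ) : P.hi (S ξ₁) < p ξ₁ := by
  refine sub_pos.1 (pos_of_deriv_pos_of_zero (f := fun ξ => p ξ - P.hi (S ξ)) h01
    (fun x _ => (h.hasDerivAt_sub_hi x).continuousAt.continuousWithinAt) (sub_pos.2 h0) ?_)
  intro x hx hx0
  refine ⟨_, ?_, h.hasDerivAt_sub_hi x⟩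
  have hx0' : p x = P.hi (S x) := sub_eq_zero.1 hx0
  rw [hx0', deficit_eq_zero (P.lo_lt_hi _ (h.mem01 x)).le, excess_eq_zero le_rfl]
  have := P.g_pos (S x) ⟨hlt x hx, (h.mem x).2⟩
  simpa using this

/-- `S` increases only below the curve `lo`, and there the orbit stays while `S < b`. -/
theorem eventually_lt_lo (hev : ∀ᶠ ξ in atTop, S ξ < P.b) : ∀ᶠ ξ in atTop, p ξ < P.lo (S ξ) := by
  obtain ⟨M, hM⟩ := eventually_atTop.1 hev
  obtain ⟨ξ₁, h1, h1'⟩ : ∃ ξ₁ ≥ M, p ξ₁ < P.lo (S ξ₁) := by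
    by_contra! hcon
    -- `S` would be nonincreasing and could not tend to `b` from the left
    have hanti : AntitoneOn S (Ici M) := by
      refine antitoneOn_of_hasDerivWithinAt_nonpos (convex_Ici _) h.continuous_S.continuousOn
        (fun x _ => (h.hasDerivAt_S x).hasDerivWithinAt) (fun x hx => ?_)
      rw [deficit_eq_zero (hcon x (mem_Ici.1 (interior_subset hx)))]
      exact div_nonpos_of_nonpos_of_nonneg
        (by linarith [excess_nonneg (P := P) (S := S x) (p := p x)])
        h.κ_pos.le
    have := le_of_tendsto h.tendsto_b ((eventually_ge_atTop M).mono fun ξ hξ =>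
      hanti self_mem_Ici (mem_Ici.2 hξ) hξ)
    exact absurd this (not_le.2 (hM M le_rfl))
  filter_upwards [eventually_ge_atTop ξ₁] with ξ hξ
  exact h.lt_lo_of_le hξ h1' fun η hη => hM η (h1.trans hη.1.le)

/-- `S` decreases only above the curve `hi`, and there the orbit stays while `S > b`. -/
theorem eventually_hi_lt (hev : ∀ᶠ ξ in atTop, P.b < S ξ) : ∀ᶠ ξ in atTop, P.hi (S ξ) < p ξ := by
  obtain ⟨M, hM⟩ := eventually_atTop.1 hev
  obtain ⟨ξ₁, h1, h1'⟩ : ∃ ξ₁ ≥ M, P.hi (S ξ₁) < p ξ₁ := by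
    by_contra! hcon
    have hmono : MonotoneOn S (Ici M) := by
      refine monotoneOn_of_hasDerivWithinAt_nonneg (convex_Ici _) h.continuous_S.continuousOn
        (fun x _ => (h.hasDerivAt_S x).hasDerivWithinAt) (fun x hx => ?_)
      rw [excess_eq_zero (hcon x (mem_Ici.1 (interior_subset hx)))]
      exact div_nonneg (by linarith [deficit_nonneg (P := P) (S := S x) (p := p x)]) h.κ_pos.le
    have := ge_of_tendsto h.tendsto_b ((eventually_ge_atTop M).mono fun ξ hξ =>
      hmono self_mem_Ici (mem_Ici.2 hξ) hξ)
    exact absurd this (not_le.2 (hM M le_rfl))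
  filter_upwards [eventually_ge_atTop ξ₁] with ξ hξ
  exact h.hi_lt_of_le hξ h1' fun η hη => hM η (h1.trans hη.1.le)

theorem tendsto_lo_b (hev : ∀ᶠ ξ in atTop, S ξ < P.b) : Tendsto p atTop (𝓝 (P.lo P.b)) := by
  have h1 : Tendsto (fun ξ => P.lo (S ξ) - P.deficit (S ξ) (p ξ)) atTop (𝓝 (P.lo P.b - 0)) :=
    ((hasDerivAt_lo P.b_mem).continuousAt.tendsto.comp h.tendsto_b).sub h.tendsto_deficit
  rw [sub_zero] at h1
  refine h1.congr' ?_
  filter_upwards [h.eventually_lt_lo hev] with ξ hξ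
  rw [deficit_eq hξ.le]; ring

theorem tendsto_hi_b (hev : ∀ᶠ ξ in atTop, P.b < S ξ) : Tendsto p atTop (𝓝 (P.hi P.b)) := by
  have h1 : Tendsto (fun ξ => P.hi (S ξ) + P.excess (S ξ) (p ξ)) atTop (𝓝 (P.hi P.b + 0)) :=
    ((hasDerivAt_hi P.b_mem).continuousAt.tendsto.comp h.tendsto_b).add h.tendsto_excess
  rw [add_zero] at h1
  refine h1.congr' ?_
  filter_upwards [h.eventually_hi_lt hev] with ξ hξ
  rw [excess_eq hξ.le]; ring

/-! ### No monotone approach to a focus -/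

/-- Monotone approach to `b` along the branch `q` requires real eigenvalues. -/
theorem not_focus {q : ℝ → ℝ} (hq : ∀ x ∈ Ioo (0 : ℝ) 1, HasDerivAt q (deriv q x) x)
    (hqc : ContinuousOn (deriv q) (Ioo 0 1))
    (hev : ∀ᶠ ξ in atTop, HasDerivAt S ((q (S ξ) - p ξ) / κ) ξ) (hne : ∀ᶠ ξ in atTop, S ξ ≠ P.b)
    (hdisc : deriv q P.b ^ 2 < 4 * κ * deriv P.g P.b) : False := by
  have hκ := h.κ_pos
  obtain ⟨N, hN⟩ := eventually_atTop.1 (hev.and hne)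
  refine riccati_no_global_solution (r := fun ξ => -((q (S ξ) - p ξ) / κ) / (S ξ - P.b))
    (P := fun ξ => -(deriv q (S ξ) / κ)) (Q := fun ξ => P.g (S ξ) / (S ξ - P.b) / κ)
    (P₀ := -(deriv q P.b / κ)) (Q₀ := deriv P.g P.b / κ) (ξ₀ := N) ?_ ?_ ?_ ?_
  · intro ξ hξ
    obtain ⟨hd, hn⟩ := hN ξ hξ
    have hn' : S ξ - P.b ≠ 0 := sub_ne_zero.2 hn
    have h1 := ((((hq _ (h.mem01 ξ)).comp ξ hd).sub (h.solves ξ).eq_p).div_const κ).neg.div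
      (hd.sub_const P.b) hn'
    refine h1.congr_deriv ?_
    simp only [Pi.neg_apply, Pi.sub_apply, Function.comp_apply]
    field_simp
    ring
  · have h1 : Tendsto (deriv q) (𝓝 P.b) (𝓝 (deriv q P.b)) :=
      hqc.continuousAt (isOpen_Ioo.mem_nhds P.b_mem)
    exact ((h1.comp h.tendsto_b).div_const κ).neg
  · have h1 := hasDerivAt_iff_tendsto_slope.1 (hasDerivAt_g (P := P) P.b_mem)
    have h2 : Tendsto S atTop (𝓝[≠] P.b) := tendsto_nhdsWithin_iff.2 ⟨h.tendsto_b, hne⟩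
    refine ((h1.comp h2).congr fun ξ => ?_).div_const κ
    simp [slope_def_field, P.g_b]
  · rw [neg_sq, div_pow, mul_div_assoc', div_lt_div_iff₀ (by positivity) hκ]
    nlinarith

theorem not_eventually_lt (hdisc : deriv P.lo P.b ^ 2 < 4 * κ * deriv P.g P.b) :
    ¬ ∀ᶠ ξ in atTop, S ξ < P.b := fun hev => by
  refine h.not_focus (fun x hx => hasDerivAt_lo hx) P.continuousOn_deriv_lo ?_
    (hev.mono fun _ hξ => hξ.ne) hdisc
  filter_upwards [h.eventually_lt_lo hev] with ξ hξ
  have h1 := h.hasDerivAt_S ξ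
  rwa [deficit_eq hξ.le, excess_eq_zero (hξ.le.trans (P.lo_lt_hi _ (h.mem01 ξ)).le), sub_zero] at h1

theorem not_eventually_gt (hdisc : deriv P.hi P.b ^ 2 < 4 * κ * deriv P.g P.b) :
    ¬ ∀ᶠ ξ in atTop, P.b < S ξ := fun hev => by
  refine h.not_focus (fun x hx => hasDerivAt_hi hx) P.continuousOn_deriv_hi ?_
    (hev.mono fun _ hξ => hξ.ne') hdisc
  filter_upwards [h.eventually_hi_lt hev] with ξ hξ
  have h1 := h.hasDerivAt_S ξ
  rwa [excess_eq hξ.le, deficit_eq_zero ((P.lo_lt_hi _ (h.mem01 ξ)).le.trans hξ.le), zero_sub,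
    neg_sub] at h1

end IsPath

end PlaySystem

end TwoPhase

/-! ### No return to a node -/

namespace TwoPhase

theorem tendsto_log_sq_mul {e : ℝ → ℝ} {C α : ℝ} (hα : 0 < α)
    (he : ∀ᶠ x in 𝓝[>] (0 : ℝ), |e x| ≤ C * x ^ α) :
    Tendsto (fun x => Real.log x ^ 2 * e x) (𝓝[>] 0) (𝓝 0) := by
  have h1 := (tendsto_log_mul_rpow_nhdsGT_zero (half_pos hα)).pow 2
  have h2 : Tendsto (fun x => C * (Real.log x * x ^ (α / 2)) ^ 2) (𝓝[>] 0) (𝓝 0) := by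
    simpa using h1.const_mul C
  refine squeeze_zero_norm' ?_ h2
  filter_upwards [he, self_mem_nhdsWithin] with x hx hx0
  have hx0' : (0 : ℝ) < x := hx0
  have h3 : (x ^ (α / 2)) ^ 2 = x ^ α := by
    rw [← Real.rpow_natCast, ← Real.rpow_mul hx0'.le]; norm_num
  rw [Real.norm_eq_abs, abs_mul, abs_of_nonneg (sq_nonneg _), mul_pow, h3]
  calc Real.log x ^ 2 * |e x| ≤ Real.log x ^ 2 * (C * x ^ α) := by gcongr
    _ = C * (Real.log x ^ 2 * x ^ α) := by ring

/-- A strict supersolution `R` of the Riccati equation satisfied by the decay rate `r = -x'/x` of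
solutions of `x'' = -p x' - q x`, as a function of `x`. -/
structure RiccatiBarrier (p q : ℝ → ℝ) (δ r₀ : ℝ) (R R' : ℝ → ℝ) : Prop where
  δ_pos : 0 < δ
  pos : ∀ x ∈ Ioo 0 δ, 0 < R x
  le : ∀ x ∈ Ioo 0 δ, R x ≤ r₀
  hasDerivAt : ∀ x ∈ Ioo 0 δ, HasDerivAt R (R' x) x
  super : ∀ x ∈ Ioo 0 δ, 0 < -R' x * (R x * x) - (R x ^ 2 - p x * R x + q x)

/-- Half of `p₀` lies strictly between the two rest points of the limiting Riccati equation. -/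
theorem exists_barrier_of_node {p q : ℝ → ℝ} {p₀ q₀ : ℝ} (hp : Tendsto p (𝓝[>] 0) (𝓝 p₀))
    (hq : Tendsto q (𝓝[>] 0) (𝓝 q₀)) (hp₀ : 0 < p₀) (hdisc : 4 * q₀ < p₀ ^ 2) :
    ∃ δ r₀ R R', RiccatiBarrier p q δ r₀ R R' := by
  have h1 : Tendsto (fun x => -((p₀ / 2) ^ 2 - p x * (p₀ / 2) + q x)) (𝓝[>] 0)
      (𝓝 (-((p₀ / 2) ^ 2 - p₀ * (p₀ / 2) + q₀))) :=
    ((tendsto_const_nhds.sub (hp.mul_const _)).add hq).neg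
  have h2 := h1.eventually
    (lt_mem_nhds (show 0 < -((p₀ / 2) ^ 2 - p₀ * (p₀ / 2) + q₀) by nlinarith))
  obtain ⟨δ, hδ, hδ'⟩ := mem_nhdsGT_iff_exists_Ioo_subset.1 h2
  refine ⟨δ, p₀ / 2, fun _ => p₀ / 2, fun _ => 0, hδ, fun _ _ => half_pos hp₀, fun _ _ => le_rfl,
    fun x _ => hasDerivAt_const x _, fun x hx => ?_⟩
  have : 0 < -((p₀ / 2) ^ 2 - p x * (p₀ / 2) + q x) := hδ' hx
  linarith

/-- For a double eigenvalue `r₀`, the barrier is `r₀ + A / log x` with `A = r₀ / 4`: the gain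
`A * (r₀ - A) / (log x) ^ 2` beats perturbations of the coefficients of order `x ^ α`. -/
theorem exists_barrier_of_degenerate {p q : ℝ → ℝ} {r₀ C D α : ℝ} (hr₀ : 0 < r₀) (hα : 0 < α)
    (hp : ∀ᶠ x in 𝓝[>] (0 : ℝ), |p x - 2 * r₀| ≤ C * x ^ α)
    (hq : ∀ᶠ x in 𝓝[>] (0 : ℝ), |q x - r₀ ^ 2| ≤ D * x) :
    ∃ δ r₀ R R', RiccatiBarrier p q δ r₀ R R' := by
  have hlog : Tendsto (fun x => r₀ + r₀ / 4 / Real.log x) (𝓝[>] 0) (𝓝 r₀) := by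
    simpa using (Real.tendsto_log_nhdsGT_zero.const_div_atBot (r₀ / 4)).const_add r₀
  have hp' := tendsto_log_sq_mul hα hp
  have hq' := tendsto_log_sq_mul (e := fun x => q x - r₀ ^ 2) (C := D) one_pos
    (by simpa only [Real.rpow_one] using hq)
  have h1 := ((hlog.const_mul (r₀ / 4)).sub_const ((r₀ / 4) ^ 2)).add ((hp'.mul hlog).sub hq')
  have h2 := h1.eventually (lt_mem_nhds
    (show 0 < r₀ / 4 * r₀ - (r₀ / 4) ^ 2 + (0 * r₀ - 0) by nlinarith))
  have h3 := hlog.eventually (lt_mem_nhds hr₀)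
  have h4 : ∀ᶠ x in 𝓝[>] (0 : ℝ), x < 1 := nhdsWithin_le_nhds (gt_mem_nhds one_pos)
  obtain ⟨δ, hδ, hδ'⟩ := mem_nhdsGT_iff_exists_Ioo_subset.1 (h2.and (h3.and h4))
  refine ⟨δ, r₀, fun x => r₀ + r₀ / 4 / Real.log x, fun x => -(r₀ / 4) / Real.log x ^ 2 * x⁻¹, hδ,
    fun x hx => (hδ' hx).2.1, fun x hx => ?_, fun x hx => ?_, fun x hx => ?_⟩
  · have := Real.log_neg hx.1 (hδ' hx).2.2
    have := div_nonpos_of_nonneg_of_nonpos (show 0 ≤ r₀ / 4 by positivity) this.le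
    linarith
  · have hl := (Real.log_neg hx.1 (hδ' hx).2.2).ne
    have h5 := ((Real.hasDerivAt_log hx.1.ne').inv hl).const_mul (r₀ / 4)
    have h6 := h5.const_add r₀
    refine h6.congr_deriv ?_
    field_simp
  · have hl := Real.log_neg hx.1 (hδ' hx).2.2
    have hl' := hl.ne
    have hx0 : x ≠ 0 := hx.1.ne'
    have h5 := (hδ' hx).1
    have h6 : -(-(r₀ / 4) / Real.log x ^ 2 * x⁻¹) * ((r₀ + r₀ / 4 / Real.log x) * x) -
        ((r₀ + r₀ / 4 / Real.log x) ^ 2 - p x * (r₀ + r₀ / 4 / Real.log x) + q x) =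
        (r₀ / 4 * (r₀ + r₀ / 4 / Real.log x) - (r₀ / 4) ^ 2 +
          (Real.log x ^ 2 * (p x - 2 * r₀) * (r₀ + r₀ / 4 / Real.log x) -
            Real.log x ^ 2 * (q x - r₀ ^ 2))) / Real.log x ^ 2 := by
      field_simp
      ring
    rw [h6]
    exact div_pos h5 (by positivity)

namespace PlaySystem

variable {P : PlaySystem} {κ : ℝ} {S p : ℝ → ℝ} {ξ : ℝ}

variable (P) in
theorem exists_abs_slope_sub_le : ∃ K, ∀ᶠ x in 𝓝[>] (0 : ℝ),
    |P.g (P.b + x) / x - deriv P.g P.b| ≤ K * x := by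
  have hg' : ContDiffOn ℝ 1 (deriv P.g) (Ioo 0 1) :=
    P.g_contDiffOn.deriv_of_isOpen isOpen_Ioo (by norm_num)
  obtain ⟨K, hK0, hK⟩ := exists_lipschitz_of_contDiffOn hg' P.a_pos P.t_lt_one
  refine ⟨K, ?_⟩
  have hev : ∀ᶠ x in 𝓝[>] (0 : ℝ), x ∈ Ioo 0 (P.t - P.b) := Ioo_mem_nhdsGT (sub_pos.2 P.b_lt_t)
  filter_upwards [hev] with x hx
  have hsub : Icc P.b (P.b + x) ⊆ Icc P.a P.t := fun y hy =>
    ⟨P.a_lt_b.le.trans hy.1, by linarith [hy.2, hx.2]⟩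
  obtain ⟨y, hy, hy'⟩ := exists_hasDerivAt_eq_slope P.g (deriv P.g)
    (show P.b < P.b + x by linarith [hx.1]) (P.continuousOn_g.mono (hsub.trans P.Icc_subset))
    (fun y hy => hasDerivAt_g (P.Icc_subset (hsub (Ioo_subset_Icc_self hy))))
  rw [P.g_b, sub_zero, add_sub_cancel_left] at hy'
  rw [← hy']
  refine (hK y (hsub (Ioo_subset_Icc_self hy)) P.b ⟨P.a_lt_b.le, P.b_lt_t.le⟩).trans ?_
  gcongr
  rw [abs_of_pos (by linarith [hy.1])]
  linarith [hy.2]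

namespace IsPath

variable (h : P.IsPath κ S p)
include h

theorem hi_le_of_le {ξ₀ ξ₁ : ℝ} (h01 : ξ₀ ≤ ξ₁) (h0 : P.hi (S ξ₀) ≤ p ξ₀)
    (hlt : ∀ ξ ∈ Ioo ξ₀ ξ₁, P.b < S ξ) : P.hi (S ξ₁) ≤ p ξ₁ := by
  have := nonpos_of_deriv_nonpos_of_pos (f := fun ξ => -(p ξ - P.hi (S ξ)))
    (f' := fun ξ => -(P.g (S ξ) -
      deriv P.hi (S ξ) * ((P.deficit (S ξ) (p ξ) - P.excess (S ξ) (p ξ)) / κ))) h01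
    (fun x _ => (h.hasDerivAt_sub_hi x).neg.continuousAt.continuousWithinAt) (by simpa using h0)
    (fun x hx hpos => ⟨(h.hasDerivAt_sub_hi x).neg, ?_⟩)
  · linarith
  · have h1 := P.g_pos (S x) ⟨hlt x hx, (h.mem x).2⟩
    have h2 : P.excess (S x) (p x) = 0 := excess_eq_zero (by linarith)
    have h3 : 0 ≤ P.deficit (S x) (p x) / κ := div_nonneg deficit_nonneg h.κ_pos.le
    rw [h2, sub_zero]
    have h4 := mul_nonneg (neg_nonneg.2 (P.hi_deriv_neg _ (h.mem01 x)).le) h3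
    linarith

/-- A barrier keeps the path from returning to the line `S = b` from the right, close to `b`. -/
theorem not_frequently_of_barrier {δ r₀ : ℝ} {R R' : ℝ → ℝ}
    (hR : RiccatiBarrier (fun x => -(deriv P.hi (P.b + x) / κ)) (fun x => P.g (P.b + x) / x / κ)
      δ r₀ R R') : ¬ ∃ᶠ ξ in atTop, S ξ = P.b := by
  intro hfreq
  have hκ := h.κ_pos
  obtain ⟨s, -, hs, hturn⟩ := h.exists_turns hfreq
  obtain ⟨N, hN⟩ := eventually_atTop.1
    (h.tendsto_b.eventually (gt_mem_nhds (show P.b < P.b + δ by linarith [hR.δ_pos])))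
  obtain ⟨n, hn⟩ := (hs.eventually (eventually_ge_atTop N)).exists
  obtain ⟨⟨hu, hu'⟩, d, hud, -, hright, ⟨hd, hd'⟩, -⟩ := hturn n
  set u := s n
  have hlh := P.lo_lt_hi _ P.b_mem
  -- right of `b` the orbit passes from below `lo` to above `hi`, where the rate is `0` at first
  obtain ⟨ξ₁, hξ₁, hv⟩ := intermediate_value_Icc hud.le (f := fun ξ => p ξ - P.hi (S ξ))
    (fun x _ => (h.hasDerivAt_sub_hi x).continuousAt.continuousWithinAt)
    (show (0 : ℝ) ∈ _ by simp only [hu, hd]; constructor <;> linarith)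
  simp only at hv
  have hu1 : u < ξ₁ := lt_of_le_of_ne hξ₁.1 (by rintro rfl; rw [hu] at hv; linarith)
  have h1d : ξ₁ < d := lt_of_le_of_ne hξ₁.2 (by rintro rfl; rw [hd] at hv; linarith)
  have hX : ∀ ξ ∈ Ico ξ₁ d, S ξ - P.b ∈ Ioo 0 δ := fun ξ hξ =>
    ⟨sub_pos.2 (hright ξ ⟨hu1.trans_le hξ.1, hξ.2⟩), by
      linarith [hN ξ (hn.trans (hu1.le.trans hξ.1))]⟩
  have hv0 : ∀ ξ ∈ Ico ξ₁ d, P.hi (S ξ) ≤ p ξ := fun ξ hξ =>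
    h.hi_le_of_le hξ.1 (by linarith) fun η hη => hright η ⟨hu1.trans hη.1, hη.2.trans hξ.2⟩
  have hS' : ∀ ξ ∈ Ico ξ₁ d, HasDerivAt S (-(p ξ - P.hi (S ξ)) / κ) ξ := fun ξ hξ => by
    have h1 := h.hasDerivAt_S ξ
    rwa [excess_eq (hv0 ξ hξ), deficit_eq_zero ((P.lo_lt_hi _ (h.mem01 ξ)).le.trans (hv0 ξ hξ)),
      zero_sub] at h1
  have hrate : ∀ η ∈ Ico ξ₁ d, p η - P.hi (S η) ≤ κ * (r₀ * (S η - P.b)) := by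
    intro η hη
    have hder : ∀ x ∈ Icc ξ₁ η, HasDerivAt
        (fun ξ => R (S ξ - P.b) - (p ξ - P.hi (S ξ)) / κ / (S ξ - P.b))
        (R' (S x - P.b) * (-(p x - P.hi (S x)) / κ) -
          (((p x - P.hi (S x)) / κ / (S x - P.b)) ^ 2 -
            -(deriv P.hi (S x) / κ) * ((p x - P.hi (S x)) / κ / (S x - P.b)) +
            P.g (S x) / (S x - P.b) / κ)) x := by
      intro x hx
      have hx' : x ∈ Ico ξ₁ d := ⟨hx.1, hx.2.trans_lt hη.2⟩
      have hX0 : S x - P.b ≠ 0 := (hX x hx').1.ne'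
      have h1 := (hR.hasDerivAt _ (hX x hx')).comp x ((hS' x hx').sub_const P.b)
      have h2 := ((((h.solves x).eq_p.sub ((hasDerivAt_hi (P := P) (h.mem01 x)).comp x
        (hS' x hx'))).div_const κ).div ((hS' x hx').sub_const P.b) hX0)
      refine (h1.sub h2).congr_deriv ?_
      congr 1
      simp only [Pi.sub_apply, Function.comp_apply]
      field_simp
      ring
    have h1 := pos_of_deriv_pos_of_zero
      (f := fun ξ => R (S ξ - P.b) - (p ξ - P.hi (S ξ)) / κ / (S ξ - P.b)) hη.1
      (fun x hx => (hder x hx).continuousAt.continuousWithinAt)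
      (by
        simp only [hv, zero_div, sub_zero]
        exact hR.pos _ (hX ξ₁ ⟨le_rfl, h1d⟩))
      (fun x hx hx0 => ⟨_, ?_, hder x (Ioc_subset_Icc_self hx)⟩)
    · have h2 := hX η hη
      have h3 := hR.le _ h2
      have h4 : (p η - P.hi (S η)) / κ / (S η - P.b) ≤ r₀ := by linarith
      rw [div_le_iff₀ h2.1, div_le_iff₀ hκ] at h4
      linarith
    · have hx' : x ∈ Ico ξ₁ d := ⟨hx.1.le, hx.2.trans_lt hη.2⟩
      have h2 := hX x hx'
      have h3 := hR.super _ h2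
      have h4 : (p x - P.hi (S x)) / κ / (S x - P.b) = R (S x - P.b) := by linarith
      have h5 : (p x - P.hi (S x)) / κ = R (S x - P.b) * (S x - P.b) := by
        rw [← h4, div_mul_cancel₀ _ h2.1.ne']
      rw [h4, neg_div, h5]
      simp only [add_sub_cancel] at h3
      linarith
  -- `S - b` decays at most like `exp (-r₀ ξ)`
  have hmono : MonotoneOn (fun ξ => (S ξ - P.b) * Real.exp (r₀ * ξ)) (Icc ξ₁ d) := by
    have hexp : ∀ x, HasDerivAt (fun ξ => Real.exp (r₀ * ξ)) (Real.exp (r₀ * x) * (r₀ * 1)) x :=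
      fun x => ((hasDerivAt_id x).const_mul r₀).exp
    refine monotoneOn_of_hasDerivWithinAt_nonneg (convex_Icc _ _)
      (((h.continuous_S.sub continuous_const).mul (by fun_prop)).continuousOn)
      (f' := fun x => -(p x - P.hi (S x)) / κ * Real.exp (r₀ * x) +
        (S x - P.b) * (Real.exp (r₀ * x) * (r₀ * 1))) ?_ ?_
    · intro x hx
      rw [interior_Icc] at hx ⊢
      exact (((hS' x ⟨hx.1.le, hx.2⟩).sub_const P.b).mul (hexp x)).hasDerivWithinAt
    · intro x hx
      rw [interior_Icc] at hx
      have h1 := hrate x ⟨hx.1.le, hx.2⟩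
      have h2 : (p x - P.hi (S x)) / κ ≤ r₀ * (S x - P.b) := by
        rw [div_le_iff₀ hκ]; linarith
      have h3 : 0 ≤ (r₀ * (S x - P.b) - (p x - P.hi (S x)) / κ) * Real.exp (r₀ * x) :=
        mul_nonneg (by linarith) (Real.exp_pos _).le
      rw [neg_div]
      linarith
  have h1 := hmono ⟨le_rfl, h1d.le⟩ ⟨h1d.le, le_rfl⟩ h1d.le
  simp only [hd, sub_self, zero_mul] at h1
  have h2 := mul_pos (hX ξ₁ ⟨le_rfl, h1d⟩).1 (Real.exp_pos (r₀ * ξ₁))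
  linarith

/-- For real eigenvalues at `(b, hi b)`, orbits do not turn around the segment for ever. A double
eigenvalue requires a modulus of continuity of `hi'`. -/
theorem not_frequently (hdisc : 4 * κ * deriv P.g P.b ≤ deriv P.hi P.b ^ 2)
    (hholder : 4 * κ * deriv P.g P.b = deriv P.hi P.b ^ 2 → HolderDerivAt P.hi P.b) :
    ¬ ∃ᶠ ξ in atTop, S ξ = P.b := by
  have hκ := h.κ_pos
  have hneg := P.hi_deriv_neg _ P.b_mem
  have hshift : Tendsto (fun x => P.b + x) (𝓝[>] 0) (𝓝 P.b) := by
    have : Tendsto (fun x => P.b + x) (𝓝 0) (𝓝 (P.b + 0)) := by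
      exact (continuous_const.add continuous_id).tendsto 0
    rw [add_zero] at this
    exact this.mono_left nhdsWithin_le_nhds
  obtain ⟨K, hK⟩ := P.exists_abs_slope_sub_le
  rcases hdisc.lt_or_eq with hlt | heq
  · have h1 : Tendsto (fun x => -(deriv P.hi (P.b + x) / κ)) (𝓝[>] 0)
        (𝓝 (-(deriv P.hi P.b / κ))) := by
      have : Tendsto (deriv P.hi) (𝓝 P.b) (𝓝 (deriv P.hi P.b)) :=
        P.continuousOn_deriv_hi.continuousAt (isOpen_Ioo.mem_nhds P.b_mem)
      exact ((this.comp hshift).div_const κ).neg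
    have h2 : Tendsto (fun x => P.g (P.b + x) / x / κ) (𝓝[>] 0) (𝓝 (deriv P.g P.b / κ)) := by
      refine Tendsto.div_const ?_ κ
      rw [← tendsto_sub_nhds_zero_iff]
      refine squeeze_zero_norm' hK ?_
      have : Tendsto (fun x => K * x) (𝓝 0) (𝓝 (K * 0)) :=
        (continuous_const.mul continuous_id).tendsto 0
      rw [mul_zero] at this
      exact this.mono_left nhdsWithin_le_nhds
    obtain ⟨δ, r₀, R, R', hR⟩ := exists_barrier_of_node h1 h2
      (neg_pos.2 (div_neg_of_neg_of_pos hneg hκ)) (by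
        rw [neg_sq, div_pow, mul_div_assoc', div_lt_div_iff₀ hκ (by positivity)]
        nlinarith)
    exact h.not_frequently_of_barrier hR
  · obtain ⟨C, α, hα, hC⟩ := hholder heq
    obtain ⟨δ, r₀, R, R', hR⟩ := exists_barrier_of_degenerate
      (p := fun x => -(deriv P.hi (P.b + x) / κ)) (q := fun x => P.g (P.b + x) / x / κ)
      (r₀ := -(deriv P.hi P.b) / (2 * κ)) (C := C / κ) (D := K / κ)
      (div_pos (neg_pos.2 hneg) (by positivity)) hα (by
        filter_upwards [hshift.eventually hC, self_mem_nhdsWithin] with x hx hx0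
        rw [add_sub_cancel_left, abs_of_pos (show 0 < x from hx0)] at hx
        have e : -(deriv P.hi (P.b + x) / κ) - 2 * (-deriv P.hi P.b / (2 * κ)) =
            -(deriv P.hi (P.b + x) - deriv P.hi P.b) / κ := by field_simp; ring
        rw [e, abs_div, abs_neg, abs_of_pos hκ, div_mul_eq_mul_div]
        gcongr) (by
        filter_upwards [hK] with x hx
        have e : P.g (P.b + x) / x / κ - (-deriv P.hi P.b / (2 * κ)) ^ 2 =
            (P.g (P.b + x) / x - deriv P.g P.b) / κ := by
          have : (-deriv P.hi P.b / (2 * κ)) ^ 2 = deriv P.g P.b / κ := by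
            rw [div_pow, neg_sq, ← heq]
            field_simp
            ring
          rw [this, sub_div]
        rw [e, abs_div, abs_of_pos hκ, div_mul_eq_mul_div]
        gcongr)
    exact h.not_frequently_of_barrier hR

end IsPath

end PlaySystem

end TwoPhase

/-! ### The orbit as a graph over the saturation -/

namespace TwoPhase

theorem abs_sqrt_sub_sqrt_le {x y : ℝ} (hx : 0 ≤ x) (hy : 0 ≤ y) :
    |√x - √y| ≤ √|x - y| := by
  wlog h : y ≤ x generalizing x y
  · rw [abs_sub_comm, abs_sub_comm x]
    exact this hy hx (le_of_not_ge h)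
  rw [abs_of_nonneg (sub_nonneg.2 (Real.sqrt_le_sqrt h)), abs_of_nonneg (sub_nonneg.2 h),
    sub_le_iff_le_add]
  refine Real.sqrt_le_iff.2 ⟨by positivity, ?_⟩
  have h1 := Real.sq_sqrt (sub_nonneg.2 h)
  have h2 := Real.sq_sqrt hy
  nlinarith [mul_nonneg (Real.sqrt_nonneg (x - y)) (Real.sqrt_nonneg y)]

/-- A bounded version of `v ↦ √(2 v)`, Lipschitz continuous for `ε > 0` and within `ε` of the case
`ε = 0`. -/
noncomputable def cutSqrt (B ε v : ℝ) : ℝ := √(2 * max 0 (min v B) + ε ^ 2) - ε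

theorem abs_cut_sub_cut_le (B v w : ℝ) : |max 0 (min v B) - max 0 (min w B)| ≤ |v - w| := by
  have h1 := abs_max_sub_max_le_max 0 (min v B) 0 (min w B)
  have h2 := abs_min_sub_min_le_max v B w B
  simp only [sub_self, abs_zero] at h1 h2
  exact h1.trans (max_le (abs_nonneg _) (h2.trans (max_le le_rfl (abs_nonneg _))))

section cutSqrt

variable {B ε : ℝ}

theorem cutSqrt_mono : Monotone (cutSqrt B ε) := fun v w h => by
  unfold cutSqrt
  gcongr

theorem cutSqrt_le (hε : 0 ≤ ε) (v : ℝ) : cutSqrt B ε v ≤ cutSqrt B 0 v := by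
  unfold cutSqrt
  have h0 : 0 ≤ 2 * max 0 (min v B) := by positivity
  have h1 := Real.sq_sqrt h0
  rw [zero_pow two_ne_zero, add_zero, sub_zero, sub_le_iff_le_add]
  refine Real.sqrt_le_iff.2 ⟨by positivity, ?_⟩
  nlinarith [mul_nonneg (Real.sqrt_nonneg (2 * max 0 (min v B))) hε]

theorem cutSqrt_zero_sub_le (v : ℝ) : cutSqrt B 0 v - ε ≤ cutSqrt B ε v := by
  unfold cutSqrt
  rw [zero_pow two_ne_zero, add_zero, sub_zero]
  have : √(2 * max 0 (min v B)) ≤ √(2 * max 0 (min v B) + ε ^ 2) :=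
    Real.sqrt_le_sqrt (le_add_of_nonneg_right (sq_nonneg _))
  linarith

theorem cutSqrt_nonneg (hε : 0 ≤ ε) (v : ℝ) : 0 ≤ cutSqrt B ε v := by
  have h : √(ε ^ 2) ≤ √(2 * max 0 (min v B) + ε ^ 2) :=
    Real.sqrt_le_sqrt (le_add_of_nonneg_left (by positivity))
  rw [Real.sqrt_sq hε] at h
  exact sub_nonneg.2 h

theorem cutSqrt_le_sqrt (hB : 0 ≤ B) (hε : 0 ≤ ε) (v : ℝ) : cutSqrt B ε v ≤ √(2 * B) := by
  refine (cutSqrt_le hε v).trans ?_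
  unfold cutSqrt
  rw [zero_pow two_ne_zero, add_zero, sub_zero]
  exact Real.sqrt_le_sqrt (by linarith [max_le hB (min_le_right v B)])

theorem abs_cutSqrt_sub_le (hε : 0 < ε) (v w : ℝ) :
    |cutSqrt B ε v - cutSqrt B ε w| ≤ ε⁻¹ * |v - w| := by
  unfold cutSqrt
  set x := 2 * max 0 (min v B) + ε ^ 2
  set y := 2 * max 0 (min w B) + ε ^ 2
  have hx0 : 0 ≤ x := by positivity
  have hy0 : 0 ≤ y := by positivity
  have hx : ε ≤ √x := Real.le_sqrt_of_sq_le (le_add_of_nonneg_left (by positivity))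
  have hy : ε ≤ √y := Real.le_sqrt_of_sq_le (le_add_of_nonneg_left (by positivity))
  rw [sub_sub_sub_cancel_right, ← div_eq_inv_mul, le_div_iff₀ hε]
  have h1 : (√x - √y) * (√x + √y) = x - y := by
    have := Real.sq_sqrt hx0
    have := Real.sq_sqrt hy0
    linarith
  have h2 : |√x - √y| * (√x + √y) = |x - y| := by
    rw [← h1, abs_mul, abs_of_nonneg (show 0 ≤ √x + √y by positivity)]
  have h3 : |x - y| ≤ 2 * |v - w| := by
    have : x - y = 2 * (max 0 (min v B) - max 0 (min w B)) := by ring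
    rw [this, abs_mul, abs_two]
    exact mul_le_mul_of_nonneg_left (abs_cut_sub_cut_le B v w) two_pos.le
  nlinarith [abs_nonneg (√x - √y)]

theorem abs_cutSqrt_zero_sub_le (v w : ℝ) :
    |cutSqrt B 0 v - cutSqrt B 0 w| ≤ √(2 * |v - w|) := by
  unfold cutSqrt
  rw [zero_pow two_ne_zero, add_zero, add_zero, sub_zero, sub_zero]
  refine (abs_sqrt_sub_sqrt_le (by positivity) (by positivity)).trans (Real.sqrt_le_sqrt ?_)
  rw [← mul_sub, abs_mul, abs_two]
  exact mul_le_mul_of_nonneg_left (abs_cut_sub_cut_le B v w) two_pos.le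

theorem cutSqrt_zero_eq {v : ℝ} (h : v ≤ B) : cutSqrt B 0 v = √(2 * v) := by
  unfold cutSqrt
  rw [zero_pow two_ne_zero, add_zero, sub_zero, min_eq_left h]
  rcases le_total 0 v with h0 | h0
  · rw [max_eq_right h0]
  · rw [max_eq_left h0, mul_zero, Real.sqrt_zero, Real.sqrt_eq_zero_of_nonpos (by linarith)]

end cutSqrt

namespace PlaySystem

variable {P : PlaySystem} {κ : ℝ} {S p : ℝ → ℝ} {ξ : ℝ}

variable (P) in
/-- `V` is half the squared distance `(lo - w) ^ 2 / 2` of the graph `w` of an orbit leaving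
`(a, lo a)` from the graph of `lo`, as a function of the saturation on `[a, c]`. In terms of `V`
the singular equation for `w` becomes regular. -/
structure IsProfile (κ c : ℝ) (V : ℝ → ℝ) : Prop where
  zero : V P.a = 0
  cont : ContinuousOn V (Icc P.a c)
  hasDerivAt : ∀ s ∈ Ioo P.a c, HasDerivAt V (deriv P.lo s * √(2 * V s) - κ * P.g s) s

theorem IsProfile.mono {c d : ℝ} {V : ℝ → ℝ} (h : P.IsProfile κ c V) (hd : d ≤ c) :
    P.IsProfile κ d V :=
  ⟨h.zero, h.cont.mono (Icc_subset_Icc_right hd),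
    fun s hs => h.hasDerivAt s ⟨hs.1, hs.2.trans_le hd⟩⟩

variable (P) in
/-- The square root is approximated by the Lipschitz functions `cutSqrt B ε`. As the right-hand
side is nonincreasing in `V`, the approximate solutions form a uniform Cauchy sequence. -/
theorem exists_profile (hκ : 0 < κ) : ∃ V, P.IsProfile κ P.t V := by
  obtain ⟨C, hC, hC'⟩ := P.exists_abs_le
  have hat := P.a_lt_t
  set T := P.t - P.a with hT
  have hT0 : 0 < T := sub_pos.2 hat
  set B := κ * C * T with hB
  have hB0 : 0 ≤ B := by positivity
  set F : ℝ → ℝ → ℝ → ℝ := fun ε s v => deriv P.lo s * cutSqrt B ε v - κ * P.g s with hF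
  have hsol : ∀ ε, 0 < ε → ∃ V : ℝ → ℝ, V P.a = 0 ∧
      ∀ s ∈ Icc P.a P.t, HasDerivWithinAt V (F ε s (V s)) (Icc P.a P.t) s := by
    intro ε hε
    refine exists_solution_Icc_of_bounded (K := Real.toNNReal (C * ε⁻¹))
      (L := Real.toNNReal (C * √(2 * B) + κ * C)) ⟨P.a, le_rfl, hat.le⟩ ?_ ?_ ?_ 0
    · intro s hs
      refine LipschitzWith.of_dist_le_mul fun v w => ?_
      rw [Real.coe_toNNReal _ (by positivity), Real.dist_eq, Real.dist_eq]
      have e : F ε s v - F ε s w = deriv P.lo s * (cutSqrt B ε v - cutSqrt B ε w) := by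
        simp only [hF]; ring
      rw [e, abs_mul, mul_assoc]
      exact mul_le_mul (hC' s hs).1 (abs_cutSqrt_sub_le hε v w) (abs_nonneg _) hC.le
    · intro v
      exact ((P.continuousOn_deriv_lo.mono P.Icc_subset).mul continuousOn_const).sub
        (continuousOn_const.mul (P.continuousOn_g.mono P.Icc_subset))
    · intro s hs v
      rw [Real.coe_toNNReal _ (by positivity), Real.norm_eq_abs]
      refine (abs_sub _ _).trans (add_le_add ?_ ?_)
      · rw [abs_mul, abs_of_nonneg (cutSqrt_nonneg hε.le v)]
        exact mul_le_mul (hC' s hs).1 (cutSqrt_le_sqrt hB0 hε.le v) (cutSqrt_nonneg hε.le v) hC.le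
      · rw [abs_mul, abs_of_pos hκ]
        exact mul_le_mul_of_nonneg_left (hC' s hs).2.2 hκ.le
  set e : ℕ → ℝ := fun n => 1 / ((n : ℝ) + 1) with he
  have he0 : ∀ n, 0 < e n := fun n => by positivity
  have helim : Tendsto e atTop (𝓝 0) := tendsto_one_div_add_atTop_nhds_zero_nat
  choose U hU0 hU using fun n => hsol (e n) (he0 n)
  have hUd : ∀ n, ∀ s ∈ Ioo P.a P.t, HasDerivAt (U n) (F (e n) s (U n s)) s := fun n s hs =>
    (hU n s (Ioo_subset_Icc_self hs)).hasDerivAt (Icc_mem_nhds hs.1 hs.2)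
  have hUc : ∀ n, ContinuousOn (U n) (Icc P.a P.t) := fun n s hs => (hU n s hs).continuousWithinAt
  -- one-sided estimate: the right-hand side is nonincreasing in `v`
  have hcmp : ∀ n k, ∀ s ∈ Icc P.a P.t, U n s - U k s ≤ C * T * e n := by
    intro n k s hs
    have h1 := nonpos_of_deriv_nonpos_of_pos (f := fun s => U n s - U k s - C * e n * (s - P.a))
      (f' := fun s => F (e n) s (U n s) - F (e k) s (U k s) - C * e n * 1) hs.1
      ((((hUc n).sub (hUc k)).sub (by fun_prop)).mono (Icc_subset_Icc_right hs.2))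
      (by simp [hU0]) (fun x hx hpos => ?_)
    · have h2 : C * e n * (s - P.a) ≤ C * e n * T :=
        mul_le_mul_of_nonneg_left (by linarith [hs.2]) (mul_nonneg hC.le (he0 n).le)
      linarith
    · have hx' : x ∈ Ioo P.a P.t := ⟨hx.1, hx.2.trans_le hs.2⟩
      refine ⟨((hUd n x hx').sub (hUd k x hx')).sub
        (((hasDerivAt_id x).sub_const P.a).const_mul _), ?_⟩
      have h2 : U k x ≤ U n x := by
        have : 0 ≤ C * e n * (x - P.a) :=
          mul_nonneg (mul_nonneg hC.le (he0 n).le) (by linarith [hx.1])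
        linarith
      have h3 := cutSqrt_mono (B := B) (ε := e n) h2
      have h4 := cutSqrt_zero_sub_le (B := B) (ε := e n) (U k x)
      have h5 := cutSqrt_le (B := B) (he0 k).le (U k x)
      have h6 := (P.lo_deriv_neg x (P.Ioo_subset hx')).le
      have h7 := (abs_le.1 (hC' x (Ioo_subset_Icc_self hx')).1).1
      simp only [hF]
      have h8 : cutSqrt B (e k) (U k x) - cutSqrt B (e n) (U n x) ≤ e n := by linarith
      have h9 := mul_le_mul_of_nonneg_left h8 (neg_nonneg.2 h6)
      have h10 := mul_le_mul_of_nonneg_right (show -deriv P.lo x ≤ C by linarith) (he0 n).le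
      linarith
  have hlim : ∀ s ∈ Icc P.a P.t, ∃ l, Tendsto (fun n => U n s) atTop (𝓝 l) := by
    intro s hs
    refine cauchySeq_tendsto_of_complete (cauchySeq_of_le_tendsto_0 (fun n => C * T * e n) ?_ ?_)
    · intro n k N hn hk
      have hmono : ∀ {i}, N ≤ i → C * T * e i ≤ C * T * e N := fun {i} hi => by
        have : e i ≤ e N := by
          simp only [he]
          gcongr
        gcongr
      rw [Real.dist_eq, abs_le]
      constructor <;> linarith [hcmp n k s hs, hcmp k n s hs, hmono hn, hmono hk]
    · simpa using helim.const_mul (C * T)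
  set V : ℝ → ℝ := fun s => limUnder atTop fun n => U n s with hV
  have hVlim : ∀ s ∈ Icc P.a P.t, Tendsto (fun n => U n s) atTop (𝓝 (V s)) := fun s hs =>
    tendsto_nhds_limUnder (hlim s hs)
  have hest : ∀ n, ∀ s ∈ Icc P.a P.t, |V s - U n s| ≤ C * T * e n := by
    intro n s hs
    have h1 := hVlim s hs
    have hz : Tendsto (fun k => C * T * e k) atTop (𝓝 0) := by simpa using helim.const_mul (C * T)
    have h2 : U n s - V s ≤ C * T * e n :=
      le_of_tendsto (h1.const_sub (U n s)) (Eventually.of_forall fun k => hcmp n k s hs)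
    have h3 : V s - U n s ≤ 0 :=
      le_of_tendsto_of_tendsto (h1.sub_const (U n s)) hz
        (Eventually.of_forall fun k => hcmp k n s hs)
    have h4 : 0 ≤ C * T * e n := mul_nonneg (by positivity) (he0 n).le
    rw [abs_le]
    constructor <;> linarith
  have hunif : TendstoUniformlyOn U V atTop (Icc P.a P.t) := by
    rw [Metric.tendstoUniformlyOn_iff]
    intro δ hδ
    have hz : Tendsto (fun k => C * T * e k) atTop (𝓝 0) := by simpa using helim.const_mul (C * T)
    filter_upwards [hz.eventually (gt_mem_nhds hδ)] with n hn s hs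
    exact (hest n s hs).trans_lt hn
  have hVc : ContinuousOn V (Icc P.a P.t) :=
    hunif.continuousOn (Frequently.of_forall hUc)
  have hV0 : V P.a = 0 := by
    have := hVlim P.a ⟨le_rfl, hat.le⟩
    simp only [hU0] at this
    exact tendsto_nhds_unique this tendsto_const_nhds
  have hVd : ∀ s ∈ Ioo P.a P.t, HasDerivAt V (F 0 s (V s)) s := by
    intro s hs
    refine hasDerivAt_of_tendstoUniformlyOn isOpen_Ioo (f := U) (g' := fun s => F 0 s (V s))
      (f' := fun n s => F (e n) s (U n s)) ?_
      (Eventually.of_forall hUd) (fun x hx => hVlim x (Ioo_subset_Icc_self hx)) hs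
    rw [Metric.tendstoUniformlyOn_iff]
    intro δ hδ
    have hz : Tendsto (fun n => C * (e n + √(2 * (C * T * e n)))) atTop (𝓝 0) := by
      have h1 := ((helim.const_mul (C * T)).const_mul 2).sqrt
      simpa using (helim.add h1).const_mul C
    filter_upwards [hz.eventually (gt_mem_nhds hδ)] with n hn x hx
    refine lt_of_le_of_lt ?_ hn
    have hx' := Ioo_subset_Icc_self hx
    have e1 : F 0 x (V x) - F (e n) x (U n x) =
        deriv P.lo x * (cutSqrt B 0 (V x) - cutSqrt B (e n) (U n x)) := by
      simp only [hF]; ring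
    rw [Real.dist_eq, e1, abs_mul]
    refine mul_le_mul (hC' x hx').1 ?_ (abs_nonneg _) hC.le
    have h1 := abs_le.1 (abs_cutSqrt_zero_sub_le (B := B) (V x) (U n x))
    have h2 : √(2 * |V x - U n x|) ≤ √(2 * (C * T * e n)) :=
      Real.sqrt_le_sqrt (by linarith [hest n x hx'])
    have h3 := cutSqrt_zero_sub_le (B := B) (ε := e n) (U n x)
    have h4 := cutSqrt_le (B := B) (he0 n).le (U n x)
    have h5 := (he0 n).le
    rw [abs_le]
    constructor <;> linarith [h1.1, h1.2]
  -- hence the cut-off at `B` has no effect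
  have hVB : ∀ s ∈ Icc P.a P.t, V s ≤ B := by
    intro s hs
    have h1 := nonpos_of_deriv_nonpos_of_pos (f := fun s => V s - κ * C * (s - P.a))
      (f' := fun s => F 0 s (V s) - κ * C * 1) hs.1
      ((hVc.sub (by fun_prop)).mono (Icc_subset_Icc_right hs.2)) (by simp [hV0])
      (fun x hx _ => ?_)
    · have h2 : κ * C * (s - P.a) ≤ κ * C * T :=
        mul_le_mul_of_nonneg_left (by linarith [hs.2]) (by positivity)
      linarith
    · have hx' : x ∈ Ioo P.a P.t := ⟨hx.1, hx.2.trans_le hs.2⟩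
      refine ⟨(hVd x hx').sub (((hasDerivAt_id x).sub_const P.a).const_mul _), ?_⟩
      have h2 := mul_nonneg (neg_nonneg.2 (P.lo_deriv_neg x (P.Ioo_subset hx')).le)
        (cutSqrt_nonneg (B := B) le_rfl (V x))
      have h3 := (abs_le.1 (hC' x (Ioo_subset_Icc_self hx')).2.2).1
      have h4 := mul_le_mul_of_nonneg_left h3 hκ.le
      simp only [hF]
      linarith
  refine ⟨V, hV0, hVc, fun s hs => ?_⟩
  have := hVd s hs
  simp only [hF] at this
  rwa [cutSqrt_zero_eq (hVB s (Ioo_subset_Icc_self hs))] at this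

end PlaySystem

end TwoPhase

/-! ### Profiles: comparison, dependence on `κ`, relation to the orbit -/

namespace TwoPhase

namespace PlaySystem

variable {P : PlaySystem} {κ κ₁ κ₂ c : ℝ} {V V₁ V₂ : ℝ → ℝ} {S p : ℝ → ℝ} {ξ : ℝ}

variable (P) in
theorem Icc_ab_subset (hc : c ≤ P.b) : Icc P.a c ⊆ Icc P.a P.t :=
  Icc_subset_Icc_right (hc.trans P.b_lt_t.le)

namespace IsProfile

/-- Profiles are nondecreasing in `κ`, because `g < 0` on `(a, b)`. -/
theorem le_of_le (h₁ : P.IsProfile κ₁ c V₁) (h₂ : P.IsProfile κ₂ c V₂) (hκ : κ₁ ≤ κ₂)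
    (hc : c ≤ P.b) {s : ℝ} (hs : s ∈ Icc P.a c) : V₁ s ≤ V₂ s := by
  have h := nonpos_of_deriv_nonpos_of_pos (f := fun s => V₁ s - V₂ s)
    (f' := fun s => (deriv P.lo s * √(2 * V₁ s) - κ₁ * P.g s) -
      (deriv P.lo s * √(2 * V₂ s) - κ₂ * P.g s)) hs.1
    ((h₁.cont.sub h₂.cont).mono (Icc_subset_Icc_right hs.2)) (by simp [h₁.zero, h₂.zero])
    (fun x hx hpos => ?_)
  · linarith
  · have hx' : x ∈ Ioo P.a c := ⟨hx.1, hx.2.trans_le hs.2⟩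
    refine ⟨(h₁.hasDerivAt x hx').sub (h₂.hasDerivAt x hx'), ?_⟩
    have h1 : √(2 * V₂ x) ≤ √(2 * V₁ x) := Real.sqrt_le_sqrt (by linarith)
    have h2 := (P.lo_deriv_neg x (P.Icc_subset (P.Icc_ab_subset hc (Ioo_subset_Icc_self hx')))).le
    have h3 := P.g_neg x ⟨hx'.1, hx'.2.trans_le hc⟩
    nlinarith [mul_nonneg (neg_nonneg.2 h2) (sub_nonneg.2 h1),
      mul_nonneg (sub_nonneg.2 hκ) (neg_nonneg.2 h3.le)]

theorem eq (h₁ : P.IsProfile κ c V₁) (h₂ : P.IsProfile κ c V₂) (hc : c ≤ P.b) {s : ℝ}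
    (hs : s ∈ Icc P.a c) : V₁ s = V₂ s :=
  le_antisymm (h₁.le_of_le h₂ le_rfl hc hs) (h₂.le_of_le h₁ le_rfl hc hs)

/-- Profiles are Lipschitz in `κ`: the square root term can only reduce their distance. -/
theorem sub_le (h₁ : P.IsProfile κ₁ c V₁) (h₂ : P.IsProfile κ₂ c V₂) (hκ : κ₁ ≤ κ₂)
    (hc : c ≤ P.b) {C : ℝ} (hC : ∀ x ∈ Icc P.a P.t, |P.g x| ≤ C) {s : ℝ} (hs : s ∈ Icc P.a c) :
    V₂ s - V₁ s ≤ (κ₂ - κ₁) * C * (s - P.a) := by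
  have h := nonpos_of_deriv_nonpos_of_pos
    (f := fun s => V₂ s - V₁ s - (κ₂ - κ₁) * C * (s - P.a))
    (f' := fun s => (deriv P.lo s * √(2 * V₂ s) - κ₂ * P.g s) -
      (deriv P.lo s * √(2 * V₁ s) - κ₁ * P.g s) - (κ₂ - κ₁) * C * 1) hs.1
    (((h₂.cont.sub h₁.cont).sub (by fun_prop)).mono (Icc_subset_Icc_right hs.2))
    (by simp [h₁.zero, h₂.zero]) (fun x hx _ => ?_)
  · linarith
  · have hx' : x ∈ Ioo P.a c := ⟨hx.1, hx.2.trans_le hs.2⟩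
    refine ⟨((h₂.hasDerivAt x hx').sub (h₁.hasDerivAt x hx')).sub
      (((hasDerivAt_id x).sub_const P.a).const_mul _), ?_⟩
    have hxI := P.Icc_ab_subset hc (Ioo_subset_Icc_self hx')
    have h1 : √(2 * V₁ x) ≤ √(2 * V₂ x) :=
      Real.sqrt_le_sqrt (by linarith [h₁.le_of_le h₂ hκ hc (Ioo_subset_Icc_self hx')])
    have h2 := (P.lo_deriv_neg x (P.Icc_subset hxI)).le
    have h3 := (abs_le.1 (hC x hxI)).1
    nlinarith [mul_nonneg (neg_nonneg.2 h2) (sub_nonneg.2 h1),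
      mul_nonneg (sub_nonneg.2 hκ) (show 0 ≤ P.g x + C by linarith)]

variable (h : P.IsProfile κ c V)
include h

theorem nonneg (hκ : 0 < κ) (hc : c ≤ P.b) {s : ℝ} (hs : s ∈ Icc P.a c) : 0 ≤ V s := by
  have h1 := nonpos_of_deriv_nonpos_of_pos (f := fun s => -V s)
    (f' := fun s => -(deriv P.lo s * √(2 * V s) - κ * P.g s)) hs.1
    (h.cont.neg.mono (Icc_subset_Icc_right hs.2)) (by simp [h.zero])
    (fun x hx hpos => ?_)
  · linarith
  · have hx' : x ∈ Ioo P.a c := ⟨hx.1, hx.2.trans_le hs.2⟩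
    refine ⟨(h.hasDerivAt x hx').neg, ?_⟩
    rw [Real.sqrt_eq_zero_of_nonpos (by linarith), mul_zero, zero_sub, neg_neg]
    exact mul_nonpos_of_nonneg_of_nonpos hκ.le (P.g_neg x ⟨hx'.1, hx'.2.trans_le hc⟩).le

theorem pos (hκ : 0 < κ) (hc : c ≤ P.b) {s : ℝ} (hs : s ∈ Ioo P.a c) : 0 < V s := by
  refine lt_of_le_of_ne (h.nonneg hκ hc (Ioo_subset_Icc_self hs)) fun h0 => ?_
  have hmin : IsLocalMin V s := by
    filter_upwards [isOpen_Ioo.mem_nhds hs] with x hx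
    rw [← h0]
    exact h.nonneg hκ hc (Ioo_subset_Icc_self hx)
  have h1 := hmin.hasDerivAt_eq_zero (h.hasDerivAt s hs)
  rw [← h0, mul_zero, Real.sqrt_zero, mul_zero, zero_sub] at h1
  have h2 := mul_pos_of_neg_of_neg (P.g_neg s ⟨hs.1, hs.2.trans_le hc⟩) (neg_neg_of_pos hκ)
  linarith

theorem le_pot (hc : c ≤ P.b) {s : ℝ} (hs : s ∈ Icc P.a c) : V s ≤ -(κ * P.pot s) := by
  have hsub := P.Icc_ab_subset hc
  have hpotc : ContinuousOn P.pot (Icc P.a c) := fun x hx =>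
    (P.hasDerivAt_pot (P.Icc_subset (hsub hx))).continuousAt.continuousWithinAt
  have h1 := nonpos_of_deriv_nonpos_of_pos (f := fun s => V s + κ * P.pot s)
    (f' := fun s => (deriv P.lo s * √(2 * V s) - κ * P.g s) + κ * P.g s) hs.1
    ((h.cont.add (continuousOn_const.mul hpotc)).mono (Icc_subset_Icc_right hs.2))
    (by simp [h.zero, P.pot_a]) (fun x hx _ => ?_)
  · linarith
  · have hx' : x ∈ Ioo P.a c := ⟨hx.1, hx.2.trans_le hs.2⟩
    have hx01 := P.Icc_subset (hsub (Ioo_subset_Icc_self hx'))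
    refine ⟨(h.hasDerivAt x hx').add ((P.hasDerivAt_pot hx01).const_mul κ), ?_⟩
    have := mul_nonneg (neg_nonneg.2 (P.lo_deriv_neg x hx01).le) (Real.sqrt_nonneg (2 * V x))
    linarith

end IsProfile

variable (P) in
/-- For small `κ`, the profile stays below the parabola `k ^ 2 (b - s) ^ 2 / 2`, where `2 k` is a
lower bound for `|lo'|`. -/
theorem exists_profile_b_eq_zero : ∃ κ₀, 0 < κ₀ ∧
    ∀ κ V, 0 < κ → κ ≤ κ₀ → P.IsProfile κ P.b V → V P.b = 0 := by
  obtain ⟨m, hm, hm'⟩ := P.exists_deriv_le_neg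
  obtain ⟨K, hK0, hK⟩ := exists_lipschitz_of_contDiffOn (P.g_contDiffOn.of_le (by norm_num))
    P.a_pos P.t_lt_one
  refine ⟨(m / 2) ^ 2 / (2 * (K + 1)), by positivity, fun κ V hκ hκ₀ hV => ?_⟩
  have hκK : κ * K < (m / 2) ^ 2 := by
    rw [le_div_iff₀ (by positivity)] at hκ₀
    nlinarith
  have hlt : ∀ s ∈ Ico P.a P.b, 0 < (m / 2) ^ 2 * (P.b - s) ^ 2 / 2 - V s := by
    intro s hs
    refine pos_of_deriv_pos_of_zero (f := fun s => (m / 2) ^ 2 * (P.b - s) ^ 2 / 2 - V s) hs.1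
      ((ContinuousOn.sub (by fun_prop) hV.cont).mono (Icc_subset_Icc_right hs.2.le)) ?_ ?_
    · have := sub_pos.2 P.a_lt_b
      rw [hV.zero, sub_zero]
      positivity
    · intro x hx hx0
      have hx' : x ∈ Ioo P.a P.b := ⟨hx.1, hx.2.trans_lt hs.2⟩
      have hxI := P.Icc_ab_subset le_rfl (Ioo_subset_Icc_self hx')
      have h1 : HasDerivAt (fun s => (m / 2) ^ 2 * (P.b - s) ^ 2 / 2)
          ((m / 2) ^ 2 * (2 * (P.b - x) * (-1)) / 2) x := by
        have := ((((hasDerivAt_id x).const_sub P.b).pow 2).const_mul ((m / 2) ^ 2)).div_const 2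
        simpa using this
      refine ⟨_, ?_, h1.sub (hV.hasDerivAt x hx')⟩
      have hbx : 0 < P.b - x := sub_pos.2 hx'.2
      have h2 : √(2 * V x) = m / 2 * (P.b - x) := by
        rw [show 2 * V x = (m / 2 * (P.b - x)) ^ 2 by rw [mul_pow]; linarith]
        exact Real.sqrt_sq (by positivity)
      have h3 := hK x hxI P.b ⟨P.a_lt_b.le, P.b_lt_t.le⟩
      rw [P.g_b, sub_zero, abs_sub_comm x, abs_of_pos hbx] at h3
      have h4 := (abs_le.1 h3).1
      have h5 := (hm' x hxI).1
      rw [h2]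
      have h6 : κ * (-(K * (P.b - x))) ≤ κ * P.g x := mul_le_mul_of_nonneg_left h4 hκ.le
      have h7 : deriv P.lo x * (m / 2 * (P.b - x)) ≤ -m * (m / 2 * (P.b - x)) :=
        mul_le_mul_of_nonneg_right h5 (by positivity)
      have h8 : κ * K * (P.b - x) < (m / 2) ^ 2 * (P.b - x) := mul_lt_mul_of_pos_right hκK hbx
      linarith
  refine le_antisymm ?_ (hV.nonneg hκ le_rfl ⟨P.a_lt_b.le, le_rfl⟩)
  have hcl : Tendsto V (𝓝[Ico P.a P.b] P.b) (𝓝 (V P.b)) :=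
    (hV.cont P.b ⟨P.a_lt_b.le, le_rfl⟩).mono Ico_subset_Icc_self
  have hnb : (𝓝[Ico P.a P.b] P.b).NeBot := by
    rw [← mem_closure_iff_nhdsWithin_neBot, closure_Ico P.a_lt_b.ne]
    exact ⟨P.a_lt_b.le, le_rfl⟩
  have h1 : Tendsto (fun s => (m / 2) ^ 2 * (P.b - s) ^ 2 / 2) (𝓝[Ico P.a P.b] P.b)
      (𝓝 ((m / 2) ^ 2 * (P.b - P.b) ^ 2 / 2)) :=
    (Continuous.tendsto (by fun_prop) P.b).mono_left nhdsWithin_le_nhds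
  have h2 := le_of_tendsto_of_tendsto hcl h1
    (eventually_nhdsWithin_of_forall fun s hs => (sub_pos.1 (hlt s hs)).le)
  simpa using h2

/-- The derivative of this measure of the distance between an orbit and the graph described by
`V` vanishes on the graph, where `deficit = √(2 V)`. -/
theorem hasDerivAt_deficit_profile (hsol : P.SolvesAt κ S p ξ) (hκ : 0 < κ)
    (hV : P.IsProfile κ c V) (hS : S ξ ∈ Ioo P.a c) (hS01 : S ξ ∈ Ioo (0 : ℝ) 1)
    (hp : p ξ ≤ P.hi (S ξ)) :
    HasDerivAt (fun ξ => P.deficit (S ξ) (p ξ) ^ 2 / 2 - V (S ξ))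
      (P.deficit (S ξ) (p ξ) / κ * deriv P.lo (S ξ) *
        (P.deficit (S ξ) (p ξ) - √(2 * V (S ξ)))) ξ := by
  refine (((hsol.deficit_sq hS01).div_const 2).sub
    ((hV.hasDerivAt _ hS).comp ξ hsol.eq_S)).congr_deriv ?_
  rw [excess_eq_zero hp]
  field_simp
  ring

namespace IsPath

variable (h : P.IsPath κ S p)
include h

/-- The square of the difference of the two sides does not increase, and it tends to zero at
`-∞`. -/
theorem deficit_sq_eq (hV : P.IsProfile κ P.t V) (hp : ∀ η ≤ ξ, p η ≤ P.hi (S η)) :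
    P.deficit (S ξ) (p ξ) ^ 2 / 2 = V (S ξ) := by
  set D : ℝ → ℝ := fun ξ => P.deficit (S ξ) (p ξ) ^ 2 / 2 - V (S ξ) with hD
  have hder : ∀ η ≤ ξ, HasDerivAt D _ η := fun η hη =>
    hasDerivAt_deficit_profile (h.solves η) h.κ_pos hV (h.mem η) (h.mem01 η) (hp η hη)
  have hanti : AntitoneOn (fun η => D η ^ 2) (Iic ξ) := by
    refine antitoneOn_of_hasDerivWithinAt_nonpos (convex_Iic _)
      (fun η hη => ((hder η hη).pow 2).continuousAt.continuousWithinAt)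
      (fun η hη => ((hder η (mem_Iic.1 (interior_subset hη))).pow 2).hasDerivWithinAt)
      (fun η _ => ?_)
    have hA : 0 ≤ P.deficit (S η) (p η) / κ := div_nonneg deficit_nonneg h.κ_pos.le
    have hl := (P.lo_deriv_neg _ (h.mem01 η)).le
    have hsign : 0 ≤ D η * (P.deficit (S η) (p η) - √(2 * V (S η))) := by
      rcases le_total 0 (D η) with h0 | h0
      · refine mul_nonneg h0 (sub_nonneg.2 ?_)
        rw [← Real.sqrt_sq (deficit_nonneg (P := P) (S := S η) (p := p η))]
        exact Real.sqrt_le_sqrt (by simp only [hD] at h0; linarith)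
      · refine mul_nonneg_of_nonpos_of_nonpos h0 (sub_nonpos.2 ?_)
        rw [← Real.sqrt_sq (deficit_nonneg (P := P) (S := S η) (p := p η))]
        exact Real.sqrt_le_sqrt (by simp only [hD] at h0; linarith)
    have := mul_nonneg (mul_nonneg hA (neg_nonneg.2 hl)) hsign
    simp only [Nat.cast_ofNat, Nat.add_one_sub_one, pow_one]
    linarith
  have hlim : Tendsto (fun η => D η ^ 2) atBot (𝓝 0) := by
    have h1 := (continuousAt_deficit (P := P) (z := (P.a, P.lo P.a)) P.a_mem).tendsto.comp
      (h.tendsto_S.prodMk_nhds h.tendsto_p)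
    simp only [deficit_lo_self] at h1
    have h2 : Tendsto V (𝓝[Icc P.a P.t] P.a) (𝓝 (V P.a)) := hV.cont P.a ⟨le_rfl, P.a_lt_t.le⟩
    have h3 : Tendsto S atBot (𝓝[Icc P.a P.t] P.a) := tendsto_nhdsWithin_iff.2
      ⟨h.tendsto_S, Eventually.of_forall fun η => Ioo_subset_Icc_self (h.mem η)⟩
    have h4 := (((h1.pow 2).div_const 2).sub (h2.comp h3)).pow 2
    simpa [hV.zero] using h4
  have h1 := ge_of_tendsto hlim ((eventually_le_atBot ξ).mono fun η hη => hanti hη self_mem_Iic hη)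
  have h2 : D ξ = 0 := by
    have := le_antisymm h1 (sq_nonneg _)
    exact pow_eq_zero_iff two_ne_zero |>.1 this
  exact sub_eq_zero.1 h2

theorem profile_b_pos (hV : P.IsProfile κ P.t V) (hex : ∃ ξ, S ξ = P.b) : 0 < V P.b := by
  obtain ⟨ξ, hξ, hp, hle⟩ := h.exists_first_crossing hex
  have h1 := h.deficit_sq_eq hV (ξ := ξ) fun η hη =>
    (hle η hη).2.le.trans (P.lo_lt_hi _ (h.mem01 η)).le
  rw [hξ, deficit_eq hp.le] at h1
  rw [← h1]
  have : 0 < P.lo P.b - p ξ := sub_pos.2 hp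
  positivity

theorem lt_b_of_ne (hne : ∀ ξ, S ξ ≠ P.b) (ξ : ℝ) : S ξ < P.b := by
  obtain ⟨N, hN⟩ := eventually_atBot.1 (h.tendsto_S.eventually (gt_mem_nhds P.a_lt_b))
  by_contra! hcon
  obtain ⟨x, -, hx⟩ := intermediate_value_Icc (min_le_right N ξ) h.continuous_S.continuousOn
    ⟨(hN _ (min_le_left N ξ)).le, hcon⟩
  exact hne x hx

theorem lt_lo_of_ne (hne : ∀ ξ, S ξ ≠ P.b) (ξ : ℝ) : p ξ < P.lo (S ξ) := by
  obtain ⟨N, hN⟩ := eventually_atBot.1 h.start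
  exact h.lt_lo_of_le (min_le_right N ξ) (hN _ (min_le_left N ξ)) fun x _ => h.lt_b_of_ne hne x

theorem strictMono_of_ne (hne : ∀ ξ, S ξ ≠ P.b) : StrictMono S :=
  strictMono_of_hasDerivAt_pos h.hasDerivAt_S fun ξ => h.deriv_pos_of_lt_lo (h.lt_lo_of_ne hne ξ)

theorem strictAnti_of_ne (hne : ∀ ξ, S ξ ≠ P.b) : StrictAnti p :=
  strictAnti_of_hasDerivAt_neg (fun ξ => (h.solves ξ).eq_p) fun ξ =>
    P.g_neg _ ⟨(h.mem ξ).1, h.lt_b_of_ne hne ξ⟩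

theorem profile_b_eq_zero (hV : P.IsProfile κ P.t V) (hne : ∀ ξ, S ξ ≠ P.b) : V P.b = 0 := by
  have h1 : ∀ ξ, P.deficit (S ξ) (p ξ) ^ 2 / 2 = V (S ξ) := fun ξ =>
    h.deficit_sq_eq hV fun η _ => (h.lt_lo_of_ne hne η).le.trans (P.lo_lt_hi _ (h.mem01 η)).le
  have h2 : ContinuousAt V P.b := hV.cont.continuousAt (Icc_mem_nhds P.a_lt_b P.b_lt_t)
  have h3 := h2.tendsto.comp h.tendsto_b
  have h4 : Tendsto (fun ξ => P.deficit (S ξ) (p ξ) ^ 2 / 2) atTop (𝓝 0) := by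
    simpa using (h.tendsto_deficit.pow 2).div_const 2
  exact tendsto_nhds_unique h3 (h4.congr h1)

/-- The orbit passes the line `S = b` if and only if its graph reaches this line below `lo b`. -/
theorem crosses_iff (hV : P.IsProfile κ P.t V) : (∃ ξ, S ξ = P.b) ↔ 0 < V P.b := by
  refine ⟨h.profile_b_pos hV, fun hpos => ?_⟩
  by_contra! hne
  exact hpos.ne' (h.profile_b_eq_zero hV hne)

end IsPath

end PlaySystem

end TwoPhase

/-! ### Existence of an orbit -/

namespace TwoPhase

namespace PlaySystem

variable {P : PlaySystem} {κ : ℝ} {V : ℝ → ℝ} {S p : ℝ → ℝ} {ξ : ℝ}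

variable (P) in
/-- The vector field of the system, made bounded and globally Lipschitz by cutting off the
saturation outside `[a, t]` and the rate above `R`. -/
noncomputable def cutField (κ R : ℝ) (z : ℝ × ℝ) : ℝ × ℝ :=
  ((min (P.deficit (projIcc P.a P.t P.a_lt_t.le z.1) z.2) R -
      min (P.excess (projIcc P.a P.t P.a_lt_t.le z.1) z.2) R) / κ,
    P.g (projIcc P.a P.t P.a_lt_t.le z.1))

open scoped NNReal in
theorem exists_lipschitzWith_cutField (hκ : 0 < κ) (R : ℝ) :
    ∃ K : ℝ≥0, LipschitzWith K (P.cutField κ R) := by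
  obtain ⟨K, hK0, hK⟩ := P.exists_lipschitz P.a_pos P.t_lt_one
  refine ⟨Real.toNNReal (K * (2 / κ) + K), LipschitzWith.of_dist_le_mul fun z z' => ?_⟩
  set q : ℝ → ℝ := fun x => projIcc P.a P.t P.a_lt_t.le x with hq
  have hqmem : ∀ x, q x ∈ Icc P.a P.t := fun x => (projIcc P.a P.t P.a_lt_t.le x).2
  obtain ⟨k1, k2, k3⟩ := hK (q z.1, z.2) ⟨hqmem _, trivial⟩ (q z'.1, z'.2) ⟨hqmem _, trivial⟩
  have hd : dist (q z.1, z.2) (q z'.1, z'.2) ≤ dist z z' := by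
    rw [Prod.dist_eq, Prod.dist_eq]
    refine max_le_max ?_ le_rfl
    have := (LipschitzWith.projIcc P.a_lt_t.le).dist_le_mul z.1 z'.1
    rw [NNReal.coe_one, one_mul] at this
    exact this
  have hd0 : 0 ≤ dist z z' := dist_nonneg
  have hKd := mul_le_mul_of_nonneg_left hd hK0
  simp only at k1 k2 k3
  rw [Real.coe_toNNReal _ (by positivity), Prod.dist_eq, Real.dist_eq, Real.dist_eq]
  have m1 := abs_min_sub_min_le_max (P.deficit (q z.1) z.2) R (P.deficit (q z'.1) z'.2) R
  have m2 := abs_min_sub_min_le_max (P.excess (q z.1) z.2) R (P.excess (q z'.1) z'.2) R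
  rw [sub_self, abs_zero, max_eq_left (abs_nonneg _)] at m1 m2
  refine max_le ?_ ?_
  · change |(min (P.deficit (q z.1) z.2) R - min (P.excess (q z.1) z.2) R) / κ -
      (min (P.deficit (q z'.1) z'.2) R - min (P.excess (q z'.1) z'.2) R) / κ| ≤ _
    rw [← sub_div, abs_div, abs_of_pos hκ, div_le_iff₀ hκ]
    have e : min (P.deficit (q z.1) z.2) R - min (P.excess (q z.1) z.2) R -
        (min (P.deficit (q z'.1) z'.2) R - min (P.excess (q z'.1) z'.2) R) =
        (min (P.deficit (q z.1) z.2) R - min (P.deficit (q z'.1) z'.2) R) -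
        (min (P.excess (q z.1) z.2) R - min (P.excess (q z'.1) z'.2) R) := by ring
    rw [e]
    refine (abs_sub _ _).trans ?_
    have e2 : (K * (2 / κ) + K) * dist z z' * κ = 2 * (K * dist z z') + K * dist z z' * κ := by
      field_simp
    have : 0 ≤ K * dist z z' * κ := by positivity
    linarith
  · change |P.g (q z.1) - P.g (q z'.1)| ≤ _
    have : 0 ≤ K * (2 / κ) * dist z z' := by positivity
    linarith

open scoped NNReal in
theorem exists_bound_cutField (hκ : 0 < κ) {R : ℝ} (hR : 0 < R) :
    ∃ L : ℝ≥0, ∀ z, ‖P.cutField κ R z‖ ≤ L := by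
  obtain ⟨C, hC, hC'⟩ := P.exists_abs_le
  refine ⟨Real.toNNReal (R / κ + C), fun z => ?_⟩
  have hmem := (projIcc P.a P.t P.a_lt_t.le z.1).2
  rw [Real.coe_toNNReal _ (by positivity), Prod.norm_def]
  refine max_le ?_ ?_
  · have h1 := deficit_nonneg (P := P) (S := projIcc P.a P.t P.a_lt_t.le z.1) (p := z.2)
    have h2 := excess_nonneg (P := P) (S := projIcc P.a P.t P.a_lt_t.le z.1) (p := z.2)
    refine le_trans ?_ (le_add_of_nonneg_right hC.le)
    unfold cutField
    rw [Real.norm_eq_abs, abs_div, abs_of_pos hκ]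
    gcongr
    rw [abs_le]
    constructor
    · linarith [le_min h1 hR.le,
        min_le_right (P.excess (projIcc P.a P.t P.a_lt_t.le z.1) z.2) R]
    · linarith [le_min h2 hR.le,
        min_le_right (P.deficit (projIcc P.a P.t P.a_lt_t.le z.1) z.2) R]
  · refine le_trans ?_ (le_add_of_nonneg_left (by positivity))
    exact (hC' _ hmem).2.2

theorem cutField_eq {R x y : ℝ} (hx : x ∈ Icc P.a P.t) (hA : P.deficit x y ≤ R)
    (hB : P.excess x y ≤ R) :
    P.cutField κ R (x, y) = ((P.deficit x y - P.excess x y) / κ, P.g x) := by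
  unfold cutField
  rw [projIcc_of_mem _ hx, min_eq_left hA, min_eq_left hB]

variable (P) in
/-- The orbit starts on the graph described by `V`, half-way between `a` and `b`. Backwards it
follows this graph to `(a, lo a)`, without reaching it in finite time; forwards it is confined by
its energy. -/
theorem exists_path (hκ : 0 < κ) : ∃ S p, P.IsPath κ S p := by
  obtain ⟨V, hV⟩ := P.exists_profile hκ
  have hVb := hV.mono P.b_lt_t.le
  obtain ⟨R₀, hR₀, hR₀'⟩ := exists_energy_radius P κ
  set R := R₀ + 1 with hR
  have hRpos : 0 < R := by linarith
  have hR' : -(2 * κ * P.pot P.b) ≤ R ^ 2 := by nlinarith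
  have hVR : ∀ s ∈ Icc P.a P.b, √(2 * V s) < R := fun s hs => by
    have h1 := hVb.le_pot le_rfl hs
    have h2 := mul_le_mul_of_nonneg_left (P.pot_b_le (P.Icc_ab_subset le_rfl hs)) hκ.le
    have h3 : √(2 * V s) ≤ R₀ := Real.sqrt_le_iff.2 ⟨hR₀.le, by linarith⟩
    linarith
  have hVpos : ∀ s ∈ Ioo P.a P.b, 0 < V s := fun s hs => hVb.pos hκ le_rfl hs
  have hVnn : ∀ s ∈ Icc P.a P.b, 0 ≤ V s := fun s hs => hVb.nonneg hκ le_rfl hs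
  obtain ⟨C, hC, hC'⟩ := P.exists_abs_le
  obtain ⟨K, hK⟩ := exists_lipschitzWith_cutField (P := P) hκ R
  obtain ⟨L, hL⟩ := exists_bound_cutField (P := P) hκ hRpos
  set s₁ := (P.a + P.b) / 2 with hs₁
  have hab := P.a_lt_b
  have hs₁mem : s₁ ∈ Ioo P.a P.b := ⟨by rw [hs₁]; linarith, by rw [hs₁]; linarith⟩
  obtain ⟨α, hα0, hα⟩ := exists_global_solution_of_bounded hK hL (s₁, P.lo s₁ - √(2 * V s₁))
  set S : ℝ → ℝ := fun ξ => (α ξ).1 with hS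
  set p : ℝ → ℝ := fun ξ => (α ξ).2 with hp
  have hαc : Continuous α := continuous_iff_continuousAt.2 fun ξ => (hα ξ).continuousAt
  have hSc : Continuous S := continuous_fst.comp hαc
  have hpc : Continuous p := continuous_snd.comp hαc
  have hsolves : ∀ ξ, S ξ ∈ Ioo P.a P.t → P.deficit (S ξ) (p ξ) < R →
      P.excess (S ξ) (p ξ) < R → P.SolvesAt κ S p ξ := by
    intro ξ h1 h2 h3
    have h4 := hα ξ
    have h5 : P.cutField κ R (α ξ) =
        ((P.deficit (S ξ) (p ξ) - P.excess (S ξ) (p ξ)) / κ, P.g (S ξ)) :=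
      cutField_eq (x := S ξ) (y := p ξ) (Ioo_subset_Icc_self h1) h2.le h3.le
    rw [h5] at h4
    exact ⟨h4.fst, h4.snd⟩
  set good : Set ℝ :=
    {ξ | S ξ ∈ Ioo P.a P.b ∧ p ξ < P.hi (S ξ) ∧ P.deficit (S ξ) (p ξ) < R} with hgood
  have hab_sub : Ioo P.a P.b ⊆ Ioo P.a P.t := Ioo_subset_Ioo_right P.b_lt_t.le
  have hgsol : ∀ ξ ∈ good, P.SolvesAt κ S p ξ := fun ξ hξ =>
    hsolves ξ (hab_sub hξ.1) hξ.2.2 (by rw [excess_eq_zero hξ.2.1.le]; exact hRpos)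
  have hgopen : IsOpen good := by
    rw [isOpen_iff_mem_nhds]
    intro η hη
    have hz : (S η, p η).1 ∈ Ioo (0 : ℝ) 1 := P.Ioo_subset (hab_sub hη.1)
    have hc : ContinuousAt (fun ξ => (S ξ, p ξ)) η := (hSc.prodMk hpc).continuousAt
    have h1 := ContinuousAt.comp (f := fun ξ => (S ξ, p ξ)) (continuousAt_deficit (P := P) hz) hc
    have h2 : ContinuousAt (fun ξ => P.hi (S ξ)) η :=
      ContinuousAt.comp (g := P.hi) (f := S) (hasDerivAt_hi (P := P) hz).continuousAt
        hSc.continuousAt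
    filter_upwards [hSc.continuousAt.eventually (isOpen_Ioo.mem_nhds hη.1),
      hpc.continuousAt.eventually_lt h2 hη.2.1, h1.eventually (gt_mem_nhds hη.2.2)] with x h3 h4 h5
    exact ⟨h3, h4, h5⟩
  have hS0 : S 0 = s₁ := by simp only [hS, hα0]
  have hp0 : p 0 = P.lo s₁ - √(2 * V s₁) := by simp only [hp, hα0]
  -- backwards in time the solution follows the graph described by `V`, as long as it is good
  have hfollow : ∀ ξ₁ ≤ 0, (∀ ξ ∈ Ioc ξ₁ 0, ξ ∈ good) → S ξ₁ ∈ Icc P.a P.b →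
      ∀ ξ ∈ Icc ξ₁ 0, P.deficit (S ξ) (p ξ) = √(2 * V (S ξ)) := by
    intro ξ₁ hξ₁ hg hS₁
    have hmem : ∀ ξ ∈ Icc ξ₁ 0, S ξ ∈ Icc P.a P.b := fun ξ hξ => by
      rcases hξ.1.eq_or_lt with rfl | h1
      · exact hS₁
      · exact Ioo_subset_Icc_self (hg ξ ⟨h1, hξ.2⟩).1
    have hDc : ContinuousOn (fun ξ => P.deficit (S ξ) (p ξ) ^ 2 / 2 - V (S ξ)) (Icc ξ₁ 0) := by
      refine ContinuousOn.sub (ContinuousOn.div_const (ContinuousOn.pow ?_ 2) 2)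
        (hVb.cont.comp hSc.continuousOn hmem)
      intro ξ hξ
      exact (ContinuousAt.comp (f := fun ξ => (S ξ, p ξ))
        (continuousAt_deficit (P := P) (z := (S ξ, p ξ))
          (P.Icc_subset (P.Icc_ab_subset le_rfl (hmem ξ hξ))))
        (hSc.prodMk hpc).continuousAt).continuousWithinAt
    have h0 := eq_zero_of_abs_deriv_le_mul_abs_of_eq_zero_left (K := 2 * C / κ) hDc
      (fun ξ hξ => hasDerivAt_deficit_profile (hgsol ξ (hg ξ hξ)) hκ hVb (hg ξ hξ).1
        (P.Ioo_subset (hab_sub (hg ξ hξ).1)) (hg ξ hξ).2.1.le) ?_ ?_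
    · intro ξ hξ
      have h1 : P.deficit (S ξ) (p ξ) ^ 2 = 2 * V (S ξ) := by linarith [h0 ξ hξ]
      rw [← h1, Real.sqrt_sq deficit_nonneg]
    · have h1 := hVnn _ (Ioo_subset_Icc_self hs₁mem)
      rw [hS0, hp0, deficit_eq (by linarith [Real.sqrt_nonneg (2 * V s₁)]), sub_sub_cancel,
        Real.sq_sqrt (by linarith)]
      ring
    · intro ξ hξ
      have hA : 0 ≤ P.deficit (S ξ) (p ξ) := deficit_nonneg
      have hsq := Real.sq_sqrt (show 0 ≤ 2 * V (S ξ) by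
        linarith [hVnn _ (Ioo_subset_Icc_self (hg ξ hξ).1)])
      have hl := (hC' _ (P.Icc_ab_subset le_rfl (Ioo_subset_Icc_self (hg ξ hξ).1))).1
      set A := P.deficit (S ξ) (p ξ)
      set r := √(2 * V (S ξ)) with hr
      have hr0 : 0 ≤ r := Real.sqrt_nonneg _
      have e1 : A ^ 2 / 2 - V (S ξ) = (A + r) * (A - r) / 2 := by
        linear_combination (1 / 2) * hsq
      rw [e1, abs_mul, abs_mul, abs_div, abs_div, abs_mul, abs_of_pos hκ, abs_of_nonneg hA,
        abs_of_nonneg (add_nonneg hA hr0), abs_two]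
      have e2 : 2 * C / κ * ((A + r) * |A - r| / 2) = (A + r) / κ * C * |A - r| := by
        field_simp
      rw [e2]
      gcongr
      linarith
  have hallgood : ∀ ξ ≤ 0, ξ ∈ good := by
    intro ξ hξ
    by_contra hbad
    have hbd : BddAbove (goodᶜ ∩ Iic 0) := ⟨0, fun x hx => hx.2⟩
    obtain ⟨h1, h2⟩ := (hgopen.isClosed_compl.inter isClosed_Iic).csSup_mem ⟨ξ, hbad, hξ⟩ hbd
    set ξ₁ := sSup (goodᶜ ∩ Iic 0)
    have hg : ∀ η ∈ Ioc ξ₁ 0, η ∈ good := fun η hη => by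
      by_contra hcon
      exact absurd (le_csSup hbd ⟨hcon, hη.2⟩) (not_le.2 hη.1)
    have h0good : (0 : ℝ) ∈ good := by
      have h3 := Real.sqrt_nonneg (2 * V s₁)
      have h4 := P.lo_lt_hi _ (P.Ioo_subset (hab_sub hs₁mem))
      refine ⟨by rwa [hS0], by rw [hS0, hp0]; linarith, ?_⟩
      rw [hS0, hp0, deficit_eq (by linarith), sub_sub_cancel]
      exact hVR _ (Ioo_subset_Icc_self hs₁mem)
    have hlt : ξ₁ < 0 := lt_of_le_of_ne h2 fun h3 => h1 (by rwa [h3])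
    have hnb : (𝓝[Ioc ξ₁ 0] ξ₁).NeBot := by
      rw [← mem_closure_iff_nhdsWithin_neBot, closure_Ioc hlt.ne]
      exact ⟨le_rfl, hlt.le⟩
    have hS₁ : S ξ₁ ∈ Icc P.a P.b := isClosed_Icc.mem_of_tendsto
      (hSc.continuousAt.continuousWithinAt (s := Ioc ξ₁ 0)).tendsto
      (eventually_nhdsWithin_of_forall fun η hη => Ioo_subset_Icc_self (hg η hη).1)
    have hfol := hfollow ξ₁ hlt.le hg hS₁
    have hmono : MonotoneOn S (Icc ξ₁ 0) := by
      refine monotoneOn_of_hasDerivWithinAt_nonneg (convex_Icc _ _) hSc.continuousOn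
        (f' := fun η => (P.deficit (S η) (p η) - P.excess (S η) (p η)) / κ)
        (fun η hη => ?_) (fun η hη => ?_)
      · rw [interior_Icc] at hη
        exact (hgsol η (hg η ⟨hη.1, hη.2.le⟩)).eq_S.hasDerivWithinAt
      · rw [interior_Icc] at hη
        rw [excess_eq_zero (hg η ⟨hη.1, hη.2.le⟩).2.1.le, sub_zero]
        exact div_nonneg deficit_nonneg hκ.le
    have hSle : S ξ₁ ≤ s₁ := hS0 ▸ hmono ⟨le_rfl, hlt.le⟩ ⟨hlt.le, le_rfl⟩ hlt.le
    have hA₁ := hfol ξ₁ ⟨le_rfl, hlt.le⟩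
    have hS₁01 := P.Icc_subset (P.Icc_ab_subset le_rfl hS₁)
    have hple : p ξ₁ ≤ P.lo (S ξ₁) := by
      have h3 : Tendsto (fun η => P.lo (S η) - p η) (𝓝[Ioc ξ₁ 0] ξ₁) (𝓝 (P.lo (S ξ₁) - p ξ₁)) :=
        ((ContinuousAt.comp (g := P.lo) (f := S) (hasDerivAt_lo (P := P) hS₁01).continuousAt
          hSc.continuousAt).sub hpc.continuousAt).continuousWithinAt
      have h4 : (0 : ℝ) ≤ P.lo (S ξ₁) - p ξ₁ := ge_of_tendsto h3 <|
        eventually_nhdsWithin_of_forall fun η hη => by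
        have h5 := hfol η (Ioc_subset_Icc_self hη)
        have h6 := Real.sqrt_pos.2 (mul_pos two_pos (hVpos _ (hg η hη).1))
        rw [← h5] at h6
        by_contra! h7
        rw [deficit_eq_zero (by linarith)] at h6
        exact lt_irrefl _ h6
      linarith
    rcases hS₁.1.eq_or_lt with h3 | h3
    · -- the solution would have reached the equilibrium `(a, lo a)` in finite time
      rw [← h3, hV.zero, mul_zero, Real.sqrt_zero] at hA₁
      have h4 : p ξ₁ = P.lo P.a := le_antisymm (by rwa [← h3] at hple) (le_of_deficit_eq_zero hA₁)
      have h5 : P.cutField κ R (P.a, P.lo P.a) = 0 := by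
        rw [cutField_eq ⟨le_rfl, P.a_lt_t.le⟩ (by rw [deficit_lo_self]; exact hRpos.le)
          (by rw [excess_lo_self P.a_mem]; exact hRpos.le), deficit_lo_self,
          excess_lo_self P.a_mem, P.g_a, sub_self, zero_div]
        rfl
      have h6 : α = fun _ => (P.a, P.lo P.a) :=
        ODE_solution_unique_univ (v := fun _ => P.cutField κ R) (s := fun _ => univ) (K := K)
          (t₀ := ξ₁) (fun _ => hK.lipschitzOnWith) (fun ξ => ⟨hα ξ, trivial⟩)
          (fun ξ => ⟨by rw [h5]; exact hasDerivAt_const _ _, trivial⟩)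
          (Prod.ext h3.symm h4)
      have h7 : S 0 = P.a := by simp only [hS, h6]
      exact hs₁mem.1.ne (h7.symm.trans hS0)
    · refine h1 ⟨⟨h3, hSle.trans_lt hs₁mem.2⟩, hple.trans_lt (P.lo_lt_hi _ hS₁01), ?_⟩
      rw [hA₁]
      exact hVR _ hS₁
  have hfol : ∀ ξ ≤ 0, P.deficit (S ξ) (p ξ) = √(2 * V (S ξ)) := fun ξ hξ =>
    hfollow ξ hξ (fun η hη => hallgood η hη.2) (Ioo_subset_Icc_self (hallgood ξ hξ).1)
      ξ ⟨le_rfl, hξ⟩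
  have hlt_lo : ∀ ξ ≤ 0, p ξ < P.lo (S ξ) := fun ξ hξ => by
    have h6 := Real.sqrt_pos.2 (mul_pos two_pos (hVpos _ (hallgood ξ hξ).1))
    rw [← hfol ξ hξ] at h6
    by_contra! h7
    rw [deficit_eq_zero h7] at h6
    exact lt_irrefl _ h6
  have hSder : ∀ ξ ≤ 0, HasDerivAt S (√(2 * V (S ξ)) / κ) ξ := fun ξ hξ => by
    have h1 := (hgsol ξ (hallgood ξ hξ)).eq_S
    rwa [excess_eq_zero (hallgood ξ hξ).2.1.le, sub_zero, hfol ξ hξ] at h1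
  have hmono : MonotoneOn S (Iic 0) := by
    refine monotoneOn_of_hasDerivWithinAt_nonneg (convex_Iic _) hSc.continuousOn
      (fun η hη => (hSder η (mem_Iic.1 (interior_subset hη))).hasDerivWithinAt)
      (fun η _ => div_nonneg (Real.sqrt_nonneg _) hκ.le)
  have hlim : Tendsto S atBot (𝓝 P.a) := by
    rw [tendsto_order]
    refine ⟨fun x hx => ?_, fun x hx => ?_⟩
    · filter_upwards [eventually_le_atBot 0] with ξ hξ
      exact hx.trans (hallgood ξ hξ).1.1
    · suffices h : ∃ ξ ≤ 0, S ξ < x by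
        obtain ⟨ξ, hξ, hξ'⟩ := h
        filter_upwards [eventually_le_atBot ξ] with η hη
        exact (hmono (mem_Iic.2 (hη.trans hξ)) (mem_Iic.2 hξ) hη).trans_lt hξ'
      by_contra! hcon
      -- otherwise `S` would grow at a uniformly positive rate on all of `(-∞, 0]`
      have hxs : Icc x s₁ ⊆ Ioo P.a P.b := fun y hy =>
        ⟨hx.trans_le hy.1, hy.2.trans_lt hs₁mem.2⟩
      obtain ⟨η, hη, hη'⟩ := isCompact_Icc.exists_forall_le' (s := Icc x s₁)
        (f := fun s => √(2 * V s) / κ) (a := 0)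
        (ContinuousOn.div_const (Real.continuous_sqrt.comp_continuousOn (continuousOn_const.mul
          (hVb.cont.mono (hxs.trans Ioo_subset_Icc_self)))) κ)
        (fun s hs => div_pos (Real.sqrt_pos.2 (mul_pos two_pos (hVpos s (hxs hs)))) hκ)
      have hgrow : MonotoneOn (fun ξ => S ξ - η * ξ) (Iic 0) := by
        refine monotoneOn_of_hasDerivWithinAt_nonneg (convex_Iic _)
          (hSc.sub (by fun_prop)).continuousOn
          (fun ξ hξ => ((hSder ξ (mem_Iic.1 (interior_subset hξ))).sub
            ((hasDerivAt_id ξ).const_mul η)).hasDerivWithinAt) (fun ξ hξ => ?_)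
        have hξ0 : ξ ≤ 0 := mem_Iic.1 (interior_subset hξ)
        have h1 := hη' (S ξ) ⟨hcon ξ hξ0, hS0 ▸ hmono (mem_Iic.2 hξ0) self_mem_Iic hξ0⟩
        simp only [mul_one]
        linarith
      have hneg : -((s₁ - P.a) / η) ≤ 0 := neg_nonpos.2 (div_nonneg (by linarith [hs₁mem.1]) hη.le)
      have h1 := hgrow (mem_Iic.2 hneg) self_mem_Iic hneg
      simp only [hS0, mul_zero, sub_zero, mul_neg, sub_neg_eq_add] at h1
      rw [mul_div_cancel₀ _ hη.ne'] at h1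
      linarith [(hallgood _ hneg).1.1]
  have hplim : Tendsto p atBot (𝓝 (P.lo P.a)) := by
    have h1 : Tendsto (fun ξ => P.lo (S ξ)) atBot (𝓝 (P.lo P.a)) :=
      (hasDerivAt_lo (P := P) P.a_mem).continuousAt.tendsto.comp hlim
    have h2 : Tendsto V (𝓝[Icc P.a P.b] P.a) (𝓝 (V P.a)) := hVb.cont P.a ⟨le_rfl, hab.le⟩
    have h3 : Tendsto S atBot (𝓝[Icc P.a P.b] P.a) := tendsto_nhdsWithin_iff.2
      ⟨hlim, (eventually_le_atBot 0).mono fun ξ hξ => Ioo_subset_Icc_self (hallgood ξ hξ).1⟩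
    have h4 := h1.sub ((h2.comp h3).const_mul 2).sqrt
    rw [hV.zero, mul_zero, Real.sqrt_zero, sub_zero] at h4
    refine h4.congr' ?_
    filter_upwards [eventually_le_atBot 0] with ξ hξ
    rw [Function.comp_apply, ← hfol ξ hξ, deficit_eq (hlt_lo ξ hξ).le, sub_sub_cancel]
  have hmem : ∀ᶠ ξ in atBot, S ξ ∈ Ioo P.a P.t :=
    (eventually_le_atBot 0).mono fun ξ hξ => hab_sub (hallgood ξ hξ).1
  have hstart : ∀ᶠ ξ in atBot, p ξ < P.lo (S ξ) := (eventually_le_atBot 0).mono hlt_lo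
  have htrap := trapped hκ hRpos hR' hSc hpc hsolves hmem hstart hlim hplim
  exact ⟨S, p, hκ, fun ξ => (htrap ξ).1,
    fun ξ => hsolves ξ (htrap ξ).1 (htrap ξ).2.1 (htrap ξ).2.2, hstart, hlim, hplim⟩

end PlaySystem

end TwoPhase

/-! ### The play system of a two-phase medium -/

namespace TwoPhase

namespace Medium

variable (m : Medium) {S : ℝ}

theorem krw_pos (hS : S ∈ Ioo (0 : ℝ) 1) : 0 < m.krw S := by
  have h : StrictMonoOn m.krw (Icc 0 1) := by
    refine strictMonoOn_of_deriv_pos (convex_Icc _ _) m.krw_contDiffOn.continuousOn fun x hx => ?_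
    rw [interior_Icc] at hx
    rw [← derivWithin_of_mem_nhds (Icc_mem_nhds hx.1 hx.2)]
    exact m.krw_deriv_pos x (Ioo_subset_Ioc_self hx)
  have := h (left_mem_Icc.2 zero_le_one) (Ioo_subset_Icc_self hS) hS.1
  rwa [m.krw_zero] at this

theorem krn_pos (hS : S ∈ Ioo (0 : ℝ) 1) : 0 < m.krn S := by
  have h : StrictAntiOn m.krn (Icc 0 1) := by
    refine strictAntiOn_of_deriv_neg (convex_Icc _ _) m.krn_contDiffOn.continuousOn fun x hx => ?_
    rw [interior_Icc] at hx
    rw [← derivWithin_of_mem_nhds (Icc_mem_nhds hx.1 hx.2)]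
    exact m.krn_deriv_neg x (Ioo_subset_Ico_self hx)
  have := h (Ioo_subset_Icc_self hS) (right_mem_Icc.2 zero_le_one) hS.2
  rwa [m.krn_one] at this

theorem mobility_pos (hS : S ∈ Ioo (0 : ℝ) 1) : 0 < m.krw S + m.M * m.krn S :=
  add_pos (m.krw_pos hS) (mul_pos m.M_pos (m.krn_pos hS))

theorem h_pos (hS : S ∈ Ioo (0 : ℝ) 1) : 0 < m.h S :=
  mul_pos (m.krn_pos hS) (div_pos (m.krw_pos hS) (m.mobility_pos hS))

theorem contDiffOn_f : ContDiffOn ℝ 2 m.f (Ioo 0 1) := by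
  have h1 := m.krw_contDiffOn.mono Ioo_subset_Icc_self
  have h2 := m.krn_contDiffOn.mono Ioo_subset_Icc_self
  exact h1.div (h1.add (contDiffOn_const.mul h2)) fun x hx => (m.mobility_pos hx).ne'

theorem contDiffOn_h : ContDiffOn ℝ 2 m.h (Ioo 0 1) :=
  (m.krn_contDiffOn.mono Ioo_subset_Icc_self).mul m.contDiffOn_f

theorem contDiffOn_F : ContDiffOn ℝ 2 m.F (Ioo 0 1) :=
  m.contDiffOn_f.add (contDiffOn_const.mul m.contDiffOn_h)

theorem contDiffOn_G (SB a : ℝ) : ContDiffOn ℝ 2 (m.G SB a) (Ioo 0 1) := by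
  refine (m.contDiffOn_F.sub ?_).div m.contDiffOn_h fun x hx => (m.h_pos hx).ne'
  unfold chord
  fun_prop

theorem hasDerivAt_F (hS : S ∈ Ioo (0 : ℝ) 1) : HasDerivAt m.F (deriv m.F S) S :=
  ((m.contDiffOn_F.differentiableOn (by norm_num)).differentiableAt
    (isOpen_Ioo.mem_nhds hS)).hasDerivAt

theorem hasDerivAt_deriv_F (hS : S ∈ Ioo (0 : ℝ) 1) :
    HasDerivAt (deriv m.F) (deriv (deriv m.F) S) S := by
  have h1 : ContDiffOn ℝ 1 (deriv m.F) (Ioo 0 1) :=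
    m.contDiffOn_F.deriv_of_isOpen isOpen_Ioo (by norm_num)
  exact ((h1.differentiableOn (by norm_num)).differentiableAt
    (isOpen_Ioo.mem_nhds hS)).hasDerivAt

/-- The numerator of the derivative of the chord slope `a ↦ speed SB a`; its sign tells on which
side of the tangency point `S̄` the point `a` lies. -/
noncomputable def tangencyGap (SB a : ℝ) : ℝ := deriv m.F a * (a - SB) - (m.F a - m.F SB)

theorem hasDerivAt_tangencyGap (SB : ℝ) (hS : S ∈ Ioo (0 : ℝ) 1) :
    HasDerivAt (m.tangencyGap SB) (deriv (deriv m.F) S * (S - SB)) S := by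
  refine (((m.hasDerivAt_deriv_F hS).mul ((hasDerivAt_id S).sub_const SB)).sub
    ((m.hasDerivAt_F hS).sub_const (m.F SB))).congr_deriv ?_
  simp

theorem hasDerivAt_speed {SB : ℝ} (hS : S ∈ Ioo (0 : ℝ) 1) (hne : S ≠ SB) :
    HasDerivAt (m.speed SB) (m.tangencyGap SB S / (S - SB) ^ 2) S := by
  refine (((m.hasDerivAt_F hS).sub_const (m.F SB)).div ((hasDerivAt_id S).sub_const SB)
    (sub_ne_zero.2 hne)).congr_deriv ?_
  simp [tangencyGap]

theorem flux_sub_chord (SB a : ℝ) (S : ℝ) :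
    m.F S - m.chord SB a S = (S - SB) * (m.speed SB S - m.speed SB a) := by
  rcases eq_or_ne S SB with rfl | h
  · simp [chord]
  · have h1 : (S - SB) * m.speed SB S = m.F S - m.F SB := mul_div_cancel₀ _ (sub_ne_zero.2 h)
    rw [mul_sub, h1, chord]
    ring

theorem G_eq (SB a S : ℝ) :
    m.G SB a S = (S - SB) * (m.speed SB S - m.speed SB a) / m.h S := by
  rw [G, flux_sub_chord]

variable {m} {So SB SBar Ss ST : ℝ}

section Tangency

variable (hA : m.ScenarioA So) (hSB : 0 < SB) (hSBSo : SB < So)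
include hA hSB hSBSo

omit hSBSo in
theorem tangencyGap_strictMonoOn : StrictMonoOn (m.tangencyGap SB) (Icc SB So) := by
  have hsub : Icc SB So ⊆ Ioo 0 1 := fun x hx => ⟨hSB.trans_le hx.1, hx.2.trans_lt hA.So_mem.2⟩
  refine strictMonoOn_of_hasDerivWithinAt_pos (convex_Icc _ _)
    (fun x hx => (m.hasDerivAt_tangencyGap SB (hsub hx)).continuousAt.continuousWithinAt)
    (fun x hx => (m.hasDerivAt_tangencyGap SB (hsub (interior_subset hx))).hasDerivWithinAt)
    fun x hx => ?_
  rw [interior_Icc] at hx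
  exact mul_pos (hA.convex_part x ⟨hSB.trans hx.1, hx.2⟩) (sub_pos.2 hx.1)

omit hSB in
theorem tangencyGap_strictAntiOn : StrictAntiOn (m.tangencyGap SB) (Ico So 1) := by
  have hsub : Ico So 1 ⊆ Ioo 0 1 := fun x hx => ⟨hA.So_mem.1.trans_le hx.1, hx.2⟩
  refine strictAntiOn_of_hasDerivWithinAt_neg (convex_Ico _ _)
    (fun x hx => (m.hasDerivAt_tangencyGap SB (hsub hx)).continuousAt.continuousWithinAt)
    (fun x hx => (m.hasDerivAt_tangencyGap SB (hsub (interior_subset hx))).hasDerivWithinAt)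
    fun x hx => ?_
  rw [interior_Ico] at hx
  exact mul_neg_of_neg_of_pos (hA.concave_part x hx) (sub_pos.2 (hSBSo.trans hx.1))

theorem tangencyGap_pos_of_le (hS : S ∈ Ioc SB So) : 0 < m.tangencyGap SB S := by
  have h := tangencyGap_strictMonoOn hA hSB (left_mem_Icc.2 hSBSo.le)
    (Ioc_subset_Icc_self hS) hS.1
  simpa [tangencyGap] using h

variable (hbar : m.IsSBar SB SBar)
include hbar

omit hA hSB hSBSo in
theorem tangencyGap_SBar : m.tangencyGap SB SBar = 0 := by
  rw [tangencyGap, hbar.2, div_mul_cancel₀ _ (sub_ne_zero.2 hbar.1.1.ne'), sub_self]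

theorem So_lt_SBar : So < SBar := by
  by_contra! h
  exact (tangencyGap_pos_of_le hA hSB hSBSo ⟨hbar.1.1, h⟩).ne' (tangencyGap_SBar hbar)

theorem tangencyGap_pos (hS : S ∈ Ioo SB SBar) : 0 < m.tangencyGap SB S := by
  rcases le_total S So with h | h
  · exact tangencyGap_pos_of_le hA hSB hSBSo ⟨hS.1, h⟩
  · rw [← tangencyGap_SBar hbar]
    exact tangencyGap_strictAntiOn hA hSBSo ⟨h, hS.2.trans hbar.1.2⟩
      ⟨(So_lt_SBar hA hSB hSBSo hbar).le, hbar.1.2⟩ hS.2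

theorem tangencyGap_neg (hS : S ∈ Ioo SBar 1) : m.tangencyGap SB S < 0 := by
  have h := So_lt_SBar hA hSB hSBSo hbar
  rw [← tangencyGap_SBar hbar]
  exact tangencyGap_strictAntiOn hA hSBSo ⟨h.le, hbar.1.2⟩ ⟨h.le.trans hS.1.le, hS.2⟩ hS.1

theorem speed_strictMonoOn : StrictMonoOn (m.speed SB) (Ioc SB SBar) := by
  have hd : ∀ x ∈ Ioc SB SBar,
      HasDerivAt (m.speed SB) (m.tangencyGap SB x / (x - SB) ^ 2) x := fun x hx =>
    m.hasDerivAt_speed ⟨hSB.trans hx.1, hx.2.trans_lt hbar.1.2⟩ hx.1.ne'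
  refine strictMonoOn_of_hasDerivWithinAt_pos (convex_Ioc _ _)
    (fun x hx => (hd x hx).continuousAt.continuousWithinAt)
    (fun x hx => (hd x (interior_subset hx)).hasDerivWithinAt) fun x hx => ?_
  rw [interior_Ioc] at hx
  exact div_pos (tangencyGap_pos hA hSB hSBSo hbar hx) (pow_pos (sub_pos.2 hx.1) 2)

theorem speed_strictAntiOn : StrictAntiOn (m.speed SB) (Ico SBar 1) := by
  have hd : ∀ x ∈ Ico SBar 1,
      HasDerivAt (m.speed SB) (m.tangencyGap SB x / (x - SB) ^ 2) x := fun x hx =>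
    m.hasDerivAt_speed ⟨(hSB.trans hbar.1.1).trans_le hx.1, hx.2⟩ (hbar.1.1.trans_le hx.1).ne'
  refine strictAntiOn_of_hasDerivWithinAt_neg (convex_Ico _ _)
    (fun x hx => (hd x hx).continuousAt.continuousWithinAt)
    (fun x hx => (hd x (interior_subset hx)).hasDerivWithinAt) fun x hx => ?_
  rw [interior_Ico] at hx
  exact div_neg_of_neg_of_pos (tangencyGap_neg hA hSB hSBSo hbar hx)
    (pow_pos (sub_pos.2 (hbar.1.1.trans hx.1)) 2)

omit hSBSo hbar in
theorem speed_pos (hS : S ∈ Ioo SB 1) : 0 < m.speed SB S := by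
  have hF : StrictMonoOn m.F (Ioo 0 1) := strictMonoOn_of_deriv_pos (convex_Ioo _ _)
    m.contDiffOn_F.continuousOn (by rw [interior_Ioo]; exact hA.F_deriv_pos)
  exact div_pos (sub_pos.2 (hF ⟨hSB, hS.1.trans hS.2⟩ ⟨hSB.trans hS.1, hS.2⟩ hS.1))
    (sub_pos.2 hS.1)

theorem deriv_G_pos (hST : ST ∈ Ioo SB SBar) : 0 < deriv (m.G SB ST) ST := by
  have h01 : ST ∈ Ioo (0 : ℝ) 1 := ⟨hSB.trans hST.1, hST.2.trans hbar.1.2⟩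
  have hh := m.h_pos h01
  have hdh : HasDerivAt m.h (deriv m.h ST) ST :=
    ((m.contDiffOn_h.differentiableOn (by norm_num)).differentiableAt
      (isOpen_Ioo.mem_nhds h01)).hasDerivAt
  have hchord : HasDerivAt (m.chord SB ST) (m.speed SB ST) ST := by
    refine ((((hasDerivAt_id ST).sub_const SB).const_mul (m.speed SB ST)).const_add
      (m.F SB)).congr_deriv ?_
    simp
  have h0 : m.F ST - m.chord SB ST ST = 0 := by rw [flux_sub_chord, sub_self, mul_zero]
  have hG : HasDerivAt (m.G SB ST) _ ST := ((m.hasDerivAt_F h01).sub hchord).div hdh hh.ne'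
  rw [hG.deriv]
  simp only [Pi.sub_apply]
  rw [h0, zero_mul, sub_zero]
  have hgap := tangencyGap_pos hA hSB hSBSo hbar hST
  have hpos : 0 < ST - SB := sub_pos.2 hST.1
  have h1 : deriv m.F ST - m.speed SB ST = m.tangencyGap SB ST / (ST - SB) := by
    rw [tangencyGap, speed]
    field_simp
  rw [h1]
  positivity

end Tangency

/-- Lowering the chord raises `G`. -/
theorem G_le_G (hSB : 0 < SB) (hS : S ∈ Ico SB 1) {a a' : ℝ} (h : m.speed SB a' ≤ m.speed SB a) :
    m.G SB a S ≤ m.G SB a' S := by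
  rw [G_eq, G_eq]
  have := (m.h_pos ⟨hSB.trans_le hS.1, hS.2⟩).le
  have h2 := sub_nonneg.2 hS.1
  gcongr

/-- The travelling wave system of a two-phase medium, between the saturation `SB` and the common
value `β = γ` that belongs to `S_*`, is a play system. -/
theorem exists_playSystem (hA : m.ScenarioA So) (hSB : 0 < SB) (hSBSo : SB < So)
    (hSs : m.IsSStar SB Ss) (hST : SB < ST) (hSTSs : ST ≤ Ss) :
    ∃ P : PlaySystem, P.lo = m.pci ∧ P.hi = m.pcd ∧ P.g = m.G SB ST ∧ P.a = SB ∧ P.b = ST := by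
  obtain ⟨SBar, hbar, hSsbar, t, hbeta, ⟨htmem, htint⟩, -⟩ := hSs
  have hmono := speed_strictMonoOn hA hSB hSBSo hbar
  have hanti := speed_strictAntiOn hA hSB hSBSo hbar
  have hSTbar : ST < SBar := hSTSs.trans_lt hSsbar.2
  have hle : m.speed SB ST ≤ m.speed SB Ss :=
    hmono.monotoneOn ⟨hST, hSTbar.le⟩ ⟨hSsbar.1, hSsbar.2.le⟩ hSTSs
  have hspeedt : m.speed SB t = m.speed SB Ss := by
    have h1 := m.flux_sub_chord SB Ss t
    rw [hbeta.2, sub_self] at h1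
    exact sub_eq_zero.1 ((mul_eq_zero.1 h1.symm).resolve_left (sub_pos.2 htmem.1).ne')
  have hsub : Ioo (0 : ℝ) 1 ⊇ Icc SB t := fun x hx => ⟨hSB.trans_le hx.1, hx.2.trans_lt htmem.2⟩
  have hint : ∀ a, IntervalIntegrable (m.G SB a) MeasureTheory.volume SB t := fun a =>
    ((m.contDiffOn_G SB a).continuousOn.mono
      (by rw [uIcc_of_le htmem.1.le]; exact hsub)).intervalIntegrable
  refine ⟨{ lo := m.pci, hi := m.pcd, g := m.G SB ST, a := SB, b := ST, t := t
            a_pos := hSB, a_lt_b := hST, b_lt_t := hSTbar.trans_le hbeta.1.1, t_lt_one := htmem.2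
            lo_contDiffOn := m.pci_contDiffOn.mono Ioo_subset_Ioc_self
            hi_contDiffOn := m.pcd_contDiffOn.mono Ioo_subset_Ioc_self
            lo_deriv_neg := m.pci_deriv_neg, hi_deriv_neg := m.pcd_deriv_neg
            lo_lt_hi := m.pci_lt_pcd, g_contDiffOn := m.contDiffOn_G SB ST
            g_a := ?_, g_b := ?_, g_neg := ?_, g_pos := ?_
            g_deriv_pos := deriv_G_pos hA hSB hSBSo hbar ⟨hST, hSTbar⟩, area_nonneg := ?_ },
          rfl, rfl, rfl, rfl, rfl⟩
  · rw [G_eq, sub_self, zero_mul, zero_div]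
  · rw [G_eq, sub_self, mul_zero, zero_div]
  · intro x hx
    rw [G_eq]
    exact div_neg_of_neg_of_pos (mul_neg_of_pos_of_neg (sub_pos.2 hx.1)
      (sub_neg.2 (hmono ⟨hx.1, (hx.2.trans hSTbar).le⟩ ⟨hST, hSTbar.le⟩ hx.2)))
      (m.h_pos (hsub ⟨hx.1.le, hx.2.le.trans (hSTbar.le.trans hbeta.1.1)⟩))
  · intro x hx
    rw [G_eq]
    refine div_pos (mul_pos (sub_pos.2 (hST.trans hx.1)) (sub_pos.2 ?_))
      (m.h_pos (hsub ⟨(hST.trans hx.1).le, hx.2.le⟩))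
    rcases le_total x SBar with h | h
    · exact hmono ⟨hST, hSTbar.le⟩ ⟨hST.trans hx.1, h⟩ hx.1
    · exact hle.trans_lt (hspeedt ▸ hanti ⟨h, hx.2.trans htmem.2⟩ ⟨hbeta.1.1, htmem.2⟩ hx.2)
  · rw [← htint]
    exact intervalIntegral.integral_mono_on htmem.1.le (hint _) (hint _) fun x hx =>
      G_le_G hSB ⟨hx.1, hx.2.trans_lt htmem.2⟩ hle

end Medium

end TwoPhase

/-! ### Orbits of the medium and of the play system -/

namespace TwoPhase

theorem eqOn_Iic_of_deriv_eq_zero {f : ℝ → ℝ} {L x₀ : ℝ} (hd : ∀ x ≤ x₀, HasDerivAt f 0 x)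
    (hlim : Tendsto f atBot (𝓝 L)) : f x₀ = L := by
  have h1 : ∀ x ≤ x₀, f x = f x₀ := fun x hx =>
    (constant_of_has_deriv_right_zero
      (fun y hy => (hd y hy.2).continuousAt.continuousWithinAt)
      (fun y hy => (hd y hy.2.le).hasDerivWithinAt) x₀ ⟨hx, le_rfl⟩).symm
  exact tendsto_nhds_unique
    (tendsto_const_nhds.congr' ((eventually_le_atBot x₀).mono fun x hx => (h1 x hx).symm)) hlim

namespace PlaySystem

variable {P : PlaySystem} {κ : ℝ} {S p : ℝ → ℝ}

/-- Any nonconstant solution coming from `(a, lo a)` starts into `a < S`, `p < lo S`: elsewhere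
near this point, `S` or `(S, p)` does not change as one goes back in time. -/
theorem isPath_of_solves (hκ : 0 < κ) (hmem : ∀ ξ, S ξ ∈ Ioo (0 : ℝ) 1)
    (hsol : ∀ ξ, P.SolvesAt κ S p ξ) (hS : Tendsto S atBot (𝓝 P.a))
    (hp : Tendsto p atBot (𝓝 (P.lo P.a))) (hne : ∃ ξ, (S ξ, p ξ) ≠ (P.a, P.lo P.a)) :
    P.IsPath κ S p := by
  have hnoeq : ∀ ξ, S ξ = P.a → p ξ ≠ P.lo P.a := fun ξ h1 h2 => by
    obtain ⟨η, hη⟩ := hne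
    obtain ⟨h3, h4⟩ := eq_equilibrium hκ P.a_mem P.g_a le_rfl (P.lo_lt_hi _ P.a_mem).le hmem hsol
      h1 h2 η
    exact hη (Prod.ext h3 h4)
  have hhi : Tendsto (fun ξ => P.hi (S ξ)) atBot (𝓝 (P.hi P.a)) :=
    (hasDerivAt_hi (P := P) P.a_mem).continuousAt.tendsto.comp hS
  obtain ⟨N, hN⟩ := eventually_atBot.1 ((hS.eventually (gt_mem_nhds P.a_lt_b)).and
    (hp.eventually_lt hhi (P.lo_lt_hi _ P.a_mem)))
  have hdS : ∀ ξ ≤ N, HasDerivAt S (P.deficit (S ξ) (p ξ) / κ) ξ := fun ξ hξ => by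
    have h1 := (hsol ξ).eq_S
    rwa [excess_eq_zero (hN ξ hξ).2.le, sub_zero] at h1
  have hmono : MonotoneOn S (Iic N) := by
    refine monotoneOn_of_hasDerivWithinAt_nonneg (convex_Iic _)
      (fun ξ hξ => (hdS ξ hξ).continuousAt.continuousWithinAt)
      (fun ξ hξ => (hdS ξ (mem_Iic.1 (interior_subset hξ))).hasDerivWithinAt) fun ξ _ => ?_
    exact div_nonneg deficit_nonneg hκ.le
  have hle : ∀ ξ ≤ N, P.a ≤ S ξ := fun ξ hξ =>
    le_of_tendsto hS ((eventually_le_atBot ξ).mono fun η hη => hmono (hη.trans hξ) hξ hη)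
  have hgt : ∀ ξ ≤ N, P.a < S ξ := fun ξ hξ => by
    refine lt_of_le_of_ne (hle ξ hξ) fun heq => ?_
    -- otherwise `S = a` on the whole half-line, where `p` is then constant as well
    refine hnoeq ξ heq.symm (eqOn_Iic_of_deriv_eq_zero (fun η hη => ?_) hp)
    have h1 : S η = P.a :=
      le_antisymm (heq ▸ hmono (mem_Iic.2 (hη.trans hξ)) hξ hη) (hle η (hη.trans hξ))
    have h2 := (hsol η).eq_p
    rwa [h1, P.g_a] at h2
  have hstart : ∀ ξ ≤ N, p ξ < P.lo (S ξ) := fun ξ hξ => by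
    by_contra! hcon
    -- the region `lo S ≤ p` would be backward invariant, and `S` constant there
    have hback : ∀ η ≤ ξ, P.lo (S η) ≤ p η := fun η hη => by
      by_contra! hlt
      have hd : ∀ x, HasDerivAt (fun ξ => P.lo (S ξ) - p ξ) _ x := fun x =>
        ((hasDerivAt_lo (hmem x)).comp x (hsol x).eq_S).sub (hsol x).eq_p
      have := pos_of_deriv_pos_of_zero (f := fun ξ => P.lo (S ξ) - p ξ) hη
        (fun x _ => (hd x).continuousAt.continuousWithinAt) (sub_pos.2 hlt) fun x hx hx0 => by
          refine ⟨_, ?_, hd x⟩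
          rw [← sub_eq_zero.1 hx0, deficit_lo_self, excess_lo_self (hmem x)]
          simpa using P.g_neg _ ⟨hgt x (hx.2.trans hξ), (hN x (hx.2.trans hξ)).1⟩
      exact (sub_pos.1 this).not_ge hcon
    refine (hgt ξ hξ).ne' (eqOn_Iic_of_deriv_eq_zero (fun η hη => ?_) hS)
    have h1 := hdS η (hη.trans hξ)
    rwa [deficit_eq_zero (hback η hη), zero_div] at h1
  have hst : ∀ᶠ ξ in atBot, p ξ < P.lo (S ξ) := eventually_atBot.2 ⟨N, hstart⟩
  have hin : ∀ᶠ ξ in atBot, S ξ ∈ Ioo P.a P.t := eventually_atBot.2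
    ⟨N, fun ξ hξ => ⟨hgt ξ hξ, (hN ξ hξ).1.trans P.b_lt_t⟩⟩
  obtain ⟨R, hR, hR2⟩ := exists_energy_radius P κ
  have hSc : Continuous S := continuous_iff_continuousAt.2 fun ξ => (hsol ξ).eq_S.continuousAt
  have hpc : Continuous p := continuous_iff_continuousAt.2 fun ξ => (hsol ξ).eq_p.continuousAt
  exact ⟨hκ, fun ξ => (trapped hκ hR hR2 hSc hpc (fun ξ _ _ _ => hsol ξ) hin hst hS hp ξ).1,
    hsol, hst, hS, hp⟩

end PlaySystem

namespace Medium

/-- `P` is the play system which governs the travelling waves of the medium `m` from `SB` to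
`ST`. -/
structure Governs (P : PlaySystem) (m : Medium) (SB ST : ℝ) : Prop where
  lo_eq : P.lo = m.pci
  hi_eq : P.hi = m.pcd
  g_eq : P.g = m.G SB ST
  a_eq : P.a = SB
  b_eq : P.b = ST

variable {m : Medium} {P : PlaySystem} {SB ST τ : ℝ} {S p : ℝ → ℝ}

namespace Governs

variable (hP : Governs P m SB ST)
include hP

theorem solvesAt_iff {ξ : ℝ} (hmem : S ξ ∈ Ioo (0 : ℝ) 1) :
    P.SolvesAt (m.speed SB ST * τ) S p ξ ↔
      HasDerivAt S (1 / (m.speed SB ST * τ) * m.calF (S ξ) (p ξ)) ξ ∧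
        HasDerivAt p (m.G SB ST (S ξ)) ξ := by
  have hF : m.calF (S ξ) (p ξ) = P.deficit (S ξ) (p ξ) - P.excess (S ξ) (p ξ) := by
    have h1 := m.pci_lt_pcd _ hmem
    rw [calF, PlaySystem.deficit, PlaySystem.excess, hP.lo_eq, hP.hi_eq]
    split_ifs with h2 h3
    · rw [max_eq_right (by linarith), max_eq_left (by linarith)]; ring
    · rw [max_eq_left (by linarith), max_eq_right (by linarith)]; ring
    · rw [max_eq_right (by linarith), max_eq_right (by linarith)]; ring
  rw [hF, one_div_mul_eq_div, ← hP.g_eq]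
  exact ⟨fun h => ⟨h.eq_S, h.eq_p⟩, fun h => ⟨h.1, h.2⟩⟩

theorem isOrbit_iff (hκ : 0 < m.speed SB ST * τ) :
    m.IsOrbit SB ST τ S p ↔ P.IsPath (m.speed SB ST * τ) S p := by
  constructor
  · intro h
    refine PlaySystem.isPath_of_solves hκ h.mem_strip
      (fun ξ => (hP.solvesAt_iff (h.mem_strip ξ)).2 ⟨h.eq_S ξ, h.eq_p ξ⟩) ?_ ?_ ?_
    · rw [hP.a_eq]; exact h.tendsto_S
    · rw [hP.a_eq, hP.lo_eq]; exact h.tendsto_p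
    · rw [hP.a_eq, hP.lo_eq]; exact h.leaves
  · intro h
    have hsol := fun ξ => (hP.solvesAt_iff (h.mem01 ξ)).1 (h.solves ξ)
    refine ⟨h.mem01, fun ξ => (hsol ξ).1, fun ξ => (hsol ξ).2, ?_, ?_, 0, fun heq => ?_⟩
    · rw [← hP.a_eq]; exact h.tendsto_S
    · rw [← hP.a_eq, ← hP.lo_eq]; exact h.tendsto_p
    · have h1 := congrArg Prod.fst heq
      exact (h.mem 0).1.ne' (h1.trans hP.a_eq.symm)

end Governs

end Medium

end TwoPhase

/-! ### `S_m` and `τ_m` in terms of profiles -/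

namespace TwoPhase

namespace Medium

variable {m : Medium} {P : PlaySystem} {SB ST τ : ℝ} {V : ℝ → ℝ}

namespace Governs

variable (hP : Governs P m SB ST)
include hP

/-- Half the squared distance of a graph orbit from the curve `lo` is a profile. -/
theorem isProfile_of_isGraphOrbit {b c : ℝ} {w : ℝ → ℝ} (hw : m.IsGraphOrbit SB ST τ b w)
    (hcb : c < b) (hct : c ≤ P.t) :
    P.IsProfile (m.speed SB ST * τ) c fun s => (P.lo s - w s) ^ 2 / 2 := by
  obtain ⟨h0, hc, hd⟩ := hw
  rw [← hP.a_eq] at h0 hc hd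
  rw [← hP.lo_eq] at h0 hd
  have hsub : Icc P.a c ⊆ Ioo 0 1 := (Icc_subset_Icc_right hct).trans P.Icc_subset
  refine ⟨by simp [h0], ?_, fun s hs => ?_⟩
  · exact (((P.continuousOn_lo.mono hsub).sub
      (hc.mono fun x hx => ⟨hx.1, hx.2.trans_lt hcb⟩)).pow 2).div_const 2
  · obtain ⟨h1, h2⟩ := hd s ⟨hs.1, hs.2.trans hcb⟩
    rw [hP.a_eq, ← hP.g_eq] at h2
    have hpos : 0 < P.lo s - w s := sub_pos.2 h1
    refine ((((PlaySystem.hasDerivAt_lo (hsub (Ioo_subset_Icc_self hs))).sub h2).pow 2).div_const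
      2).congr_deriv ?_
    simp only [Pi.sub_apply]
    rw [show 2 * ((P.lo s - w s) ^ 2 / 2) = (P.lo s - w s) ^ 2 by ring, Real.sqrt_sq hpos.le]
    field_simp
    ring

theorem isGraphOrbit_of_isProfile {b : ℝ} (hV : P.IsProfile (m.speed SB ST * τ) P.t V)
    (hbt : b ≤ P.t) (hpos : ∀ s ∈ Ioo P.a b, 0 < V s) :
    m.IsGraphOrbit SB ST τ b fun s => P.lo s - √(2 * V s) := by
  have hsub : Ico P.a b ⊆ Icc P.a P.t := fun x hx => ⟨hx.1, hx.2.le.trans hbt⟩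
  unfold IsGraphOrbit
  rw [← hP.a_eq, ← hP.lo_eq]
  refine ⟨by simp [hV.zero], ?_, fun s hs => ?_⟩
  · exact (P.continuousOn_lo.mono (hsub.trans P.Icc_subset)).sub
      ((hV.cont.mono hsub).const_mul 2).sqrt
  · have hp := hpos s hs
    have hr : 0 < √(2 * V s) := Real.sqrt_pos.2 (by positivity)
    refine ⟨sub_lt_self _ hr, ?_⟩
    have h1 := ((hV.hasDerivAt s ⟨hs.1, hs.2.trans_le hbt⟩).const_mul 2).sqrt (by positivity)
    refine ((PlaySystem.hasDerivAt_lo (P := P)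
      (P.Icc_subset (hsub (Ioo_subset_Ico_self hs)))).sub h1).congr_deriv ?_
    rw [hP.a_eq, ← hP.g_eq, sub_sub_cancel]
    field_simp
    ring

/-- The orbit stays below `lo` exactly up to the saturation `b` if and only if the profile
vanishes there. -/
theorem Sm_eq_iff (hκ : 0 < m.speed SB ST * τ) (hV : P.IsProfile (m.speed SB ST * τ) P.t V) :
    m.Sm SB ST τ = ST ↔ V P.b = 0 := by
  have hVb := hV.mono P.b_lt_t.le
  have hpos := fun s (hs : s ∈ Ioo P.a P.b) => hVb.pos hκ le_rfl hs
  have hbmem : P.b ∈ Icc P.a P.b := ⟨P.a_lt_b.le, le_rfl⟩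
  unfold Sm
  rw [← hP.a_eq]
  constructor
  · intro hSm
    by_contra hne
    have hb : 0 < V P.b := (hVb.nonneg hκ le_rfl hbmem).lt_of_ne' hne
    have h1 : ∀ᶠ x in 𝓝 P.b, 0 < V x :=
      (hV.cont.continuousAt (Icc_mem_nhds P.a_lt_b P.b_lt_t)).eventually (lt_mem_nhds hb)
    obtain ⟨c, hc, hc'⟩ := (nhds_basis_Ioo' ⟨P.a, P.a_lt_b⟩ ⟨P.t, P.b_lt_t⟩).mem_iff.1
      (h1.and (gt_mem_nhds P.b_lt_t))
    obtain ⟨d, hd⟩ := exists_between hc.2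
    have hdt : d < P.t := (hc' ⟨hc.1.trans hd.1, hd.2⟩).2
    have hdpos : ∀ s ∈ Ioo P.a d, 0 < V s := fun s hs => by
      rcases lt_or_ge s P.b with h | h
      · exact hpos s ⟨hs.1, h⟩
      · exact (hc' ⟨hc.1.trans_le h, hs.2.trans hd.2⟩).1
    have h2 := le_csSup (⟨1, fun x hx => hx.1.2.le⟩ : BddAbove
      {b : ℝ | b ∈ Ioo P.a 1 ∧ ∃ w : ℝ → ℝ, m.IsGraphOrbit P.a ST τ b w})
      ⟨⟨P.a_lt_b.trans hd.1, hdt.trans P.t_lt_one⟩, _, by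
        rw [hP.a_eq]; exact hP.isGraphOrbit_of_isProfile hV hdt.le hdpos⟩
    rw [hSm, ← hP.b_eq] at h2
    exact h2.not_gt hd.1
  · intro h0
    rw [← hP.b_eq]
    refine IsGreatest.csSup_eq ⟨⟨⟨P.a_lt_b, P.b_mem.2⟩, fun s => P.lo s - √(2 * V s), ?_⟩, ?_⟩
    · rw [hP.a_eq, hP.b_eq]
      rw [hP.b_eq] at hpos
      exact hP.isGraphOrbit_of_isProfile hV (hP.b_eq ▸ P.b_lt_t.le) hpos
    · rintro c ⟨-, w, hw⟩
      by_contra! hlt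
      rw [hP.a_eq, hP.b_eq] at hw
      have h1 := (hP.isProfile_of_isGraphOrbit hw hlt P.b_lt_t.le).eq hVb le_rfl hbmem
      have h2 := (hw.2.2 P.b ⟨hP.a_eq ▸ P.a_lt_b, hlt⟩).1
      rw [← hP.lo_eq] at h2
      rw [h0] at h1
      have h3 : 0 < P.lo P.b - w P.b := sub_pos.2 h2
      have : 0 < (P.lo P.b - w P.b) ^ 2 / 2 := by positivity
      exact this.ne' h1

variable (hc : 0 < m.speed SB ST)
include hc

theorem le_tauI_iff : τ ≤ m.tauI SB ST ↔
    4 * (m.speed SB ST * τ) * deriv P.g P.b ≤ deriv P.lo P.b ^ 2 := by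
  have hg := P.g_deriv_pos
  rw [hP.g_eq, hP.b_eq] at hg
  rw [tauI, le_div_iff₀ (by positivity), hP.g_eq, hP.b_eq, hP.lo_eq,
    show τ * (4 * m.speed SB ST * deriv (m.G SB ST) ST) =
      4 * (m.speed SB ST * τ) * deriv (m.G SB ST) ST by ring]

theorem le_tauD_iff : τ ≤ m.tauD SB ST ↔
    4 * (m.speed SB ST * τ) * deriv P.g P.b ≤ deriv P.hi P.b ^ 2 := by
  have hg := P.g_deriv_pos
  rw [hP.g_eq, hP.b_eq] at hg
  rw [tauD, le_div_iff₀ (by positivity), hP.g_eq, hP.b_eq, hP.hi_eq,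
    show τ * (4 * m.speed SB ST * deriv (m.G SB ST) ST) =
      4 * (m.speed SB ST * τ) * deriv (m.G SB ST) ST by ring]

theorem eq_tauD_of_eq
    (h : 4 * (m.speed SB ST * τ) * deriv P.g P.b = deriv P.hi P.b ^ 2) : τ = m.tauD SB ST := by
  have hg := P.g_deriv_pos
  rw [hP.g_eq, hP.b_eq] at hg
  rw [hP.g_eq, hP.b_eq, hP.hi_eq] at h
  rw [tauD, eq_div_iff (by positivity), ← h]
  ring

/-- For small `τ` the orbit does not pass the line `S = ST`. -/
theorem exists_Sm_eq : ∃ τ, 0 < τ ∧ m.Sm SB ST τ = ST := by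
  obtain ⟨κ, hκ, hκ'⟩ := P.exists_profile_b_eq_zero
  have h1 : m.speed SB ST * (κ / m.speed SB ST) = κ := mul_div_cancel₀ _ hc.ne'
  obtain ⟨V, hV⟩ := P.exists_profile hκ
  refine ⟨κ / m.speed SB ST, by positivity, ?_⟩
  rw [hP.Sm_eq_iff (V := V) (by rwa [h1]) (by rwa [h1])]
  exact hκ' κ V hκ le_rfl (hV.mono P.b_lt_t.le)

/-- An orbit that does not pass the line `S = ST` approaches it monotonically. -/
theorem le_tauI_of_Sm_eq (hτ : 0 < τ) (hSm : m.Sm SB ST τ = ST) : τ ≤ m.tauI SB ST := by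
  have hκ : 0 < m.speed SB ST * τ := mul_pos hc hτ
  obtain ⟨V, hV⟩ := P.exists_profile hκ
  obtain ⟨S, p, h⟩ := P.exists_path hκ
  rw [hP.Sm_eq_iff hκ hV] at hSm
  have hne : ¬ ∃ ξ, S ξ = P.b := by rw [h.crosses_iff hV, hSm]; exact lt_irrefl _
  rw [hP.le_tauI_iff hc]
  by_contra! hlt
  exact h.not_eventually_lt hlt (Eventually.of_forall (h.lt_b_of_ne (not_exists.1 hne)))

theorem bddAbove_Sm_eq : BddAbove {τ : ℝ | 0 < τ ∧ m.Sm SB ST τ = ST} :=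
  ⟨m.tauI SB ST, fun _ hτ => hP.le_tauI_of_Sm_eq hc hτ.1 hτ.2⟩

theorem tauM_pos : 0 < m.tauM SB ST := by
  obtain ⟨τ, hτ, hSm⟩ := hP.exists_Sm_eq hc
  exact hτ.trans_le (le_csSup (hP.bddAbove_Sm_eq hc) ⟨hτ, hSm⟩)

theorem tauM_le_tauI : m.tauM SB ST ≤ m.tauI SB ST :=
  csSup_le (hP.exists_Sm_eq hc) fun _ hτ => hP.le_tauI_of_Sm_eq hc hτ.1 hτ.2

/-- The profiles depend monotonically and Lipschitz continuously on `τ`; hence the set of `τ` for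
which the orbit does not pass the line `S = ST` is a half-open interval `(0, τ_m]`. -/
theorem le_tauM_iff (hτ : 0 < τ) (hV : P.IsProfile (m.speed SB ST * τ) P.t V) :
    τ ≤ m.tauM SB ST ↔ V P.b = 0 := by
  have hκ : 0 < m.speed SB ST * τ := mul_pos hc hτ
  have hbmem : P.b ∈ Icc P.a P.b := ⟨P.a_lt_b.le, le_rfl⟩
  have hVb := hV.mono P.b_lt_t.le
  refine ⟨fun hle => ?_, fun h0 =>
    le_csSup (hP.bddAbove_Sm_eq hc) ⟨hτ, (hP.Sm_eq_iff hκ hV).2 h0⟩⟩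
  by_contra hne
  have hpos : 0 < V P.b := (hVb.nonneg hκ le_rfl hbmem).lt_of_ne' hne
  obtain ⟨C, hC, hC'⟩ := P.exists_abs_le
  have hC0 : 0 ≤ m.speed SB ST * C * (P.b - P.a) := by
    have := sub_pos.2 P.a_lt_b
    positivity
  set D := m.speed SB ST * C * (P.b - P.a) + 1 with hD
  have hD0 : 0 < D := by linarith
  have hgap : m.tauM SB ST ≤ τ - V P.b / D := by
    refine csSup_le (hP.exists_Sm_eq hc) fun τ' hτ' => ?_
    have hκ' : 0 < m.speed SB ST * τ' := mul_pos hc hτ'.1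
    obtain ⟨V', hV'⟩ := P.exists_profile hκ'
    have h0 := (hP.Sm_eq_iff hκ' hV').1 hτ'.2
    have hVb' := hV'.mono P.b_lt_t.le
    have hlt : τ' < τ := by
      by_contra! h
      have := hVb.le_of_le hVb' (mul_le_mul_of_nonneg_left h hc.le) le_rfl hbmem
      linarith
    have h1 := hVb'.sub_le hVb (mul_le_mul_of_nonneg_left hlt.le hc.le) le_rfl
      (fun x hx => (hC' x hx).2.2) hbmem
    rw [le_sub_comm, div_le_iff₀ hD0]
    rw [h0] at h1
    linarith
  have := div_pos hpos hD0
  linarith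

end Governs

end Medium

end TwoPhase

/-! ### The behaviour of the orbits -/

namespace TwoPhase

namespace Medium

variable {m : Medium} {P : PlaySystem} {SB ST τ κ : ℝ} {S p : ℝ → ℝ}

namespace Governs

variable (hP : Governs P m SB ST) (h : P.IsPath κ S p)
include hP h

theorem satisfiesBC : SatisfiesBC SB ST S p := by
  have hdp : deriv p = fun ξ => P.g (S ξ) := funext fun ξ => (h.solves ξ).eq_p.deriv
  have ha := (PlaySystem.hasDerivAt_g (P := P) P.a_mem).continuousAt.tendsto.comp h.tendsto_S
  have hb := (PlaySystem.hasDerivAt_g (P := P) P.b_mem).continuousAt.tendsto.comp h.tendsto_b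
  rw [P.g_a] at ha
  rw [P.g_b] at hb
  refine ⟨hP.a_eq ▸ h.tendsto_S, hP.b_eq ▸ h.tendsto_b, ?_, ?_⟩
  · rw [hdp]; exact ha
  · rw [hdp]; exact hb

theorem exists_passage_below (hex : ∃ ξ, S ξ = P.b) : ∃ ξ, S ξ = ST ∧ p ξ < m.pci ST := by
  obtain ⟨ξ, h1, h2, -⟩ := h.exists_first_crossing hex
  exact ⟨ξ, hP.b_eq ▸ h1, by rwa [hP.b_eq, hP.lo_eq] at h2⟩

theorem turnsFinitelyOften (hev : ∀ᶠ ξ in atTop, S ξ ≠ P.b) : m.TurnsFinitelyOften ST S p := by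
  have h1 := h.finite_all_crossings hev
  rw [hP.b_eq] at h1 hev
  exact ⟨h1.subset fun ξ ⟨_, _, hξ⟩ => hξ.start_below.1, hev⟩

theorem turnsInfinitelyOften (hfreq : ∃ᶠ ξ in atTop, S ξ = P.b) :
    m.TurnsInfinitelyOften ST S p := by
  obtain ⟨s, hs, hs', hturn⟩ := h.exists_turns hfreq
  simp only [hP.b_eq, hP.lo_eq, hP.hi_eq] at hturn
  refine ⟨s, hs, hs', fun n => ?_⟩
  obtain ⟨h1, d, h2, h3, h4, h5, h6⟩ := hturn n
  exact ⟨d, h2, h3, h1, h4, h5, h6, (hturn (n + 1)).1⟩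

theorem tendsto_infDist_eqSegment :
    Tendsto (fun ξ => Metric.infDist (S ξ, p ξ) (m.eqSegment ST)) atTop (𝓝 0) := by
  have := h.tendsto_infDist_segment
  rwa [hP.b_eq, hP.lo_eq, hP.hi_eq] at this

end Governs

end Medium

end TwoPhase

theorem mainTheorem1 (m : TwoPhase.Medium) (So SB Ss ST : ℝ)
    (hA : m.ScenarioA So) (hSB : 0 < SB) (hSBSo : SB < So)
    (hSs : m.IsSStar SB Ss) (hST : SB < ST) (hSTSs : ST ≤ Ss)
    (hid : m.tauI SB ST < m.tauD SB ST) :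
    0 < m.tauM SB ST ∧ m.tauM SB ST ≤ m.tauI SB ST ∧
    ∀ τ : ℝ, 0 < τ →
      (∃ S p : ℝ → ℝ, m.IsOrbit SB ST τ S p) ∧
      ∀ S p : ℝ → ℝ, m.IsOrbit SB ST τ S p →
        TwoPhase.Medium.SatisfiesBC SB ST S p ∧
        (τ ≤ m.tauM SB ST →
          (∀ ξ, p ξ < m.pci (S ξ)) ∧ StrictMono S ∧ StrictAnti p ∧
          Tendsto S atTop (𝓝 ST) ∧ Tendsto p atTop (𝓝 (m.pci ST))) ∧
        (m.tauM SB ST < τ → τ ≤ m.tauI SB ST →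
          (∃ ξ, S ξ = ST ∧ p ξ < m.pci ST) ∧ m.TurnsFinitelyOften ST S p ∧
          Tendsto S atTop (𝓝 ST) ∧
          (Tendsto p atTop (𝓝 (m.pci ST)) ∨ Tendsto p atTop (𝓝 (m.pcd ST)))) ∧
        (m.tauI SB ST < τ → τ ≤ m.tauD SB ST →
          (τ = m.tauD SB ST → TwoPhase.HolderDerivAt m.pcd ST) →
          (∃ ξ, S ξ = ST ∧ p ξ < m.pci ST) ∧ m.TurnsFinitelyOften ST S p ∧
          Tendsto S atTop (𝓝 ST) ∧ Tendsto p atTop (𝓝 (m.pcd ST))) ∧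
        (m.tauD SB ST < τ →
          m.TurnsInfinitelyOften ST S p ∧
          Tendsto (fun ξ => Metric.infDist (S ξ, p ξ) (m.eqSegment ST)) atTop (𝓝 0)) := by
  obtain ⟨P, hlo, hhi, hg, ha, hb⟩ :=
    TwoPhase.Medium.exists_playSystem hA hSB hSBSo hSs hST hSTSs
  have hP : TwoPhase.Medium.Governs P m SB ST := ⟨hlo, hhi, hg, ha, hb⟩
  have hc : 0 < m.speed SB ST := TwoPhase.Medium.speed_pos hA hSB ⟨hST, hb ▸ P.b_mem.2⟩
  refine ⟨hP.tauM_pos hc, hP.tauM_le_tauI hc, fun τ hτ => ?_⟩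
  have hκ : 0 < m.speed SB ST * τ := mul_pos hc hτ
  simp only [hP.isOrbit_iff hκ]
  refine ⟨P.exists_path hκ, fun S p h => ?_⟩
  obtain ⟨V, hV⟩ := P.exists_profile hκ
  have hV0 : 0 ≤ V P.b :=
    (hV.mono P.b_lt_t.le).nonneg hκ le_rfl ⟨P.a_lt_b.le, le_rfl⟩
  have hbc := hP.satisfiesBC h
  have hcross : m.tauM SB ST < τ → ∃ ξ, S ξ = P.b := fun hlt => by
    rw [h.crosses_iff hV]
    exact hV0.lt_of_ne' fun h0 => hlt.not_ge ((hP.le_tauM_iff hc hτ hV).2 h0)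
  have hlim_lo : (∀ᶠ ξ in atTop, S ξ < P.b) → Tendsto p atTop (𝓝 (m.pci ST)) := fun hev => by
    have := h.tendsto_lo_b hev
    rwa [hb, hlo] at this
  have hlim_hi : (∀ᶠ ξ in atTop, P.b < S ξ) → Tendsto p atTop (𝓝 (m.pcd ST)) := fun hev => by
    have := h.tendsto_hi_b hev
    rwa [hb, hhi] at this
  have hev : τ ≤ m.tauD SB ST → (τ = m.tauD SB ST → TwoPhase.HolderDerivAt m.pcd ST) →
      ∀ᶠ ξ in atTop, S ξ ≠ P.b := fun hle hhol => by
    refine not_frequently.1 (h.not_frequently ((hP.le_tauD_iff hc).1 hle) fun heq => ?_)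
    rw [hb, hhi]
    exact hhol (hP.eq_tauD_of_eq hc heq)
  have hnlt : m.tauI SB ST < τ → ¬ ∀ᶠ ξ in atTop, S ξ < P.b := fun hlt =>
    h.not_eventually_lt (not_le.1 fun hle => hlt.not_ge ((hP.le_tauI_iff hc).2 hle))
  refine ⟨hbc, fun hle => ?_, fun hlt hle => ?_, fun hlt hle hhol => ?_, fun hlt => ?_⟩
  · have hne : ∀ ξ, S ξ ≠ P.b := not_exists.1 fun hex =>
      ((h.crosses_iff hV).1 hex).ne' ((hP.le_tauM_iff hc hτ hV).1 hle)
    exact ⟨fun ξ => hlo ▸ h.lt_lo_of_ne hne ξ, h.strictMono_of_ne hne, h.strictAnti_of_ne hne,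
      hbc.2.1, hlim_lo (Eventually.of_forall (h.lt_b_of_ne hne))⟩
  · have hne := hev (hle.trans hid.le) fun heq => absurd (heq ▸ hle) hid.not_ge
    exact ⟨hP.exists_passage_below h (hcross hlt), hP.turnsFinitelyOften h hne, hbc.2.1,
      (h.eventually_lt_or_gt hne).imp hlim_lo hlim_hi⟩
  · have hne := hev hle hhol
    exact ⟨hP.exists_passage_below h (hcross ((hP.tauM_le_tauI hc).trans_lt hlt)),
      hP.turnsFinitelyOften h hne, hbc.2.1,
      hlim_hi ((h.eventually_lt_or_gt hne).resolve_left (hnlt hlt))⟩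
  · refine ⟨hP.turnsInfinitelyOften h fun hne => ?_, hP.tendsto_infDist_eqSegment h⟩
    rcases h.eventually_lt_or_gt hne with h1 | h1
    · exact hnlt (hid.trans hlt) h1
    · exact h.not_eventually_gt
        (not_le.1 fun hle => hlt.not_ge ((hP.le_tauD_iff hc).2 hle)) h1
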